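/- Let $(\Omega,\mathcal F,\mathbb P)$ be a probability space with a measure-preserving, ergodic action $(\tau_k)_{k\in\mathbb Z^d}$ of $\mathbb Z^d$, and let $Q=[-\frac12,\frac12]^d$. A field $F(x,\omega)$ is called stationary if $F(x+k,\omega)=F(x,\tau_k\omega)$ for all $k\in\mathbb Z^d$ and almost all $(x,\omega)$. Let $A_{per},C_{per}:\mathbb R^d\to\mathbb R^{d\times d}$ be measurable and $\mathbb Z^d$-periodic, and let $M>0$ and $0<\alpha\le\beta$ be such that for all $\xi\in\mathbb R^d$, almost all $x$ and all $s\in[-M,M]$, $$\alpha|\xi|^2\le (A_{per}+sC_{per})(x)\xi\cdot\xi,\qquad |(A_{per}+sC_{per})(x)\xi|\le\beta|\xi| .$$ For $\eta>0$ let $b_\eta(x,\omega)=\sum_{k\in\mathbb Z^d}\mathbf 1_{Q+k}(x)B_\eta(\tau_k\omega)$ with $\|B_\eta\|_{L^\infty(\Omega)}\le M$, and assume that there are $\bar B_0,\bar R_0\in L^2(\Omega)$ with $$B_\eta=\eta\bar B_0+\eta^2\bar R_0+o(\eta^2)\ \text{ weakly in } L^2(\Omega)\text{ as }\eta\to0^+,\qquad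 \sum_{k\in\mathbb Z^d}|\operatorname{cov}(\bar B_0,\bar B_0(\tau_k\cdot))|<\infty .$$ Put $\bar b_0=\sum_k\mathbf 1_{Q+k}\bar B_0(\tau_k\omega)$, $\bar r_0=\sum_k\mathbf 1_{Q+k}\bar R_0(\tau_k\omega)$ and $A_\eta=A_{per}+b_\eta C_{per}$. For $1\le i,j\le d$ consider the following problems. Their solutions are in $H^1_{loc}(\mathbb R^d)$ (almost surely, for the random ones), the equations hold in the sense of distributions on $\mathbb R^d$, and stationary gradients are required to be in $L^2(Q\times\Omega)$: - $-\operatorname{div}(A_{per}(\nabla w_i^0+e_i))=0$ and $-\operatorname{div}(A_{per}^T(\nabla\tilde w_j^0+e_j))=0$, with $w_i^0,\tilde w_j^0$ $\mathbb Z^d$-periodic; - $-\operatorname{div}(A_\eta(\nabla w_i^\eta+e_i))=0$, with $\nabla w_i^\eta$ stationary and $\mathbb E\int_Q\nabla w_i^\eta=0$; - $-\operatorname{div}(A_{per}\nabla v_i^0)=\operatorname{div}(\bar b_0C_{per}(\nabla w_i^0+e_i))$, with $\nabla v_i^0$ stationary and $\mathbb E\int_Q\nabla v_i^0=0$; - $-\operatorname{div}(A_{per}\nabla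 s_i)=\operatorname{div}(C_{per}(\nabla w_i^0+e_i))$, with $s_i$ $\mathbb Z^d$-periodic; - $-\operatorname{div}(A_{per}\nabla t_i)=\operatorname{div}(C_{per}\mathbf 1_Q(\nabla w_i^0+e_i))$, with $\nabla t_i\in L^2(\mathbb R^d)$. Then all these problems have solutions. For any choice of solutions, the series below converges absolutely, and the coefficient $$\tilde A_2^*e_i\cdot e_j:=\int_Q\mathbb E(\bar r_0)\,C_{per}(\nabla w_i^0+e_i)\cdot(\nabla\tilde w_j^0+e_j)+\int_Q C_{per}\,\mathbb E(\bar b_0\nabla v_i^0)\cdot(\nabla\tilde w_j^0+e_j)$$ is given by the deterministic formula $$\begin{aligned}\tilde A_2^*e_i\cdot e_j={}&\mathbb E(\bar R_0)\int_Q C_{per}(\nabla w_i^0+e_i)\cdot(\nabla\tilde w_j^0+e_j)+\operatorname{Var}(\bar B_0)\int_Q C_{per}\nabla t_i\cdot(\nabla\tilde w_j^0+e_j)\\&+(\mathbb E(\bar B_0))^2\int_Q C_{per}\nabla s_i\cdot(\nabla\tilde w_j^0+e_j)\\&+\sum_{k\in\mathbb Z^d,\,k\ne0}\operatorname{cov}(\bar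 B_0,\bar B_0(\tau_k\cdot))\int_Q C_{per}\nabla t_i(\cdot-k)\cdot(\nabla\tilde w_j^0+e_j).\end{aligned}$$ Moreover, this is the second-order coefficient of the homogenized tensor: with $A_\eta^*e_i=\mathbb E\int_Q A_\eta(\nabla w_i^\eta+e_i)$, $A_{per}^*e_i=\int_Q A_{per}(\nabla w_i^0+e_i)$ and $\tilde A_1^*e_i=\int_Q\mathbb E(\bar b_0)C_{per}(\nabla w_i^0+e_i)+\int_Q A_{per}\,\mathbb E(\nabla v_i^0)$, one has $$A_\eta^*=A_{per}^*+\eta\tilde A_1^*+\eta^2\tilde A_2^*+o(\eta^2)\qquad(\eta\to0^+).$$ -/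

import Mathlib

open MeasureTheory ProbabilityTheory Filter Topology

namespace WeakRandomHom

noncomputable section

/-- Euclidean space `ℝ^d`. -/
abbrev Space (d : ℕ) : Type := EuclideanSpace ℝ (Fin d)

/-- The point of `ℝ^d` with the integer coordinates `k`. -/
def latt {d : ℕ} (k : Fin d → ℤ) : Space d := WithLp.toLp 2 (fun i => (k i : ℝ))

/-- The `i`-th vector of the canonical basis of `ℝ^d`. -/
def basisVec {d : ℕ} (i : Fin d) : Space d := EuclideanSpace.single i 1

/-- The unit cell `Q = [-1/2, 1/2]^d`. -/
def cell (d : ℕ) : Set (Space d) := {x | ∀ i, x i ∈ Set.Icc (-(1 / 2) : ℝ) (1 / 2)}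

/-- The product of a `d × d` matrix with a vector of `ℝ^d`. -/
def app {d : ℕ} (A : Matrix (Fin d) (Fin d) ℝ) (v : Space d) : Space d :=
  Matrix.toEuclideanLin A v

/-- `ℤ^d`-periodicity, almost everywhere. -/
def IsPeriodic {d : ℕ} {β : Type*} (f : Space d → β) : Prop :=
  ∀ k : Fin d → ℤ, ∀ᵐ x, f (x + latt k) = f x

/-- Membership in `L²_loc(ℝ^d)`. -/
def LocallyL2 {d : ℕ} {F : Type*} [NormedAddCommGroup F] (f : Space d → F) : Prop :=
  ∀ K : Set (Space d), IsCompact K → MemLp f 2 (volume.restrict K)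

/-- Test functions: smooth, compactly supported, real-valued functions on `ℝ^d`. -/
def IsTest {d : ℕ} (φ : Space d → ℝ) : Prop :=
  ContDiff ℝ (⊤ : ℕ∞) φ ∧ HasCompactSupport φ

/-- `u` and its weak gradient `Du` are both in `L²_loc(ℝ^d)`. -/
structure IsWeakGradient {d : ℕ} (u : Space d → ℝ) (Du : Space d → Space d) : Prop where
  fun_loc : LocallyL2 u
  grad_loc : LocallyL2 Du
  by_parts : ∀ φ : Space d → ℝ, IsTest φ → ∫ x, u x • gradient φ x = -∫ x, φ x • Du x

/-- The equation `- div F = div H` in the sense of distributions on `ℝ^d`. -/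
def NegDivEqDiv {d : ℕ} (F H : Space d → Space d) : Prop :=
  ∀ φ : Space d → ℝ, IsTest φ →
    ∫ x, inner ℝ (F x) (gradient φ x) = -∫ x, inner ℝ (H x) (gradient φ x)

/-! ### Deterministic problems -/

/-- `w`, with gradient `Dw`, solves the `i`-th periodic cell problem
`- div (A (∇w + e_i)) = 0`, `w` periodic. -/
structure IsPeriodicCorrector {d : ℕ} (A : Space d → Matrix (Fin d) (Fin d) ℝ) (i : Fin d)
    (w : Space d → ℝ) (Dw : Space d → Space d) : Prop where
  isGrad : IsWeakGradient w Dw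
  periodic : IsPeriodic w
  eqn : NegDivEqDiv (fun x => app (A x) (Dw x + basisVec i)) (fun _ => 0)

/-- `s`, with gradient `Ds`, solves `- div (A ∇s) = div (C (∇w + e_i))`, `s` periodic. -/
structure IsPeriodicResponse {d : ℕ} (A C : Space d → Matrix (Fin d) (Fin d) ℝ) (i : Fin d)
    (Dw : Space d → Space d) (s : Space d → ℝ) (Ds : Space d → Space d) : Prop where
  isGrad : IsWeakGradient s Ds
  periodic : IsPeriodic s
  eqn : NegDivEqDiv (fun x => app (A x) (Ds x)) (fun x => app (C x) (Dw x + basisVec i))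

/-- `t`, with gradient `Dt`, solves the single-defect problem
`- div (A ∇t) = div (C 1_Q (∇w + e_i))` in `ℝ^d`, with `∇t ∈ L²(ℝ^d)`. -/
structure IsDefectSolution {d : ℕ} (A C : Space d → Matrix (Fin d) (Fin d) ℝ) (i : Fin d)
    (Dw : Space d → Space d) (t : Space d → ℝ) (Dt : Space d → Space d) : Prop where
  isGrad : IsWeakGradient t Dt
  grad_memLp : MemLp Dt 2 volume
  eqn : NegDivEqDiv (fun x => app (A x) (Dt x))
    (fun x => app (C x) ((cell d).indicator (fun y => Dw y + basisVec i) x))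

/-! ### Random fields -/

section Random

variable {d : ℕ} {Ω : Type*} [MeasurableSpace Ω] [AddAction (Fin d → ℤ) Ω]

/-- The random field `∑_k 1_{Q+k}(x) X(τ_k ω)`; the action `τ_k ω` is written `k +ᵥ ω`. -/
def cellField (X : Ω → ℝ) (x : Space d) (ω : Ω) : ℝ :=
  ∑' k : Fin d → ℤ, {y : Space d | y - latt k ∈ cell d}.indicator (fun _ => X (k +ᵥ ω)) x

/-- Stationarity: `F(x + k, ω) = F(x, τ_k ω)` almost everywhere in `x` and `ω`. -/
def IsStationary (P : Measure Ω) {β : Type*} (F : Space d → Ω → β) : Prop :=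
  ∀ k : Fin d → ℤ, ∀ᵐ p ∂((volume : Measure (Space d)).prod P),
    F (p.1 + latt k) p.2 = F p.1 (k +ᵥ p.2)

/-- `Du` is the gradient of the random function `u`; it is a stationary field, lies in
`L²(Q × Ω)`, and `𝔼 ∫_Q Du = 0`. The function `u` itself is only relevant up to the addition of
a random constant, so that stationarity and joint measurability concern `Du` only. -/
structure IsStationaryGradient (P : Measure Ω) (u : Space d → Ω → ℝ) (Du : Space d → Ω → Space d) :
    Prop where
  meas : AEStronglyMeasurable (Function.uncurry Du) ((volume : Measure (Space d)).prod P)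
  memLp : MemLp (Function.uncurry Du) 2 ((volume.restrict (cell d)).prod P)
  isGrad : ∀ᵐ ω ∂P, IsWeakGradient (fun x => u x ω) (fun x => Du x ω)
  stationary : IsStationary P Du
  mean_zero : ∫ ω, (∫ x in cell d, Du x ω) ∂P = 0

/-- `w`, with gradient `Dw`, solves the `i`-th stochastic cell problem
`- div (A (∇w + e_i)) = 0` in `ℝ^d`, `∇w` stationary, `𝔼 ∫_Q ∇w = 0`. -/
structure IsCorrector (P : Measure Ω) (A : Space d → Ω → Matrix (Fin d) (Fin d) ℝ) (i : Fin d)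
    (w : Space d → Ω → ℝ) (Dw : Space d → Ω → Space d) : Prop where
  isGrad : IsStationaryGradient P w Dw
  eqn : ∀ᵐ ω ∂P, NegDivEqDiv (fun x => app (A x ω) (Dw x ω + basisVec i)) (fun _ => 0)

/-- `v`, with gradient `Dv`, solves `- div (A ∇v) = div (b C (∇w + e_i))` in `ℝ^d`,
`∇v` stationary, `𝔼 ∫_Q ∇v = 0`. -/
structure IsRandomResponse (P : Measure Ω) (A C : Space d → Matrix (Fin d) (Fin d) ℝ) (i : Fin d)
    (b : Space d → Ω → ℝ) (Dw : Space d → Space d)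
    (v : Space d → Ω → ℝ) (Dv : Space d → Ω → Space d) : Prop where
  isGrad : IsStationaryGradient P v Dv
  eqn : ∀ᵐ ω ∂P, NegDivEqDiv (fun x => app (A x) (Dv x ω))
    (fun x => b x ω • app (C x) (Dw x + basisVec i))

/-- The perturbed tensor `A_per(x) + b(x, ω) C_per(x)`. -/
def perturbed (A C : Space d → Matrix (Fin d) (Fin d) ℝ) (b : Space d → Ω → ℝ)
    (x : Space d) (ω : Ω) : Matrix (Fin d) (Fin d) ℝ :=
  A x + b x ω • C x

/-- The vector `A* e_i = 𝔼 ∫_Q A (∇w + e_i)` of the stochastic homogenized tensor, where `Dw` is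
the gradient of the `i`-th corrector. -/
def homogenized (P : Measure Ω) (A : Space d → Ω → Matrix (Fin d) (Fin d) ℝ) (i : Fin d)
    (Dw : Space d → Ω → Space d) : Space d :=
  ∫ ω, (∫ x in cell d, app (A x ω) (Dw x ω + basisVec i)) ∂P

/-- The vector `A_per* e_i = ∫_Q A_per (∇w + e_i)` of the periodic homogenized tensor. -/
def periodicHomogenized (A : Space d → Matrix (Fin d) (Fin d) ℝ) (i : Fin d)
    (Dw : Space d → Space d) : Space d :=
  ∫ x in cell d, app (A x) (Dw x + basisVec i)

/-- The first-order vector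
`Ã₁ e_i = ∫_Q 𝔼(b) C (∇w + e_i) + ∫_Q A 𝔼(∇v)`. -/
def firstOrder (P : Measure Ω) (A C : Space d → Matrix (Fin d) (Fin d) ℝ) (i : Fin d)
    (b : Space d → Ω → ℝ) (Dw : Space d → Space d) (Dv : Space d → Ω → Space d) : Space d :=
  (∫ x in cell d, (∫ ω, b x ω ∂P) • app (C x) (Dw x + basisVec i)) +
    ∫ x in cell d, app (A x) (∫ ω, Dv x ω ∂P)

/-- The pairing `∫_Q C F · G`. -/
def pairing (C : Space d → Matrix (Fin d) (Fin d) ℝ) (F G : Space d → Space d) : ℝ :=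
  ∫ x in cell d, inner ℝ (app (C x) (F x)) (G x)

/-- The second-order coefficient through the random field `∇v`:
`∫_Q 𝔼(r) C (∇w + e_i) · (∇w̃ + e_j) + ∫_Q C 𝔼(b ∇v) · (∇w̃ + e_j)`. -/
def secondOrder (P : Measure Ω) (C : Space d → Matrix (Fin d) (Fin d) ℝ) (i j : Fin d)
    (b r : Space d → Ω → ℝ) (Dw Dwt : Space d → Space d) (Dv : Space d → Ω → Space d) : ℝ :=
  (∫ x in cell d, inner ℝ ((∫ ω, r x ω ∂P) • app (C x) (Dw x + basisVec i)) (Dwt x + basisVec j)) +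
    pairing C (fun x => ∫ ω, b x ω • Dv x ω ∂P) (fun x => Dwt x + basisVec j)

/-- The summand of index `k` in the correlation series:
`cov(B, B(τ_k ·)) ∫_Q C ∇t(· - k) · (∇w̃ + e_j)`. -/
def covTerm (P : Measure Ω) (C : Space d → Matrix (Fin d) (Fin d) ℝ) (j : Fin d) (B : Ω → ℝ)
    (Dwt Dt : Space d → Space d) (k : Fin d → ℤ) : ℝ :=
  cov[B, fun ω => B (k +ᵥ ω); P] *
    pairing C (fun x => Dt (x - latt k)) (fun x => Dwt x + basisVec j)

/-- The deterministic formula for the second-order coefficient. -/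
def deterministicSecondOrder (P : Measure Ω) (C : Space d → Matrix (Fin d) (Fin d) ℝ)
    (i j : Fin d) (B R : Ω → ℝ) (Dw Dwt Ds Dt : Space d → Space d) : ℝ :=
  (∫ ω, R ω ∂P) * pairing C (fun x => Dw x + basisVec i) (fun x => Dwt x + basisVec j) +
    Var[B; P] * pairing C Dt (fun x => Dwt x + basisVec j) +
    (∫ ω, B ω ∂P) ^ 2 * pairing C Ds (fun x => Dwt x + basisVec j) +
    ∑' k : {k : Fin d → ℤ // k ≠ 0}, covTerm P C j B Dwt Dt k

end Random

end

end WeakRandomHom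

open WeakRandomHom

namespace WeakRandomHom

open scoped ENNReal NNReal

/-! ### Gradients -/

/-! Functional setting. A stationary field is a function on Q × Ω read along the orbits of the
suspension of the ℤ^d-action, which is a measure-preserving flow of ℝ^d. For any such flow S,
consider the L²-closure of the smoothed gradients ∫ ψ(S_y x) ∇φ(y) dy. Its orthogonal complement
consists of the divergence-free fields (`IsFlow.mem_orthogonal_potentialFields`), its elements have
weak gradients as realisations (`IsFlow.exists_isWeakGradient`), and a curl-free field differs from
an element of it by a field that is constant along orbits (`IsFlow.exists_sub_mem_of_curlFree`).
Three flows are used: the suspension over Ω, the suspension over a point (periodic problems) and the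
translations of ℝ^d (the defect problem). The constant is removed by ergodicity and zero mean in the
first case, by infinite volume in the last. Every problem is then solved by Lax–Milgram on a closed
subspace, and every use of an equation is an orthogonality between a potential and a divergence-free
field.

Deterministic formula. Put Y = C(∇w⁰ + e_i), Z = Cᵀ(∇w̃⁰ + e_j), b = b̄₀, m = 𝔼 B̄₀. No translates
of t are superposed and no decay of ∇t beyond L² is used; instead one passes to a dual problem. Let
ψ be the stationary potential for which Aᵀψ + bZ is divergence-free. Duality gives 𝔼∫_Q ∇v⁰·bZ =
𝔼∫_Q bY·ψ, and 𝔼∫_Q ∇s·bZ = 𝔼∫_Q Y·ψ. Subtracting m times the second from the first leaves ∫_{ℝ^d}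
1_Q Y·Φ with Φ(x) = 𝔼((B̄₀ − m)ψ(x,·)). Summability of the covariances makes the translates of B̄₀ −
m a Bessel family (`sum_inner_sq_le_of_summable`), so Φ ∈ L²(ℝ^d) (`memLp_corrField`). Averaging
keeps Φ curl-free and makes it solve the adjoint equation with source cov(B̄₀, B̄₀(τ_k·)) Z on the
cell Q + k. Duality with ∇t in ℝ^d and unfolding into cells give the series
(`IsCoefficientPair.hasSum_ip_sub`), convergence included.

Expansion. Testing with ∇w̃⁰ + e_j yields the exact identity (A_η* − A_per*)e_i·e_j = 𝔼∫_Q b_η (∇w^η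
+ e_i)·Z (`IsCoefficientPair.homogenized_sub_eq_wip`), so a first-order expansion of ∇w^η is enough.
By uniform boundedness the weak second-order expansion of B_η forces B_η/η → B̄₀ strongly in L²
(`tendsto_eLpNorm_of_weak_expansion`). The energy estimate then gives ∇w^η = ∇w⁰ + η∇v⁰ + o(η) in
L²(Q × Ω) (`IsCoefficientPair.corrector_remainder_le`), and inserting this in the identity finishes
the proof. -/

lemma inner_gradient_left {d : ℕ} (u : Space d → ℝ) (x v : Space d) :
    inner ℝ (gradient u x) v = fderiv ℝ u x v := by
  rw [gradient, InnerProductSpace.toDual_symm_apply]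

lemma gradient_apply {d : ℕ} (u : Space d → ℝ) (x : Space d) (i : Fin d) :
    gradient u x i = fderiv ℝ u x (basisVec i) := by
  rw [← inner_gradient_left, basisVec, EuclideanSpace.inner_single_right]
  simp

lemma continuous_gradient {d : ℕ} {u : Space d → ℝ} (hu : ContDiff ℝ 1 u) :
    Continuous (gradient u) :=
  (LinearIsometryEquiv.continuous _).comp (hu.continuous_fderiv one_ne_zero)

lemma gradient_sub {d : ℕ} {u v : Space d → ℝ} (hu : ContDiff ℝ 1 u) (hv : ContDiff ℝ 1 v) :
    gradient (fun x => u x - v x) = fun x => gradient u x - gradient v x := by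
  funext x
  simp only [gradient]
  rw [fderiv_fun_sub (hu.differentiable one_ne_zero x) (hv.differentiable one_ne_zero x), map_sub]

lemma gradient_sub_const {d : ℕ} (u : Space d → ℝ) (c : ℝ) :
    gradient (fun x => u x - c) = gradient u := by
  funext x
  simp only [gradient, fderiv_sub_const]

lemma IsTest.contDiff_one {d : ℕ} {φ : Space d → ℝ} (hφ : IsTest φ) : ContDiff ℝ 1 φ :=
  hφ.1.of_le (by exact_mod_cast le_top)

lemma IsTest.continuous_gradient {d : ℕ} {φ : Space d → ℝ} (hφ : IsTest φ) :
    Continuous (gradient φ) :=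
  WeakRandomHom.continuous_gradient hφ.contDiff_one

lemma tsupport_gradient_subset {d : ℕ} (φ : Space d → ℝ) : tsupport (gradient φ) ⊆ tsupport φ := by
  refine (closure_mono ?_).trans (tsupport_fderiv_subset ℝ (f := φ))
  intro x hx
  simp only [Function.mem_support, gradient, ne_eq, EmbeddingLike.map_eq_zero_iff] at hx ⊢
  exact hx

lemma IsTest.hasCompactSupport_gradient {d : ℕ} {φ : Space d → ℝ} (hφ : IsTest φ) :
    HasCompactSupport (gradient φ) :=
  hφ.2.of_isClosed_subset (isClosed_tsupport _) (tsupport_gradient_subset φ)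

/-! ### A Poincaré inequality on balls -/

lemma lintegral_sq_le {α : Type*} [MeasurableSpace α] (ν : Measure α) {f : α → ℝ≥0∞}
    (hf : AEMeasurable f ν) : (∫⁻ x, f x ∂ν) ^ 2 ≤ ν Set.univ * ∫⁻ x, f x ^ 2 ∂ν := by
  have h := ENNReal.lintegral_mul_le_Lp_mul_Lq ν Real.HolderConjugate.two_two
    (aemeasurable_const (b := (1 : ℝ≥0∞))) hf
  have h2 := pow_le_pow_left' h 2
  simp only [Pi.mul_apply, one_mul, ENNReal.one_rpow, lintegral_const, mul_pow] at h2
  simp only [← ENNReal.rpow_natCast, ← ENNReal.rpow_mul] at h2 ⊢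
  norm_num at h2 ⊢
  exact h2

/-- Fundamental theorem of calculus along the segment from y to x, then Cauchy–Schwarz in the
parameter t. -/
lemma enorm_sub_sq_le {d : ℕ} {u : Space d → ℝ} (hu : ContDiff ℝ 1 u) (x y : Space d) :
    ‖u x - u y‖ₑ ^ 2 ≤
      ‖x - y‖ₑ ^ 2 * ∫⁻ t in Set.Ioc (0 : ℝ) 1, ‖gradient u (y + t • (x - y))‖ₑ ^ 2 := by
  have hline : Continuous fun t : ℝ => y + t • (x - y) := by fun_prop
  have hcont : Continuous fun t : ℝ => fderiv ℝ u (y + t • (x - y)) (x - y) :=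
    ((hu.continuous_fderiv one_ne_zero).comp hline).clm_apply continuous_const
  have hder : ∀ t ∈ Set.uIcc (0 : ℝ) 1, HasDerivAt (fun t : ℝ => u (y + t • (x - y)))
      (fderiv ℝ u (y + t • (x - y)) (x - y)) t := by
    intro t _
    have h1 : HasDerivAt (fun t : ℝ => y + t • (x - y)) (x - y) t := by
      simpa using ((hasDerivAt_id t).smul_const (x - y)).const_add y
    exact ((hu.differentiable one_ne_zero _).hasFDerivAt).comp_hasDerivAt t h1
  have hint := intervalIntegral.integral_eq_sub_of_hasDerivAt hder (hcont.intervalIntegrable 0 1)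
  simp only [one_smul, add_sub_cancel, zero_smul, add_zero] at hint
  rw [← hint, intervalIntegral.integral_of_le zero_le_one]
  have hb : ∀ t : ℝ, ‖fderiv ℝ u (y + t • (x - y)) (x - y)‖ₑ ≤
      ‖x - y‖ₑ * ‖gradient u (y + t • (x - y))‖ₑ := by
    intro t
    rw [← inner_gradient_left, mul_comm]
    simp only [← ofReal_norm]
    rw [← ENNReal.ofReal_mul (norm_nonneg _)]
    exact ENNReal.ofReal_le_ofReal (norm_inner_le_norm _ _)
  have hg : Continuous fun t : ℝ => gradient u (y + t • (x - y)) :=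
    (continuous_gradient hu).comp hline
  have hgm : Measurable fun t : ℝ => ‖gradient u (y + t • (x - y))‖ₑ := hg.enorm.measurable
  calc ‖∫ t in Set.Ioc (0 : ℝ) 1, fderiv ℝ u (y + t • (x - y)) (x - y)‖ₑ ^ 2
      ≤ (∫⁻ t in Set.Ioc (0 : ℝ) 1, ‖x - y‖ₑ * ‖gradient u (y + t • (x - y))‖ₑ) ^ 2 := by
        gcongr
        exact (enorm_integral_le_lintegral_enorm _).trans (lintegral_mono hb)
    _ ≤ _ := by
        refine (lintegral_sq_le _ (hgm.const_mul _).aemeasurable).trans ?_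
        simp only [mul_pow]
        rw [lintegral_const_mul _ (hgm.pow_const 2)]
        simp

/-- The Jacobian of x ↦ z + t x is t^d ≥ 2^{-d}; the point is a bound uniform in t ≥ 1/2 and in z.
-/
lemma lintegral_comp_affine_le {d : ℕ} (g : Space d → ℝ≥0∞) (hg : Measurable g) {t : ℝ}
    (ht : 1 / 2 ≤ t) (z : Space d) : ∫⁻ x, g (z + t • x) ≤ 2 ^ d * ∫⁻ x, g x := by
  have ht0 : 0 < t := by linarith
  have h1 : ∫⁻ x, g (z + t • x) = ∫⁻ x, g (z + x) ∂(Measure.map (t • ·) volume) := by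
    rw [lintegral_map (by fun_prop) (by fun_prop)]
  rw [h1, Measure.map_addHaar_smul _ ht0.ne', lintegral_smul_measure,
    lintegral_add_left_eq_self, smul_eq_mul]
  gcongr
  have h2 : |(t ^ Module.finrank ℝ (Space d))⁻¹| ≤ 2 ^ d := by
    rw [finrank_euclideanSpace, Fintype.card_fin, abs_of_pos (by positivity), ← inv_pow]
    gcongr
    rw [inv_le_comm₀ ht0 two_pos]
    linarith
  calc ENNReal.ofReal _ ≤ ENNReal.ofReal (2 ^ d) := ENNReal.ofReal_le_ofReal h2
    _ = 2 ^ d := by rw [ENNReal.ofReal_pow zero_le_two]; simp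

/-- One of t and 1 − t is at least 1/2. Integrating first in the variable that carries this
coefficient keeps the Jacobian below 2^d, whatever t is. Convexity keeps the segment in B, so g may
be cut off outside B. -/
lemma lintegral_lintegral_segment_le {d : ℕ} {B : Set (Space d)} (hB : Convex ℝ B)
    (hBm : MeasurableSet B) (g : Space d → ℝ≥0∞) (hg : Measurable g) {t : ℝ}
    (ht : t ∈ Set.Ioc (0 : ℝ) 1) :
    ∫⁻ x in B, ∫⁻ y in B, g (y + t • (x - y)) ≤ 2 ^ d * volume B * ∫⁻ x in B, g x := by
  have hind : ∀ x ∈ B, ∀ y ∈ B, g (y + t • (x - y)) ≤ B.indicator g ((1 - t) • y + t • x) := by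
    intro x hx y hy
    have h0 : y + t • (x - y) = (1 - t) • y + t • x := by module
    have hmem : (1 - t) • y + t • x ∈ B :=
      hB hy hx (by linarith [ht.2]) ht.1.le (by ring)
    rw [h0, Set.indicator_of_mem hmem]
  have hgi : Measurable (B.indicator g) := hg.indicator hBm
  rcases le_total (1 / 2) t with h | h
  · calc ∫⁻ x in B, ∫⁻ y in B, g (y + t • (x - y))
        ≤ ∫⁻ x in B, ∫⁻ y in B, B.indicator g ((1 - t) • y + t • x) :=
          setLIntegral_mono' hBm fun x hx => setLIntegral_mono' hBm fun y hy => hind x hx y hy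
      _ = ∫⁻ y in B, ∫⁻ x in B, B.indicator g ((1 - t) • y + t • x) :=
          lintegral_lintegral_swap (by fun_prop)
      _ ≤ ∫⁻ y in B, 2 ^ d * ∫⁻ x in B, g x := by
          refine lintegral_mono fun y => (setLIntegral_le_lintegral _ _).trans ?_
          refine (lintegral_comp_affine_le _ hgi h _).trans_eq ?_
          rw [lintegral_indicator hBm]
      _ = _ := by rw [setLIntegral_const]; ring
  · calc ∫⁻ x in B, ∫⁻ y in B, g (y + t • (x - y))
        ≤ ∫⁻ x in B, ∫⁻ y in B, B.indicator g ((1 - t) • y + t • x) :=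
          setLIntegral_mono' hBm fun x hx => setLIntegral_mono' hBm fun y hy => hind x hx y hy
      _ ≤ ∫⁻ x in B, 2 ^ d * ∫⁻ x in B, g x := by
          refine lintegral_mono fun x => (setLIntegral_le_lintegral _ _).trans ?_
          simp only [add_comm _ (t • x)]
          refine (lintegral_comp_affine_le _ hgi (by linarith) _).trans_eq ?_
          rw [lintegral_indicator hBm]
      _ = _ := by rw [setLIntegral_const]; ring

lemma lintegral_lintegral_lintegral_segment_le {d : ℕ} {B : Set (Space d)} (hB : Convex ℝ B)
    (hBm : MeasurableSet B) (g : Space d → ℝ≥0∞) (hg : Measurable g) :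
    ∫⁻ x in B, ∫⁻ y in B, ∫⁻ t in Set.Ioc (0 : ℝ) 1, g (y + t • (x - y)) ≤
      2 ^ d * volume B * ∫⁻ x in B, g x := by
  have h3 : ∀ x : Space d, ∫⁻ y in B, ∫⁻ t in Set.Ioc (0 : ℝ) 1, g (y + t • (x - y)) =
      ∫⁻ t in Set.Ioc (0 : ℝ) 1, ∫⁻ y in B, g (y + t • (x - y)) := by
    intro x
    exact lintegral_lintegral_swap (by fun_prop)
  simp_rw [h3]
  rw [lintegral_lintegral_swap]
  · calc _ ≤ ∫⁻ t in Set.Ioc (0 : ℝ) 1, 2 ^ d * volume B * ∫⁻ x in B, g x :=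
          setLIntegral_mono' measurableSet_Ioc fun t ht =>
            lintegral_lintegral_segment_le hB hBm _ hg ht
      _ = _ := by rw [setLIntegral_const]; simp
  · have h4 : Measurable fun q : (Space d × ℝ) × Space d => g (q.2 + q.1.2 • (q.1.1 - q.2)) := by
      fun_prop
    exact h4.lintegral_prod_right'.aemeasurable

/-- Poincaré inequality on a bounded convex set, in double integral form. -/
lemma lintegral_lintegral_enorm_sub_sq_le {d : ℕ} {u : Space d → ℝ} (hu : ContDiff ℝ 1 u)
    {B : Set (Space d)} (hB : Convex ℝ B) (hBm : MeasurableSet B) {D : ℝ≥0∞} (hDt : D ≠ ⊤)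
    (hD : ∀ x ∈ B, ∀ y ∈ B, ‖x - y‖ₑ ≤ D) :
    ∫⁻ x in B, ∫⁻ y in B, ‖u x - u y‖ₑ ^ 2 ≤
      D ^ 2 * (2 ^ d * volume B * ∫⁻ x in B, ‖gradient u x‖ₑ ^ 2) := by
  obtain ⟨g, hg, hgu⟩ : ∃ g : Space d → ℝ≥0∞, Measurable g ∧ ∀ x, g x = ‖gradient u x‖ₑ ^ 2 :=
    ⟨_, ((continuous_gradient hu).enorm.measurable.pow_const 2), fun _ => rfl⟩
  calc ∫⁻ x in B, ∫⁻ y in B, ‖u x - u y‖ₑ ^ 2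
      ≤ ∫⁻ x in B, ∫⁻ y in B, D ^ 2 * ∫⁻ t in Set.Ioc (0 : ℝ) 1, g (y + t • (x - y)) := by
        refine setLIntegral_mono' hBm fun x hx => setLIntegral_mono' hBm fun y hy => ?_
        refine (enorm_sub_sq_le hu x y).trans ?_
        simp only [hgu]
        gcongr
        exact hD x hx y hy
    _ = D ^ 2 * ∫⁻ x in B, ∫⁻ y in B, ∫⁻ t in Set.Ioc (0 : ℝ) 1, g (y + t • (x - y)) := by
        have hD2 : D ^ 2 ≠ ⊤ := ENNReal.pow_ne_top hDt
        simp_rw [lintegral_const_mul' _ _ hD2]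
    _ ≤ _ := by
        simp only [← hgu]
        gcongr
        exact lintegral_lintegral_lintegral_segment_le hB hBm g hg

/-! ### Auxiliary facts on `L²` -/

lemma eLpNorm_two_sq {α F : Type*} [MeasurableSpace α] [NormedAddCommGroup F] (f : α → F)
    (ν : Measure α) : eLpNorm f 2 ν ^ 2 = ∫⁻ x, ‖f x‖ₑ ^ 2 ∂ν := by
  have := eLpNorm_nnreal_pow_eq_lintegral (f := f) (μ := ν) (p := 2) two_ne_zero
  simp only [ENNReal.coe_ofNat, NNReal.coe_ofNat, ENNReal.rpow_ofNat] at this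
  exact this

lemma integral_euclidean_apply {α : Type*} [MeasurableSpace α] {ν : Measure α} {d : ℕ}
    {f : α → Space d} (hf : Integrable f ν) (i : Fin d) : (∫ x, f x ∂ν) i = ∫ x, f x i ∂ν :=
  ((EuclideanSpace.proj i : Space d →L[ℝ] ℝ).integral_comp_comm hf).symm

lemma MemLp.euclidean_apply {α : Type*} [MeasurableSpace α] {ν : Measure α} {d : ℕ} {p : ℝ≥0∞}
    {f : α → Space d} (hf : MemLp f p ν) (i : Fin d) : MemLp (fun x => f x i) p ν :=
  (EuclideanSpace.proj i : Space d →L[ℝ] ℝ).comp_memLp' hf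

/-- Hölder for an arbitrary continuous bilinear map, so that scalar products and products of a
scalar with a vector need no separate treatment. -/
lemma lintegral_enorm_bilin_le {α F G K : Type*} [MeasurableSpace α] {ν : Measure α}
    [NormedAddCommGroup F] [NormedSpace ℝ F] [NormedAddCommGroup G] [NormedSpace ℝ G]
    [NormedAddCommGroup K] [NormedSpace ℝ K] (L : F →L[ℝ] G →L[ℝ] K) {f : α → F} {g : α → G}
    (hf : AEStronglyMeasurable f ν) (hg : AEStronglyMeasurable g ν) :
    ∫⁻ x, ‖L (f x) (g x)‖ₑ ∂ν ≤ ‖L‖ₑ * (eLpNorm f 2 ν * eLpNorm g 2 ν) := by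
  rw [← eLpNorm_one_eq_lintegral_enorm]
  refine (eLpNorm_le_eLpNorm_mul_eLpNorm_of_nnnorm hf hg (fun a b => L a b) ‖L‖₊ ?_
    (p := 2) (q := 2)).trans_eq ?_
  · refine Eventually.of_forall fun x => ?_
    exact_mod_cast L.le_opNorm₂ (f x) (g x)
  · rw [mul_assoc]
    rfl

lemma integrable_bilin {α F G K : Type*} [MeasurableSpace α] {ν : Measure α}
    [NormedAddCommGroup F] [NormedSpace ℝ F] [NormedAddCommGroup G] [NormedSpace ℝ G]
    [NormedAddCommGroup K] [NormedSpace ℝ K] (L : F →L[ℝ] G →L[ℝ] K) {f : α → F} {g : α → G}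
    (hf : MemLp f 2 ν) (hg : MemLp g 2 ν) : Integrable (fun x => L (f x) (g x)) ν := by
  refine ⟨L.aestronglyMeasurable_comp₂ hf.1 hg.1, ?_⟩
  refine (lintegral_enorm_bilin_le L hf.1 hg.1).trans_lt ?_
  exact ENNReal.mul_lt_top (by simp) (ENNReal.mul_lt_top hf.2 hg.2)

lemma tendsto_integral_bilin {ι α F G K : Type*} [MeasurableSpace α] {ν : Measure α}
    [NormedAddCommGroup F] [NormedSpace ℝ F] [NormedAddCommGroup G] [NormedSpace ℝ G]
    [NormedAddCommGroup K] [NormedSpace ℝ K] (L : F →L[ℝ] G →L[ℝ] K) {l : Filter ι}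
    {f : ι → α → F} {f₀ : α → F} {g : α → G}
    (hf : ∀ k, MemLp (f k) 2 ν) (hf₀ : MemLp f₀ 2 ν) (hg : MemLp g 2 ν)
    (h : Tendsto (fun k => eLpNorm (fun x => f k x - f₀ x) 2 ν) l (𝓝 0)) :
    Tendsto (fun k => ∫ x, L (f k x) (g x) ∂ν) l (𝓝 (∫ x, L (f₀ x) (g x) ∂ν)) := by
  refine tendsto_integral_of_L1 _ (integrable_bilin L hf₀ hg).1
    (Eventually.of_forall fun k => integrable_bilin L (hf k) hg) ?_
  have hlim : Tendsto (fun k => ‖L‖ₑ * (eLpNorm (fun x => f k x - f₀ x) 2 ν * eLpNorm g 2 ν)) l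
      (𝓝 0) := by
    have h1 := ENNReal.Tendsto.mul_const (b := eLpNorm g 2 ν) h (Or.inr hg.2.ne)
    have h2 := ENNReal.Tendsto.const_mul (a := ‖L‖ₑ) h1 (Or.inr (by simp))
    simpa using h2
  refine tendsto_of_tendsto_of_tendsto_of_le_of_le tendsto_const_nhds hlim (fun _ => zero_le)
    fun k => ?_
  have := lintegral_enorm_bilin_le L ((hf k).sub hf₀).1 hg.1
  simp only [Pi.sub_apply, map_sub, sub_apply] at this
  exact this

/-! ### Exhaustion by balls -/

/-- The closed ball of radius `n + 1`. -/
def bigBall (d n : ℕ) : Set (Space d) := Metric.closedBall 0 (n + 1)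

lemma isCompact_bigBall (d n : ℕ) : IsCompact (bigBall d n) := isCompact_closedBall _ _

lemma measurableSet_bigBall (d n : ℕ) : MeasurableSet (bigBall d n) := measurableSet_closedBall

lemma bigBall_mono (d : ℕ) : Monotone (bigBall d) := fun m n h =>
  Metric.closedBall_subset_closedBall (by have : (m : ℝ) ≤ n := by exact_mod_cast h
                                          linarith)

lemma mem_bigBall_ceil {d : ℕ} (x : Space d) : x ∈ bigBall d ⌈‖x‖⌉₊ := by
  simp only [bigBall, Metric.mem_closedBall, dist_zero_right]
  linarith [Nat.le_ceil ‖x‖]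

lemma volume_bigBall_ne_top (d n : ℕ) : volume (bigBall d n) ≠ ⊤ :=
  (isCompact_bigBall d n).measure_lt_top.ne

lemma volume_bigBall_ne_zero (d n : ℕ) : volume (bigBall d n) ≠ 0 :=
  (Metric.measure_closedBall_pos _ _ (by positivity)).ne'

instance (d n : ℕ) : IsFiniteMeasure (volume.restrict (bigBall d n)) :=
  ⟨by simpa using (volume_bigBall_ne_top d n).lt_top⟩

lemma exists_subset_bigBall {d : ℕ} {K : Set (Space d)} (hK : IsCompact K) :
    ∃ n, K ⊆ bigBall d n := by
  obtain ⟨r, hr⟩ := hK.isBounded.subset_closedBall 0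
  refine ⟨⌈r⌉₊, hr.trans (Metric.closedBall_subset_closedBall ?_)⟩
  linarith [Nat.le_ceil r]

lemma locallyL2_iff {d : ℕ} {F : Type*} [NormedAddCommGroup F] {f : Space d → F} :
    LocallyL2 f ↔ ∀ n, MemLp f 2 (volume.restrict (bigBall d n)) := by
  refine ⟨fun h n => h _ (isCompact_bigBall d n), fun h K hK => ?_⟩
  obtain ⟨n, hn⟩ := exists_subset_bigBall hK
  exact (h n).mono_measure (Measure.restrict_mono hn le_rfl)

lemma _root_.Continuous.locallyL2 {d : ℕ} {F : Type*} [NormedAddCommGroup F]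
    {f : Space d → F} (hf : Continuous f) : LocallyL2 f := by
  intro K hK
  have : IsFiniteMeasure (volume.restrict K) := ⟨by simpa using hK.measure_lt_top⟩
  obtain ⟨c, hc⟩ := hK.exists_bound_of_continuousOn hf.continuousOn
  have hcl : ∀ᵐ x ∂volume.restrict K, ‖f x‖ ≤ c :=
    (ae_restrict_mem hK.measurableSet).mono hc
  exact MemLp.of_bound (hf.continuousOn.aestronglyMeasurable_of_isCompact hK hK.measurableSet) c hcl

lemma LocallyL2.add {d : ℕ} {F : Type*} [NormedAddCommGroup F] {f g : Space d → F}
    (hf : LocallyL2 f) (hg : LocallyL2 g) : LocallyL2 (fun x => f x + g x) :=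
  fun K hK => (hf K hK).add (hg K hK)

lemma LocallyL2.sub {d : ℕ} {F : Type*} [NormedAddCommGroup F] {f g : Space d → F}
    (hf : LocallyL2 f) (hg : LocallyL2 g) : LocallyL2 (fun x => f x - g x) :=
  fun K hK => (hf K hK).sub (hg K hK)

lemma LocallyL2.congr {d : ℕ} {F : Type*} [NormedAddCommGroup F] {f g : Space d → F}
    (hf : LocallyL2 f) (h : f =ᵐ[volume] g) : LocallyL2 g :=
  fun K hK => (hf K hK).ae_eq (ae_restrict_of_ae h)

lemma LocallyL2.apply {d m : ℕ} {f : Space d → Space m} (hf : LocallyL2 f) (i : Fin m) :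
    LocallyL2 (fun x => f x i) := fun K hK => MemLp.euclidean_apply (hf K hK) i

lemma LocallyL2.locallyIntegrable {d : ℕ} {F : Type*} [NormedAddCommGroup F] {f : Space d → F}
    (hf : LocallyL2 f) : LocallyIntegrable f := by
  rw [locallyIntegrable_iff]
  intro K hK
  have : IsFiniteMeasure (volume.restrict K) := ⟨by simpa using hK.measure_lt_top⟩
  exact (hf K hK).integrable one_le_two

/-- Integrals against a compactly supported function are integrals over a ball. -/
lemma exists_forall_integral_eq_bigBall {d : ℕ} {G : Type*} [NormedAddCommGroup G]
    {g : Space d → G} (hg : HasCompactSupport g) :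
    ∃ n, ∀ x, x ∉ bigBall d n → g x = 0 := by
  obtain ⟨n, hn⟩ := exists_subset_bigBall hg
  exact ⟨n, fun x hx => image_eq_zero_of_notMem_tsupport fun h => hx (hn h)⟩

lemma integrable_bilin_of_hasCompactSupport {d : ℕ} {F G K : Type*}
    [NormedAddCommGroup F] [NormedSpace ℝ F] [NormedAddCommGroup G] [NormedSpace ℝ G]
    [NormedAddCommGroup K] [NormedSpace ℝ K] (L : F →L[ℝ] G →L[ℝ] K) {f : Space d → F}
    {g : Space d → G} (hf : LocallyL2 f) (hg : Continuous g) (hgc : HasCompactSupport g) :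
    Integrable (fun x => L (f x) (g x)) := by
  obtain ⟨n, hn⟩ := exists_forall_integral_eq_bigBall hgc
  have h := integrable_bilin L (locallyL2_iff.1 hf n) (locallyL2_iff.1 hg.locallyL2 n)
  refine IntegrableOn.integrable_of_forall_notMem_eq_zero h fun x hx => ?_
  rw [hn x hx, map_zero]

lemma setIntegral_bigBall_bilin {d n : ℕ} {F G K : Type*}
    [NormedAddCommGroup F] [NormedSpace ℝ F] [NormedAddCommGroup G] [NormedSpace ℝ G]
    [NormedAddCommGroup K] [NormedSpace ℝ K] (L : F →L[ℝ] G →L[ℝ] K) (f : Space d → F)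
    {g : Space d → G} (hn : ∀ x, x ∉ bigBall d n → g x = 0) :
    ∫ x in bigBall d n, L (f x) (g x) = ∫ x, L (f x) (g x) :=
  setIntegral_eq_integral_of_forall_compl_eq_zero fun x hx => by rw [hn x hx, map_zero]

/-! ### Limits of gradients -/

/-- The Poincaré inequality for the deviation from the mean on the unit ball. -/
lemma exists_eLpNorm_sub_average_le (d n : ℕ) : ∃ K : ℝ≥0∞, K ≠ ⊤ ∧
    ∀ u : Space d → ℝ, ContDiff ℝ 1 u →
      eLpNorm (fun x => u x - ⨍ y in bigBall d 0, u y) 2 (volume.restrict (bigBall d n)) ≤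
        K * eLpNorm (gradient u) 2 (volume.restrict (bigBall d n)) := by
  set D : ℝ≥0∞ := ENNReal.ofReal (2 * (n + 1)) with hD
  set v₀ := volume (bigBall d 0) with hv₀
  have hv0 : v₀ ≠ 0 := volume_bigBall_ne_zero d 0
  have hvt : v₀ ≠ ⊤ := volume_bigBall_ne_top d 0
  set K2 : ℝ≥0∞ := v₀⁻¹ * (D ^ 2 * (2 ^ d * volume (bigBall d n))) with hK2
  have hK2t : K2 ≠ ⊤ := by
    refine ENNReal.mul_ne_top (ENNReal.inv_ne_top.2 hv0) (ENNReal.mul_ne_top ?_ ?_)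
    · exact ENNReal.pow_ne_top ENNReal.ofReal_ne_top
    · exact ENNReal.mul_ne_top (by simp) (volume_bigBall_ne_top d n)
  refine ⟨K2 ^ (1 / 2 : ℝ), ENNReal.rpow_ne_top_of_nonneg (by norm_num) hK2t, fun u hu => ?_⟩
  -- The deviation at x is the mean over the unit ball of u x − u y. After Cauchy–Schwarz the domain
  -- in y is enlarged to the ball of index n, where the double-integral inequality applies.
  have hpt : ∀ x, ‖u x - ⨍ y in bigBall d 0, u y‖ₑ ^ 2 ≤
      v₀⁻¹ * ∫⁻ y in bigBall d n, ‖u x - u y‖ₑ ^ 2 := by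
    intro x
    have hui : IntegrableOn u (bigBall d 0) :=
      hu.continuous.continuousOn.integrableOn_compact (isCompact_bigBall d 0)
    have h1 : u x - ⨍ y in bigBall d 0, u y = ⨍ y in bigBall d 0, (u x - u y) := by
      have hc : ⨍ _ in bigBall d 0, u x = u x := setAverage_const hv0 hvt _
      rw [setAverage_eq] at hc
      rw [setAverage_eq, setAverage_eq, integral_sub (integrable_const _) hui, smul_sub, hc]
    have hum : Measurable fun y => ‖u x - u y‖ₑ :=
      (continuous_const.sub hu.continuous).enorm.measurable
    have hreal : ‖(volume.real (bigBall d 0))⁻¹‖ₑ = v₀⁻¹ := by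
      rw [measureReal_def, ← hv₀, enorm_inv (ENNReal.toReal_ne_zero.2 ⟨hv0, hvt⟩),
        Real.enorm_of_nonneg ENNReal.toReal_nonneg, ENNReal.ofReal_toReal hvt]
    rw [h1, setAverage_eq, enorm_smul, mul_pow, hreal]
    calc v₀⁻¹ ^ 2 * ‖∫ y in bigBall d 0, (u x - u y)‖ₑ ^ 2
        ≤ v₀⁻¹ ^ 2 * (v₀ * ∫⁻ y in bigBall d 0, ‖u x - u y‖ₑ ^ 2) := by
          gcongr
          refine le_trans ?_ ((lintegral_sq_le (volume.restrict (bigBall d 0))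
            hum.aemeasurable).trans_eq ?_)
          · gcongr
            exact enorm_integral_le_lintegral_enorm _
          · simp [hv₀]
      _ = v₀⁻¹ * ∫⁻ y in bigBall d 0, ‖u x - u y‖ₑ ^ 2 := by
          rw [← mul_assoc, sq, mul_assoc v₀⁻¹, ENNReal.inv_mul_cancel hv0 hvt, mul_one]
      _ ≤ _ := by
          gcongr
          exact bigBall_mono d (Nat.zero_le n)
  have hsq : eLpNorm (fun x => u x - ⨍ y in bigBall d 0, u y) 2
        (volume.restrict (bigBall d n)) ^ 2 ≤
      K2 * eLpNorm (gradient u) 2 (volume.restrict (bigBall d n)) ^ 2 := by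
    rw [eLpNorm_two_sq, eLpNorm_two_sq]
    calc _ ≤ ∫⁻ x in bigBall d n, v₀⁻¹ * ∫⁻ y in bigBall d n, ‖u x - u y‖ₑ ^ 2 :=
          lintegral_mono hpt
      _ = v₀⁻¹ * ∫⁻ x in bigBall d n, ∫⁻ y in bigBall d n, ‖u x - u y‖ₑ ^ 2 :=
          lintegral_const_mul' _ _ (ENNReal.inv_ne_top.2 hv0)
      _ ≤ v₀⁻¹ * (D ^ 2 * (2 ^ d * volume (bigBall d n) *
            ∫⁻ x in bigBall d n, ‖gradient u x‖ₑ ^ 2)) := by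
          gcongr
          refine lintegral_lintegral_enorm_sub_sq_le hu (convex_closedBall _ _)
            (measurableSet_bigBall d n) ENNReal.ofReal_ne_top fun x hx y hy => ?_
          rw [← ofReal_norm]
          refine ENNReal.ofReal_le_ofReal ?_
          simp only [Metric.mem_closedBall, dist_zero_right] at hx hy
          linarith [norm_sub_le x y]
      _ = _ := by rw [hK2]; ring
  have := ENNReal.rpow_le_rpow hsq (z := 1 / 2) (by norm_num)
  rw [ENNReal.mul_rpow_of_nonneg _ _ (by norm_num)] at this
  simp only [← ENNReal.rpow_natCast, ← ENNReal.rpow_mul] at this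
  norm_num at this
  simpa only [one_div] using this

/-- A sequence that is Cauchy in `L²` of every ball converges in `L²_loc`. -/
lemma exists_locallyL2_tendsto {d : ℕ} {w : ℕ → Space d → ℝ} (hw : ∀ k, LocallyL2 (w k))
    {a : ℕ → ℕ → ℝ≥0∞} (ha : ∀ n, Tendsto (a n) atTop (𝓝 0))
    (h : ∀ n k l, eLpNorm (fun x => w k x - w l x) 2 (volume.restrict (bigBall d n)) ≤
      a n k + a n l) :
    ∃ v : Space d → ℝ, LocallyL2 v ∧ ∀ n,
      Tendsto (fun k => eLpNorm (fun x => w k x - v x) 2 (volume.restrict (bigBall d n))) atTop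
        (𝓝 0) := by
  have hw' : ∀ n k, MemLp (w k) 2 (volume.restrict (bigBall d n)) := fun n k =>
    locallyL2_iff.1 (hw k) n
  have hlim : ∀ n, ∃ v : Space d → ℝ, MemLp v 2 (volume.restrict (bigBall d n)) ∧
      Tendsto (fun k => eLpNorm (fun x => w k x - v x) 2 (volume.restrict (bigBall d n))) atTop
        (𝓝 0) := by
    intro n
    have hc : CauchySeq fun k => (hw' n k).toLp (w k) := by
      rw [EMetric.cauchySeq_iff]
      intro ε hε
      have hε2 : (0 : ℝ≥0∞) < ε / 2 := ENNReal.half_pos hε.ne'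
      obtain ⟨N, hN⟩ := eventually_atTop.1 ((ha n).eventually (gt_mem_nhds hε2))
      refine ⟨N, fun k hk l hl => ?_⟩
      rw [Lp.edist_toLp_toLp]
      refine (h n k l).trans_lt ?_
      calc a n k + a n l < ε / 2 + ε / 2 := ENNReal.add_lt_add (hN k hk) (hN l hl)
        _ = ε := ENNReal.add_halves ε
    obtain ⟨f, hf⟩ := cauchySeq_tendsto_of_complete hc
    refine ⟨f, Lp.memLp f, ?_⟩
    have h2 := tendsto_iff_edist_tendsto_0.1 hf
    refine h2.congr fun k => ?_
    rw [Lp.edist_def]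
    refine eLpNorm_congr_ae ?_
    filter_upwards [(hw' n k).coeFn_toLp] with x hx
    simp [hx]
  choose v hv hvt using hlim
  -- Both limits are approached by the same sequence on the smaller ball, so they agree there.
  have hcompat : ∀ m n, m ≤ n → v m =ᵐ[volume.restrict (bigBall d m)] v n := by
    intro m n hmn
    have hle : volume.restrict (bigBall d m) ≤ volume.restrict (bigBall d n) :=
      Measure.restrict_mono (bigBall_mono d hmn) le_rfl
    have hvn : MemLp (v n) 2 (volume.restrict (bigBall d m)) := (hv n).mono_measure hle
    have hz : eLpNorm (v m - v n) 2 (volume.restrict (bigBall d m)) = 0 := by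
      have hsum := (hvt m).add (hvt n)
      rw [add_zero] at hsum
      refine le_antisymm (ge_of_tendsto' hsum fun k => ?_) zero_le
      have h1 : v m - v n = (fun x => w k x - v n x) - fun x => w k x - v m x := by
        funext x
        simp
      rw [h1, add_comm]
      refine (eLpNorm_sub_le ((hw' m k).sub hvn).1 ((hw' m k).sub (hv m)).1 one_le_two).trans ?_
      exact add_le_add (eLpNorm_mono_measure _ hle) le_rfl
    rw [eLpNorm_eq_zero_iff ((hv m).sub hvn).1 two_ne_zero] at hz
    filter_upwards [hz] with x hx
    simpa [sub_eq_zero] using hx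
  -- The global limit reads at x the limit of index ⌈‖x‖⌉₊, whose ball contains x.
  have hglue : ∀ n, (fun x => v ⌈‖x‖⌉₊ x) =ᵐ[volume.restrict (bigBall d n)] v n := by
    intro n
    have hall : ∀ᵐ x, ∀ m, x ∈ bigBall d m → ∀ n, m ≤ n → v m x = v n x := by
      rw [ae_all_iff]
      intro m
      have : ∀ᵐ x ∂volume.restrict (bigBall d m), ∀ n, m ≤ n → v m x = v n x := by
        rw [ae_all_iff]
        intro n
        by_cases hmn : m ≤ n
        · filter_upwards [hcompat m n hmn] with x hx _ using hx
        · exact Eventually.of_forall fun x h => absurd h hmn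
      exact (ae_restrict_iff' (measurableSet_bigBall d m)).1 this
    filter_upwards [ae_restrict_of_ae hall, ae_restrict_mem (measurableSet_bigBall d n)] with x hx hxn
    have h1 := hx _ (mem_bigBall_ceil x) (max ⌈‖x‖⌉₊ n) (le_max_left _ _)
    have h2 := hx _ hxn (max ⌈‖x‖⌉₊ n) (le_max_right _ _)
    rw [h1, h2]
  refine ⟨fun x => v ⌈‖x‖⌉₊ x, locallyL2_iff.2 fun n => (hv n).ae_eq (hglue n).symm, fun n => ?_⟩
  refine (hvt n).congr fun k => eLpNorm_congr_ae ?_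
  filter_upwards [hglue n] with x hx
  rw [hx]

lemma integral_mul_fderiv_of_isTest {d : ℕ} {u φ : Space d → ℝ} (hu : ContDiff ℝ 1 u)
    (hφ : IsTest φ) (v : Space d) :
    ∫ x, u x * fderiv ℝ φ x v = -∫ x, fderiv ℝ u x v * φ x := by
  have hφ1 := hφ.contDiff_one
  have hcu : Continuous fun x => fderiv ℝ u x v :=
    (hu.continuous_fderiv one_ne_zero).clm_apply continuous_const
  have hcφ : Continuous fun x => fderiv ℝ φ x v :=
    (hφ1.continuous_fderiv one_ne_zero).clm_apply continuous_const
  have hsφ : HasCompactSupport fun x => fderiv ℝ φ x v := hφ.2.fderiv_apply ℝ v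
  exact integral_mul_fderiv_eq_neg_fderiv_mul_of_integrable
    ((hcu.mul hφ1.continuous).integrable_of_hasCompactSupport hφ.2.mul_left)
    ((hu.continuous.mul hcφ).integrable_of_hasCompactSupport hsφ.mul_left)
    ((hu.continuous.mul hφ1.continuous).integrable_of_hasCompactSupport hφ.2.mul_left)
    (fun x _ => hu.differentiable one_ne_zero x) (fun x _ => hφ1.differentiable one_ne_zero x)

lemma integral_smul_gradient {d : ℕ} {u φ : Space d → ℝ} (hu : ContDiff ℝ 1 u) (hφ : IsTest φ) :
    ∫ x, u x • gradient φ x = -∫ x, φ x • gradient u x := by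
  have h1 : Integrable fun x => u x • gradient φ x :=
    integrable_bilin_of_hasCompactSupport (ContinuousLinearMap.lsmul ℝ ℝ : ℝ →L[ℝ] Space d →L[ℝ] _)
      hu.continuous.locallyL2 hφ.continuous_gradient hφ.hasCompactSupport_gradient
  have h2 : Integrable fun x => φ x • gradient u x :=
    integrable_bilin_of_hasCompactSupport
      (ContinuousLinearMap.lsmul ℝ ℝ : ℝ →L[ℝ] Space d →L[ℝ] _).flip
      (continuous_gradient hu).locallyL2 hφ.contDiff_one.continuous hφ.2
  refine PiLp.ext fun i => ?_
  rw [PiLp.neg_apply, integral_euclidean_apply h1, integral_euclidean_apply h2]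
  simp only [PiLp.smul_apply, gradient_apply, smul_eq_mul]
  rw [integral_mul_fderiv_of_isTest hu hφ]
  simp only [mul_comm]

/-- `L²_loc` limits of gradients are gradients, and periods of the potentials are inherited. -/
theorem exists_isWeakGradient_of_tendsto {d : ℕ} {u : ℕ → Space d → ℝ}
    (hu : ∀ k, ContDiff ℝ 1 (u k)) {F : Space d → Space d} (hF : LocallyL2 F)
    (h : ∀ n, Tendsto (fun k => eLpNorm (fun x => gradient (u k) x - F x) 2
      (volume.restrict (bigBall d n))) atTop (𝓝 0)) :
    ∃ v : Space d → ℝ, IsWeakGradient v F ∧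
      ∀ a : Space d, (∀ k x, u k (x + a) = u k x) → ∀ᵐ x, v (x + a) = v x := by
  -- Only gradients converge, so additive constants must be fixed. The mean over one and the same
  -- ball is subtracted for all n, which makes a single sequence Cauchy on every ball.
  set w : ℕ → Space d → ℝ := fun k x => u k x - ⨍ y in bigBall d 0, u k y with hw
  have hwc : ∀ k, ContDiff ℝ 1 (w k) := fun k => (hu k).sub contDiff_const
  have hwg : ∀ k, gradient (w k) = gradient (u k) := fun k => gradient_sub_const _ _
  have hwl : ∀ k, LocallyL2 (w k) := fun k => (hwc k).continuous.locallyL2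
  have hgl : ∀ k, LocallyL2 (gradient (u k)) := fun k => (continuous_gradient (hu k)).locallyL2
  choose K hKt hK using exists_eLpNorm_sub_average_le d
  obtain ⟨v, hv, hvt⟩ := exists_locallyL2_tendsto hwl
    (a := fun n k => K n * eLpNorm (fun x => gradient (u k) x - F x) 2
      (volume.restrict (bigBall d n)))
    (fun n => by simpa using ENNReal.Tendsto.const_mul (a := K n) (h n) (Or.inr (hKt n)))
    (by
      intro n k l
      have h1 : (fun x => w k x - w l x) =
          fun x => (u k x - u l x) - ⨍ y in bigBall d 0, (u k y - u l y) := by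
        have hi : ∀ k, IntegrableOn (u k) (bigBall d 0) := fun k =>
          (hu k).continuous.continuousOn.integrableOn_compact (isCompact_bigBall d 0)
        funext x
        simp only [hw, setAverage_eq]
        rw [integral_sub (hi k) (hi l), smul_sub]
        ring
      rw [h1, ← mul_add]
      refine (hK n (fun x => u k x - u l x) ((hu k).sub (hu l))).trans ?_
      gcongr
      rw [gradient_sub (hu k) (hu l)]
      have h2 : (fun x => gradient (u k) x - gradient (u l) x) =
          (fun x => gradient (u k) x - F x) - fun x => gradient (u l) x - F x := by
        funext x
        simp
      rw [h2]
      exact eLpNorm_sub_le (((hgl k).sub hF) _ (isCompact_bigBall d n)).1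
        (((hgl l).sub hF) _ (isCompact_bigBall d n)).1 one_le_two)
  refine ⟨v, ⟨hv, hF, fun φ hφ => ?_⟩, fun a ha => ?_⟩
  · obtain ⟨n, hn⟩ := exists_forall_integral_eq_bigBall hφ.2
    have hn' : ∀ x, x ∉ bigBall d n → gradient φ x = 0 := by
      obtain ⟨m, hm⟩ := exists_subset_bigBall hφ.2
      intro x hx
      by_contra hne
      have hx' : x ∈ tsupport φ := tsupport_gradient_subset φ (subset_tsupport _ hne)
      have h0 : (bigBall d n)ᶜ ⊆ {y | φ y = 0} := fun y hy => hn y hy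
      have hopen : IsOpen (bigBall d n)ᶜ := (isCompact_bigBall d n).isClosed.isOpen_compl
      have : φ =ᶠ[𝓝 x] fun _ => 0 := by
        filter_upwards [hopen.mem_nhds hx] with y hy using h0 hy
      refine hne ?_
      rw [gradient, this.fderiv_eq]
      simp
    have h1 := tendsto_integral_bilin (ContinuousLinearMap.lsmul ℝ ℝ : ℝ →L[ℝ] Space d →L[ℝ] _)
      (fun k => locallyL2_iff.1 (hwl k) n) (locallyL2_iff.1 hv n)
      (locallyL2_iff.1 hφ.continuous_gradient.locallyL2 n) (hvt n)
    have h2 := tendsto_integral_bilin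
      (ContinuousLinearMap.lsmul ℝ ℝ : ℝ →L[ℝ] Space d →L[ℝ] _).flip
      (fun k => locallyL2_iff.1 (hgl k) n) (locallyL2_iff.1 hF n)
      (locallyL2_iff.1 hφ.contDiff_one.continuous.locallyL2 n) (h n)
    simp only [setIntegral_bigBall_bilin _ _ hn, setIntegral_bigBall_bilin _ _ hn'] at h1 h2
    simp only [ContinuousLinearMap.flip_apply, ContinuousLinearMap.lsmul_apply] at h1 h2
    refine tendsto_nhds_unique h1 ?_
    refine h2.neg.congr fun k => ?_
    rw [← hwg k, integral_smul_gradient (hwc k) hφ]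
  -- Subtracting constants does not affect periods. The relation passes to the limit by comparing v
  -- and its translate with w k on a ball that contains both the ball and its shift.
  · have hper : ∀ k x, w k (x + a) = w k x := fun k x => by simp only [hw, ha]
    have hmp : MeasurePreserving (fun x : Space d => x + a) volume volume :=
      measurePreserving_add_right volume a
    have hball : ∀ n, (fun x => v (x + a)) =ᵐ[volume.restrict (bigBall d n)] v := by
      intro n
      obtain ⟨m, hm⟩ := exists_subset_bigBall
        (((isCompact_bigBall d n).image (continuous_add_const a)).union
          (isCompact_bigBall d n))
      have hva : LocallyL2 fun x => v (x + a) := by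
        intro K hKc
        have hK' := hv _ (hKc.image (continuous_add_const a))
        have hmpr := hmp.restrict_image_emb (MeasurableEquiv.addRight a).measurableEmbedding K
        exact hK'.comp_measurePreserving hmpr
      have hshift : ∀ k, eLpNorm (fun x => w k x - v (x + a)) 2 (volume.restrict (bigBall d n)) ≤
          eLpNorm (fun x => w k x - v x) 2 (volume.restrict (bigBall d m)) := by
        intro k
        have hmpr := hmp.restrict_image_emb (MeasurableEquiv.addRight a).measurableEmbedding
          (bigBall d n)
        have hsub : (fun x => x + a) '' bigBall d n ⊆ bigBall d m :=
          fun x hx => hm (Or.inl hx)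
        have hk : LocallyL2 fun x => w k x - v x := (hwl k).sub hv
        have h1 : (fun x => w k x - v (x + a)) = (fun x => w k x - v x) ∘ fun x => x + a := by
          funext x
          simp [hper]
        rw [h1, eLpNorm_comp_measurePreserving
          ((locallyL2_iff.1 hk m).1.mono_measure (Measure.restrict_mono hsub le_rfl)) hmpr]
        exact eLpNorm_mono_measure _ (Measure.restrict_mono hsub le_rfl)
      have hz : eLpNorm ((fun x => v (x + a)) - v) 2 (volume.restrict (bigBall d n)) = 0 := by
        have hsum := (hvt m).add (hvt n)
        rw [add_zero] at hsum
        refine le_antisymm (ge_of_tendsto' hsum fun k => ?_) zero_le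
        have h1 : (fun x => v (x + a)) - v =
            (fun x => w k x - v x) - fun x => w k x - v (x + a) := by
          funext x
          simp
        rw [h1, add_comm]
        refine (eLpNorm_sub_le (locallyL2_iff.1 ((hwl k).sub hv) n).1
          (locallyL2_iff.1 ((hwl k).sub hva) n).1 one_le_two).trans ?_
        exact add_le_add le_rfl (hshift k)
      have hz' := (eLpNorm_eq_zero_iff (locallyL2_iff.1 (hva.sub hv) n).1 two_ne_zero).1 hz
      filter_upwards [hz'] with x hx
      simpa [sub_eq_zero] using hx
    have hall : ∀ᵐ x, ∀ n, x ∈ bigBall d n → v (x + a) = v x := by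
      rw [ae_all_iff]
      exact fun n => (ae_restrict_iff' (measurableSet_bigBall d n)).1 (hball n)
    filter_upwards [hall] with x hx
    exact hx _ (mem_bigBall_ceil x)

open scoped ENNReal NNReal Convolution

/-! ### Divergence-free and curl-free fields -/

/-- The field `F` is divergence-free in the sense of distributions. -/
def DivFree {d : ℕ} (F : Space d → Space d) : Prop :=
  ∀ φ : Space d → ℝ, IsTest φ → ∫ x, inner ℝ (F x) (gradient φ x) = 0

/-- The field `F` is curl-free in the sense of distributions. -/
def CurlFree {d : ℕ} (F : Space d → Space d) : Prop :=
  ∀ φ : Space d → ℝ, IsTest φ → ∀ i j : Fin d,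
    ∫ x, F x i * gradient φ x j = ∫ x, F x j * gradient φ x i

lemma integrable_inner_gradient {d : ℕ} {F : Space d → Space d} (hF : LocallyL2 F)
    {φ : Space d → ℝ} (hφ : IsTest φ) : Integrable fun x => inner ℝ (F x) (gradient φ x) :=
  integrable_bilin_of_hasCompactSupport (innerSL ℝ) hF hφ.continuous_gradient
    hφ.hasCompactSupport_gradient

/-- Local square integrability lets the two integrals be merged, so every equation becomes the
divergence-freeness of one total flux. This is the form that orthogonality in L² detects. -/
lemma negDivEqDiv_iff {d : ℕ} {F H : Space d → Space d} (hF : LocallyL2 F) (hH : LocallyL2 H) :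
    NegDivEqDiv F H ↔ DivFree fun x => F x + H x := by
  refine forall₂_congr fun φ hφ => ?_
  simp only [inner_add_left]
  rw [integral_add (integrable_inner_gradient hF hφ) (integrable_inner_gradient hH hφ),
    eq_neg_iff_add_eq_zero]

lemma DivFree.congr {d : ℕ} {F G : Space d → Space d} (hF : DivFree F) (h : F =ᵐ[volume] G) :
    DivFree G := fun φ hφ => by
  rw [← hF φ hφ]
  refine integral_congr_ae ?_
  filter_upwards [h] with x hx
  rw [hx]

lemma CurlFree.congr {d : ℕ} {F G : Space d → Space d} (hF : CurlFree F) (h : F =ᵐ[volume] G) :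
    CurlFree G := fun φ hφ i j => by
  have h1 : ∀ i j : Fin d, ∫ x, G x i * gradient φ x j = ∫ x, F x i * gradient φ x j := by
    intro i j
    refine integral_congr_ae ?_
    filter_upwards [h] with x hx
    rw [hx]
  rw [h1, h1, hF φ hφ]

lemma IsWeakGradient.congr {d : ℕ} {u : Space d → ℝ} {F G : Space d → Space d}
    (hF : IsWeakGradient u F) (h : F =ᵐ[volume] G) : IsWeakGradient u G where
  fun_loc := hF.fun_loc
  grad_loc := hF.grad_loc.congr h
  by_parts φ hφ := by
    rw [hF.by_parts φ hφ]
    congr 1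
    refine integral_congr_ae ?_
    filter_upwards [h] with x hx
    rw [hx]

/-! ### Translations -/

lemma IsTest.comp_add {d : ℕ} {φ : Space d → ℝ} (hφ : IsTest φ) (a : Space d) :
    IsTest fun x => φ (x + a) :=
  ⟨hφ.1.comp (contDiff_id.add contDiff_const), hφ.2.comp_homeomorph (Homeomorph.addRight a)⟩

lemma IsTest.comp_neg {d : ℕ} {φ : Space d → ℝ} (hφ : IsTest φ) : IsTest fun x => φ (-x) :=
  ⟨hφ.1.comp contDiff_neg, hφ.2.comp_homeomorph (Homeomorph.neg _)⟩

lemma gradient_comp_add {d : ℕ} (φ : Space d → ℝ) (a x : Space d) :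
    gradient (fun x => φ (x + a)) x = gradient φ (x + a) := by
  simp only [gradient, fderiv_comp_add_right]

lemma gradient_comp_neg {d : ℕ} (φ : Space d → ℝ) (x : Space d) :
    gradient (fun x => φ (-x)) x = -gradient φ (-x) := by
  have h := fderiv_comp_smul (𝕜 := ℝ) (f := φ) (x := x) (-1)
  simp only [neg_smul, one_smul] at h
  simp only [gradient, h, map_neg]

lemma measurePreserving_restrict_add {d : ℕ} (a : Space d) (K : Set (Space d)) :
    MeasurePreserving (fun x => x + a) (volume.restrict K)
      (volume.restrict ((fun x => x + a) '' K)) :=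
  (measurePreserving_add_right volume a).restrict_image_emb
    (MeasurableEquiv.addRight a).measurableEmbedding K

lemma LocallyL2.comp_add {d : ℕ} {F : Type*} [NormedAddCommGroup F] {f : Space d → F}
    (hf : LocallyL2 f) (a : Space d) : LocallyL2 fun x => f (x + a) := fun K hK =>
  (hf _ (hK.image (continuous_add_const a))).comp_measurePreserving
    (measurePreserving_restrict_add a K)

lemma DivFree.comp_add {d : ℕ} {F : Space d → Space d} (hF : DivFree F) (a : Space d) :
    DivFree fun x => F (x + a) := fun φ hφ => by
  rw [← hF _ (hφ.comp_add (-a)),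
    ← integral_add_right_eq_self (fun x => inner ℝ (F x) (gradient (fun y => φ (y + -a)) x)) a]
  simp only [gradient_comp_add, add_neg_cancel_right]

lemma CurlFree.comp_add {d : ℕ} {F : Space d → Space d} (hF : CurlFree F) (a : Space d) :
    CurlFree fun x => F (x + a) := fun φ hφ i j => by
  have h := hF _ (hφ.comp_add (-a)) i j
  rw [← integral_add_right_eq_self (fun x => F x i * gradient (fun y => φ (y + -a)) x j) a,
    ← integral_add_right_eq_self (fun x => F x j * gradient (fun y => φ (y + -a)) x i) a] at h
  simpa only [gradient_comp_add, add_neg_cancel_right] using h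

lemma IsWeakGradient.comp_add {d : ℕ} {u : Space d → ℝ} {F : Space d → Space d}
    (hF : IsWeakGradient u F) (a : Space d) :
    IsWeakGradient (fun x => u (x + a)) fun x => F (x + a) where
  fun_loc := hF.fun_loc.comp_add a
  grad_loc := hF.grad_loc.comp_add a
  by_parts φ hφ := by
    have h := hF.by_parts _ (hφ.comp_add (-a))
    rw [← integral_add_right_eq_self (fun x => u x • gradient (fun y => φ (y + -a)) x) a,
      ← integral_add_right_eq_self (fun x => φ (x + -a) • F x) a] at h
    simpa only [gradient_comp_add, add_neg_cancel_right] using h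

/-! ### Weak gradients are curl-free -/

lemma IsTest.gradient_apply {d : ℕ} {φ : Space d → ℝ} (hφ : IsTest φ) (i : Fin d) :
    IsTest fun x => gradient φ x i := by
  simp only [WeakRandomHom.gradient_apply]
  exact ⟨(hφ.1.fderiv_right (m := (⊤ : ℕ∞)) le_rfl).clm_apply contDiff_const,
    hφ.2.fderiv_apply ℝ _⟩

lemma gradient_gradient_symm {d : ℕ} {φ : Space d → ℝ} (hφ : IsTest φ) (i j : Fin d)
    (x : Space d) :
    gradient (fun y => gradient φ y i) x j = gradient (fun y => gradient φ y j) x i := by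
  have hd : DifferentiableAt ℝ (fderiv ℝ φ) x :=
    ((hφ.1.fderiv_right (m := (⊤ : ℕ∞)) le_rfl).differentiable (by simp)) x
  have h2 : ((2 : ℕ∞) : WithTop ℕ∞) ≤ ((⊤ : ℕ∞) : WithTop ℕ∞) := WithTop.coe_le_coe.2 le_top
  have hsymm : IsSymmSndFDerivAt ℝ φ x :=
    (hφ.1.of_le h2).contDiffAt.isSymmSndFDerivAt (by simp)
  simp only [WeakRandomHom.gradient_apply]
  rw [fderiv_clm_apply hd (differentiableAt_const _), fderiv_clm_apply hd (differentiableAt_const _)]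
  simpa using hsymm (basisVec j) (basisVec i)

lemma IsWeakGradient.integral_apply {d : ℕ} {u : Space d → ℝ} {F : Space d → Space d}
    (hF : IsWeakGradient u F) {φ : Space d → ℝ} (hφ : IsTest φ) (i : Fin d) :
    ∫ x, F x i * φ x = -∫ x, u x * gradient φ x i := by
  have h := hF.by_parts φ hφ
  have h1 : Integrable fun x => u x • gradient φ x :=
    integrable_bilin_of_hasCompactSupport (ContinuousLinearMap.lsmul ℝ ℝ : ℝ →L[ℝ] Space d →L[ℝ] _)
      hF.fun_loc hφ.continuous_gradient hφ.hasCompactSupport_gradient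
  have h2 : Integrable fun x => φ x • F x :=
    integrable_bilin_of_hasCompactSupport
      (ContinuousLinearMap.lsmul ℝ ℝ : ℝ →L[ℝ] Space d →L[ℝ] _).flip
      hF.grad_loc hφ.contDiff_one.continuous hφ.2
  have h3 := congrArg (fun v : Space d => v i) h
  simp only [PiLp.neg_apply, integral_euclidean_apply h1, integral_euclidean_apply h2,
    PiLp.smul_apply, smul_eq_mul] at h3
  rw [h3, neg_neg]
  simp only [mul_comm]

/-- Another integration by parts leaves ∫ u ∂_i∂_jφ, which is symmetric in i and j. -/
lemma IsWeakGradient.curlFree {d : ℕ} {u : Space d → ℝ} {F : Space d → Space d}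
    (hF : IsWeakGradient u F) : CurlFree F := fun φ hφ i j => by
  rw [hF.integral_apply (hφ.gradient_apply j), hF.integral_apply (hφ.gradient_apply i)]
  simp only [gradient_gradient_symm hφ j i]

/-! ### Countably many test functions suffice -/

/-- Needed to exchange "for every test function, for almost every realisation" with "for almost
every realisation, for every test function". It holds because L² is separable, hence so is every set
of gradients of test functions. -/
theorem exists_seq_isTest_divFree (d : ℕ) : ∃ φ : ℕ → Space d → ℝ, (∀ n, IsTest (φ n)) ∧
    ∀ F : Space d → Space d, LocallyL2 F →
      (∀ n, ∫ x, inner ℝ (F x) (gradient (φ n) x) = 0) → DivFree F := by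
  have hmem : ∀ φ : Space d → ℝ, IsTest φ → MemLp (gradient φ) 2 volume := fun φ hφ =>
    hφ.continuous_gradient.memLp_of_hasCompactSupport hφ.hasCompactSupport_gradient
  have hzero : IsTest (fun _ : Space d => (0 : ℝ)) := ⟨contDiff_const, HasCompactSupport.zero⟩
  -- Supports are confined to a fixed ball so that L² convergence of gradients can be tested against
  -- a field that is only locally square integrable.
  let T : ℕ → Type := fun m => {φ : Space d → ℝ // IsTest φ ∧ tsupport φ ⊆ bigBall d m}
  let g : (m : ℕ) → T m → Lp (Space d) 2 (volume : Measure (Space d)) :=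
    fun m φ => (hmem φ.1 φ.2.1).toLp _
  have hT : ∀ m, Nonempty (T m) := fun m => ⟨⟨fun _ => 0, hzero, by
    have h0 : tsupport (fun _ : Space d => (0 : ℝ)) = ∅ := by
      rw [tsupport_eq_empty_iff]; rfl
    rw [h0]
    exact Set.empty_subset _⟩⟩
  have hfact : Fact ((2 : ℝ≥0∞) ≠ ⊤) := ⟨by simp⟩
  have hN : ∀ m, Nonempty (Set.range (g m)) := fun m => (Set.range_nonempty (g m)).to_subtype
  have hchoose : ∀ m k, ∃ φ : T m, g m φ = TopologicalSpace.denseSeq (Set.range (g m)) k :=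
    fun m k => (TopologicalSpace.denseSeq (Set.range (g m)) k).2
  choose ψ hψ using hchoose
  -- The pairs (ball, index in the dense sequence of that ball) are enumerated by one integer.
  refine ⟨fun n => (ψ n.unpair.1 n.unpair.2).1, fun n => (ψ _ _).2.1, fun F hF h φ hφ => ?_⟩
  obtain ⟨m, hm⟩ := exists_subset_bigBall hφ.2
  have hsupp : ∀ χ : T m, ∀ x, x ∉ bigBall d m → gradient χ.1 x = 0 := fun χ x hx =>
    image_eq_zero_of_notMem_tsupport fun hx' => hx (χ.2.2 (tsupport_gradient_subset _ hx'))
  set φ' : T m := ⟨φ, hφ, hm⟩ with hφ'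
  have hdense := TopologicalSpace.denseRange_denseSeq (Set.range (g m)) ⟨g m φ', φ', rfl⟩
  obtain ⟨s, hs, hst⟩ := mem_closure_iff_seq_limit.1 hdense
  choose κ hκ using hs
  have hst' : Tendsto (fun l => g m (ψ m (κ l))) atTop (𝓝 (g m φ')) := by
    have := (continuous_subtype_val.tendsto _).comp hst
    refine this.congr fun l => ?_
    rw [Function.comp_apply, ← hκ l, hψ]
  have hlim : Tendsto (fun l => eLpNorm
      (fun x => gradient (ψ m (κ l)).1 x - gradient φ x) 2 (volume.restrict (bigBall d m))) atTop
      (𝓝 0) := by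
    have h2 := tendsto_iff_edist_tendsto_0.1 hst'
    refine tendsto_of_tendsto_of_tendsto_of_le_of_le tendsto_const_nhds h2 (fun _ => zero_le)
      fun l => ?_
    simp only [g, Lp.edist_toLp_toLp]
    exact eLpNorm_mono_measure _ Measure.restrict_le_self
  have hmr : ∀ χ : T m, MemLp (gradient χ.1) 2 (volume.restrict (bigBall d m)) := fun χ =>
    (hmem χ.1 χ.2.1).mono_measure Measure.restrict_le_self
  have key := tendsto_integral_bilin (innerSL ℝ : Space d →L[ℝ] Space d →L[ℝ] ℝ)
    (fun l => hmr (ψ m (κ l))) (hmr φ') (locallyL2_iff.1 hF m) hlim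
  have hset : ∀ χ : T m, ∫ x in bigBall d m, innerSL ℝ (gradient χ.1 x) (F x) =
      ∫ x, inner ℝ (F x) (gradient χ.1 x) := by
    intro χ
    refine Eq.trans (integral_congr_ae (Eventually.of_forall fun x => ?_))
      (setIntegral_bigBall_bilin (innerSL ℝ : Space d →L[ℝ] Space d →L[ℝ] ℝ) F (hsupp χ))
    exact real_inner_comm (F x) (gradient χ.1 x)
  have h0 : ∀ l, ∫ x in bigBall d m, innerSL ℝ (gradient (ψ m (κ l)).1 x) (F x) = 0 := by
    intro l
    rw [hset]
    have := h (Nat.pair m (κ l))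
    dsimp only at this
    rwa [Nat.unpair_pair] at this
  simp only [h0] at key
  have := tendsto_nhds_unique key tendsto_const_nhds
  rw [← hset φ', this]

/-! ### Convolutions with test functions -/

lemma contDiff_convolution_isTest {d : ℕ} {φ g : Space d → ℝ} (hφ : IsTest φ)
    (hg : LocallyIntegrable g) : ContDiff ℝ 1 (φ ⋆[ContinuousLinearMap.lsmul ℝ ℝ] g) :=
  hφ.2.contDiff_convolution_left _ hφ.contDiff_one hg

lemma gradient_convolution_isTest {d : ℕ} {φ g : Space d → ℝ} (hφ : IsTest φ)
    (hg : LocallyIntegrable g) (x : Space d) :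
    gradient (φ ⋆[ContinuousLinearMap.lsmul ℝ ℝ] g) x = ∫ t, g (x - t) • gradient φ t := by
  have h1 := hφ.2.hasFDerivAt_convolution_left (ContinuousLinearMap.lsmul ℝ ℝ) hφ.contDiff_one hg x
  rw [gradient, h1.fderiv]
  have h2 : ∀ t, (InnerProductSpace.toDual ℝ (Space d)).symm
      (((ContinuousLinearMap.lsmul ℝ ℝ : ℝ →L[ℝ] ℝ →L[ℝ] ℝ).precompL (Space d)) (fderiv ℝ φ t)
        (g (x - t))) = g (x - t) • gradient φ t := by
    intro t
    rw [gradient, ← map_smul]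
    congr 1
    ext v
    simp [mul_comm]
  simp only [convolution_def, ← h2]
  exact ((InnerProductSpace.toDual ℝ (Space d)).symm.toContinuousLinearEquiv.integral_comp_comm
    _).symm

/-- A function whose weak gradient vanishes is constant. -/
theorem exists_const_of_forall_divFree {d : ℕ} {g : Space d → ℝ} (hg : LocallyL2 g)
    (h : ∀ j : Fin d, DivFree fun x => g x • basisVec j) : ∃ c, ∀ᵐ x, g x = c := by
  have hgi := hg.locallyIntegrable
  -- Every mollification of g is constant: its derivative falls on the kernel, which leaves the
  -- hypothesis tested with a reflected and translated φ. Then g is an almost everywhere limit of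
  -- constants along shrinking bumps.
  have hconst : ∀ φ : Space d → ℝ, IsTest φ → ∃ c, ∀ x,
      (φ ⋆[ContinuousLinearMap.lsmul ℝ ℝ] g) x = c := by
    intro φ hφ
    have hgrad : ∀ x, gradient (φ ⋆[ContinuousLinearMap.lsmul ℝ ℝ] g) x = 0 := by
      intro x
      rw [gradient_convolution_isTest hφ hgi]
      have hint : Integrable fun t => g (x - t) • gradient φ t := by
        have hl : LocallyL2 fun t => g (x - t) := by
          have h1 := hg.comp_add x
          intro K hK
          have h2 := (h1 _ (hK.image continuous_neg)).comp_measurePreserving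
            ((Measure.measurePreserving_neg (volume : Measure (Space d))).restrict_image_emb
              (MeasurableEquiv.neg _).measurableEmbedding K)
          refine h2.congr_norm (h2.1.congr ?_) ?_ <;>
          · refine Eventually.of_forall fun t => ?_
            simp [neg_add_eq_sub]
        exact integrable_bilin_of_hasCompactSupport
          (ContinuousLinearMap.lsmul ℝ ℝ : ℝ →L[ℝ] Space d →L[ℝ] _) hl hφ.continuous_gradient
          hφ.hasCompactSupport_gradient
      refine PiLp.ext fun i => ?_
      rw [integral_euclidean_apply hint]
      have h2 := h i _ ((hφ.comp_neg).comp_add (-x))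
      rw [← integral_sub_left_eq_self _ _ x] at h2
      have h3 : ∀ t, inner ℝ (g (x - t) • basisVec i)
          (gradient (fun y => φ (-(y + -x))) (x - t)) = -((g (x - t) • gradient φ t) i) := by
        intro t
        rw [gradient_comp_add (fun y => φ (-y)), gradient_comp_neg, basisVec, inner_smul_left,
          EuclideanSpace.inner_single_left]
        simp
      simp only [h3, integral_neg, neg_eq_zero] at h2
      simpa using h2
    have hd : ∀ x, fderiv ℝ (φ ⋆[ContinuousLinearMap.lsmul ℝ ℝ] g) x = 0 := fun x => by
      have := hgrad x
      simpa [gradient] using this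
    exact ⟨_, fun x => is_const_of_fderiv_eq_zero
      ((contDiff_convolution_isTest hφ hgi).differentiable one_ne_zero) hd x 0⟩
  let b : ℕ → ContDiffBump (0 : Space d) := fun n =>
    ⟨1 / (n + 1) / 2, 1 / (n + 1), by positivity, half_lt_self (by positivity)⟩
  have hb0 : Tendsto (fun n => (b n).rOut) atTop (𝓝 0) := tendsto_one_div_add_atTop_nhds_zero_nat
  have hbK : ∀ᶠ n in atTop, (b n).rOut ≤ 2 * (b n).rIn := Eventually.of_forall fun n => by
    simp only [b]
    linarith
  have hae := ContDiffBump.ae_convolution_tendsto_right_of_locallyIntegrable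
    (μ := volume) hb0 hbK hgi
  have htest : ∀ n, IsTest ((b n).normed volume) := fun n =>
    ⟨(b n).contDiff_normed, (b n).hasCompactSupport_normed⟩
  choose c hc using fun n => hconst _ (htest n)
  simp only [hc] at hae
  obtain ⟨x₀, hx₀⟩ := hae.exists
  refine ⟨g x₀, ?_⟩
  filter_upwards [hae] with x hx
  exact tendsto_nhds_unique hx hx₀

/-! ### Measure-preserving flows of `ℝ^d` -/

/-- `S` is a measurable, measure-preserving action of `ℝ^d`; `S 0` only has to be the identity
almost everywhere. -/
structure IsFlow {d : ℕ} {X : Type*} [MeasurableSpace X] (S : Space d → X → X) (μ : Measure X) :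
    Prop where
  measurable : Measurable fun p : X × Space d => S p.2 p.1
  add : ∀ y z x, S y (S z x) = S (y + z) x
  mp : ∀ y, MeasurePreserving (S y) μ μ
  zero : ∀ᵐ x ∂μ, S 0 x = x

namespace IsFlow

variable {d : ℕ} {X : Type*} [MeasurableSpace X] {S : Space d → X → X} {μ : Measure X}

lemma ae_neg_comp (hS : IsFlow S μ) (y : Space d) : ∀ᵐ x ∂μ, S (-y) (S y x) = x := by
  filter_upwards [hS.zero] with x hx
  rw [hS.add, neg_add_cancel, hx]

lemma integral_comp (hS : IsFlow S μ) {G : Type*} [NormedAddCommGroup G] [NormedSpace ℝ G]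
    {k : X → G} (hk : AEStronglyMeasurable k μ) (y : Space d) :
    ∫ x, k (S y x) ∂μ = ∫ x, k x ∂μ := by
  have h := (hS.mp y).map_eq
  have hk' : AEStronglyMeasurable k (Measure.map (S y) μ) := by rwa [h]
  rw [← integral_map (hS.mp y).aemeasurable hk', h]

variable [SFinite μ]

lemma quasiMeasurePreserving (hS : IsFlow S μ) (ν : Measure (Space d)) [SFinite ν] :
    Measure.QuasiMeasurePreserving (fun p : X × Space d => S p.2 p.1) (μ.prod ν) μ := by
  refine ⟨hS.measurable, Measure.AbsolutelyContinuous.mk fun s hs h => ?_⟩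
  rw [Measure.map_apply hS.measurable hs, Measure.prod_apply_symm (hS.measurable hs)]
  have : ∀ y, μ ((fun x => (x, y)) ⁻¹' ((fun p : X × Space d => S p.2 p.1) ⁻¹' s)) = 0 := by
    intro y
    exact ((hS.mp y).measure_preimage hs.nullMeasurableSet).trans h
  simp [this]

/-- By Fubini and invariance, almost every orbit spends zero time in a given null set. This carries
identities between L² classes over to realisations. -/
lemma ae_ae (hS : IsFlow S μ) {q : X → Prop} (h : ∀ᵐ x ∂μ, q x) :
    ∀ᵐ x ∂μ, ∀ᵐ y, q (S y x) :=
  Measure.ae_ae_of_ae_prod ((hS.quasiMeasurePreserving volume).ae h)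

/-- Tonelli and invariance: integrating over orbit pieces indexed by K multiplies by the volume of
K. This gives the local L² bounds on realisations. -/
lemma lintegral_setLIntegral (hS : IsFlow S μ) {g : X → ℝ≥0∞} (hg : AEMeasurable g μ)
    (K : Set (Space d)) : ∫⁻ x, (∫⁻ y in K, g (S y x)) ∂μ = volume K * ∫⁻ x, g x ∂μ := by
  have hm : AEMeasurable (fun p : X × Space d => g (S p.2 p.1)) (μ.prod (volume.restrict K)) :=
    hg.comp_quasiMeasurePreserving (hS.quasiMeasurePreserving _)
  rw [lintegral_lintegral_swap hm]
  have h : ∀ y, ∫⁻ x, g (S y x) ∂μ = ∫⁻ x, g x ∂μ := by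
    intro y
    have h := (hS.mp y).map_eq
    have hg' : AEMeasurable g (Measure.map (S y) μ) := by rwa [h]
    rw [← lintegral_map' hg' (hS.mp y).aemeasurable, h]
  simp_rw [h]
  rw [setLIntegral_const, mul_comm]

section L2

variable {G : Type*} [NormedAddCommGroup G]

lemma aestronglyMeasurable_uncurry (hS : IsFlow S μ) {f : X → G} (hf : AEStronglyMeasurable f μ)
    (ν : Measure (Space d)) [SFinite ν] :
    AEStronglyMeasurable (fun p : X × Space d => f (S p.2 p.1)) (μ.prod ν) :=
  hf.comp_quasiMeasurePreserving (hS.quasiMeasurePreserving ν)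

lemma lintegral_eLpNorm_sq (hS : IsFlow S μ) {f : X → G} (hf : AEStronglyMeasurable f μ)
    (K : Set (Space d)) :
    ∫⁻ x, eLpNorm (fun y => f (S y x)) 2 (volume.restrict K) ^ 2 ∂μ =
      volume K * eLpNorm f 2 μ ^ 2 := by
  simp only [eLpNorm_two_sq]
  exact hS.lintegral_setLIntegral (g := fun x => ‖f x‖ₑ ^ 2) (hf.enorm.pow_const 2) K

lemma aemeasurable_eLpNorm (hS : IsFlow S μ) {f : X → G} (hf : AEStronglyMeasurable f μ)
    (K : Set (Space d)) :
    AEMeasurable (fun x => eLpNorm (fun y => f (S y x)) 2 (volume.restrict K) ^ 2) μ := by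
  simp only [eLpNorm_two_sq]
  exact ((hS.aestronglyMeasurable_uncurry hf (volume.restrict K)).enorm.pow_const 2).lintegral_prod_right'

/-- Almost all realisations of a square integrable function are locally square integrable. -/
lemma ae_locallyL2 (hS : IsFlow S μ) {f : X → G} (hf : MemLp f 2 μ) :
    ∀ᵐ x ∂μ, LocallyL2 fun y => f (S y x) := by
  simp only [locallyL2_iff, ae_all_iff]
  intro n
  have hfin : ∫⁻ x, eLpNorm (fun y => f (S y x)) 2 (volume.restrict (bigBall d n)) ^ 2 ∂μ ≠ ⊤ := by
    rw [hS.lintegral_eLpNorm_sq hf.1]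
    exact ENNReal.mul_ne_top (volume_bigBall_ne_top d n) (ENNReal.pow_ne_top hf.2.ne)
  filter_upwards [(hS.aestronglyMeasurable_uncurry hf.1 (volume.restrict (bigBall d n))).prodMk_left,
    ae_lt_top' (hS.aemeasurable_eLpNorm hf.1 _) hfin] with x h1 h2
  exact ⟨h1, by simpa using h2⟩

end L2

/-! ### Correlations with a kernel -/

section Corr

variable {G T K R F : Type*} [NormedAddCommGroup G] [NormedSpace ℝ G] [NormedAddCommGroup T]
  [NormedSpace ℝ T] [NormedAddCommGroup K] [NormedSpace ℝ K] [NormedAddCommGroup R]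
  [NormedSpace ℝ R] [NormedAddCommGroup F] [NormedSpace ℝ F]

lemma aestronglyMeasurable_corr (hS : IsFlow S μ) (L : G →L[ℝ] T →L[ℝ] K) {ψ : X → G}
    (hψ : AEStronglyMeasurable ψ μ) {θ : Space d → T} (hθ : Continuous θ) :
    AEStronglyMeasurable (fun p : X × Space d => L (ψ (S p.2 p.1)) (θ p.2)) (μ.prod volume) :=
  L.aestronglyMeasurable_comp₂ (hS.aestronglyMeasurable_uncurry hψ volume)
    (hθ.aestronglyMeasurable.comp_quasiMeasurePreserving Measure.quasiMeasurePreserving_snd)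

/-- Cauchy–Schwarz on a ball that contains the support of θ reduces this to the mean L² norm of an
orbit piece. -/
lemma lintegral_corr_sq_lt_top (hS : IsFlow S μ) (L : G →L[ℝ] T →L[ℝ] K) {ψ : X → G}
    (hψ : MemLp ψ 2 μ) {θ : Space d → T} (hθ : Continuous θ) (hθc : HasCompactSupport θ) :
    ∫⁻ x, (∫⁻ y, ‖L (ψ (S y x)) (θ y)‖ₑ) ^ 2 ∂μ < ⊤ := by
  obtain ⟨n, hn⟩ := exists_forall_integral_eq_bigBall hθc
  set N := eLpNorm θ 2 (volume.restrict (bigBall d n)) with hN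
  have hNt : N ≠ ⊤ := (locallyL2_iff.1 hθ.locallyL2 n).2.ne
  have hpt : ∀ᵐ x ∂μ, (∫⁻ y, ‖L (ψ (S y x)) (θ y)‖ₑ) ^ 2 ≤
      (‖L‖ₑ * N) ^ 2 * eLpNorm (fun y => ψ (S y x)) 2 (volume.restrict (bigBall d n)) ^ 2 := by
    filter_upwards [hS.ae_locallyL2 hψ] with x hx
    have h1 : ∫⁻ y, ‖L (ψ (S y x)) (θ y)‖ₑ = ∫⁻ y in bigBall d n, ‖L (ψ (S y x)) (θ y)‖ₑ := by
      rw [← lintegral_indicator (measurableSet_bigBall d n)]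
      refine lintegral_congr fun y => ?_
      by_cases hy : y ∈ bigBall d n
      · rw [Set.indicator_of_mem hy]
      · rw [Set.indicator_of_notMem hy, hn y hy, map_zero, enorm_zero]
    rw [h1, ← mul_pow]
    gcongr
    refine (lintegral_enorm_bilin_le L (locallyL2_iff.1 hx n).1
      hθ.aestronglyMeasurable).trans_eq ?_
    ring
  refine (lintegral_mono_ae hpt).trans_lt ?_
  rw [lintegral_const_mul'' _ (hS.aemeasurable_eLpNorm hψ.1 _), hS.lintegral_eLpNorm_sq hψ.1]
  exact ENNReal.mul_lt_top (ENNReal.pow_lt_top (ENNReal.mul_lt_top (by simp) hNt.lt_top))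
    (ENNReal.mul_lt_top (volume_bigBall_ne_top d n).lt_top (ENNReal.pow_lt_top hψ.2))

lemma memLp_corr (hS : IsFlow S μ) (L : G →L[ℝ] T →L[ℝ] K) {ψ : X → G}
    (hψ : MemLp ψ 2 μ) {θ : Space d → T} (hθ : Continuous θ) (hθc : HasCompactSupport θ) :
    MemLp (fun x => ∫ y, L (ψ (S y x)) (θ y)) 2 μ := by
  refine ⟨(hS.aestronglyMeasurable_corr L hψ.1 hθ).integral_prod_right', ?_⟩
  have h : eLpNorm (fun x => ∫ y, L (ψ (S y x)) (θ y)) 2 μ ^ 2 < ⊤ := by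
    rw [eLpNorm_two_sq]
    refine (lintegral_mono fun x => ?_).trans_lt (hS.lintegral_corr_sq_lt_top L hψ hθ hθc)
    gcongr
    exact enorm_integral_le_lintegral_enorm _
  simpa using h

lemma integrable_corr (hS : IsFlow S μ) (M : F →L[ℝ] K →L[ℝ] R) (L : G →L[ℝ] T →L[ℝ] K)
    {f : X → F} (hf : MemLp f 2 μ) {ψ : X → G} (hψ : MemLp ψ 2 μ) {θ : Space d → T}
    (hθ : Continuous θ) (hθc : HasCompactSupport θ) :
    Integrable (fun p : X × Space d => M (f p.1) (L (ψ (S p.2 p.1)) (θ p.2))) (μ.prod volume) := by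
  have hmL := hS.aestronglyMeasurable_corr L hψ.1 hθ
  have hmf : AEStronglyMeasurable (fun p : X × Space d => f p.1) (μ.prod volume) :=
    hf.1.comp_quasiMeasurePreserving Measure.quasiMeasurePreserving_fst
  refine ⟨M.aestronglyMeasurable_comp₂ hmf hmL, ?_⟩
  rw [HasFiniteIntegral, lintegral_prod _ (M.aestronglyMeasurable_comp₂ hmf hmL).enorm]
  have hpt : ∀ x, ∫⁻ y, ‖M (f x) (L (ψ (S y x)) (θ y))‖ₑ ≤
      ‖M‖ₑ * (‖f x‖ₑ ^ 2 + (∫⁻ y, ‖L (ψ (S y x)) (θ y)‖ₑ) ^ 2) := by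
    intro x
    calc ∫⁻ y, ‖M (f x) (L (ψ (S y x)) (θ y))‖ₑ
        ≤ ∫⁻ y, (‖M‖ₑ * ‖f x‖ₑ) * ‖L (ψ (S y x)) (θ y)‖ₑ := by
          refine lintegral_mono fun y => ?_
          simp only [← ofReal_norm]
          rw [← ENNReal.ofReal_mul (norm_nonneg _), ← ENNReal.ofReal_mul (by positivity)]
          exact ENNReal.ofReal_le_ofReal (M.le_opNorm₂ _ _)
      _ = (‖M‖ₑ * ‖f x‖ₑ) * ∫⁻ y, ‖L (ψ (S y x)) (θ y)‖ₑ :=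
          lintegral_const_mul' _ _ (ENNReal.mul_ne_top (by simp) (by simp))
      _ ≤ _ := by
          rw [mul_assoc]
          gcongr
          set a := ‖f x‖ₑ
          set b := ∫⁻ y, ‖L (ψ (S y x)) (θ y)‖ₑ
          rcases le_total a b with h | h
          · calc a * b ≤ b ^ 2 := by rw [sq]; gcongr
              _ ≤ _ := le_add_self
          · calc a * b ≤ a ^ 2 := by rw [sq]; gcongr
              _ ≤ _ := le_self_add
  refine (lintegral_mono hpt).trans_lt ?_
  rw [lintegral_const_mul' _ _ (by simp), lintegral_add_left' (hf.1.enorm.pow_const 2),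
    ← eLpNorm_two_sq]
  exact ENNReal.mul_lt_top (by simp) (ENNReal.add_lt_top.2 ⟨ENNReal.pow_lt_top hf.2,
    hS.lintegral_corr_sq_lt_top L hψ hθ hθc⟩)

/-- Fubini for smoothing along orbits. The two bilinear maps cover all cases in use: vector field
against smoothed gradient, scalar against smoothed flux, and constants. -/
lemma integral_corr_swap [CompleteSpace K] [CompleteSpace R] (hS : IsFlow S μ)
    (M : F →L[ℝ] K →L[ℝ] R) (L : G →L[ℝ] T →L[ℝ] K)
    {f : X → F} (hf : MemLp f 2 μ) {ψ : X → G} (hψ : MemLp ψ 2 μ) {θ : Space d → T}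
    (hθ : Continuous θ) (hθc : HasCompactSupport θ) :
    ∫ x, M (f x) (∫ y, L (ψ (S y x)) (θ y)) ∂μ =
      ∫ y, ∫ x, M (f x) (L (ψ (S y x)) (θ y)) ∂μ := by
  have hint := hS.integrable_corr M L hf hψ hθ hθc
  rw [← integral_integral_swap hint]
  refine integral_congr_ae ?_
  filter_upwards [hS.ae_locallyL2 hψ] with x hx
  exact ((M (f x)).integral_comp_comm
    (integrable_bilin_of_hasCompactSupport L hx hθ hθc)).symm

end Corr

end IsFlow

/-! ### Stationary potential fields -/

/-- The inner product of `ℝ^d` as a bilinear map. -/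
noncomputable def innerL (d : ℕ) : Space d →L[ℝ] Space d →L[ℝ] ℝ := innerSL ℝ

@[simp]
lemma innerL_apply {d : ℕ} (v w : Space d) : innerL d v w = inner ℝ v w := rfl

/-- The gradient field `x ↦ ∫ ψ(S_y x) ∇φ(y) dy`. -/
noncomputable def gradConv {d : ℕ} {X : Type*} (S : Space d → X → X) (φ : Space d → ℝ) (ψ : X → ℝ)
    (x : X) : Space d :=
  ∫ y, ψ (S y x) • gradient φ y

/-- The closed subspace of `L²` generated by the gradient fields `gradConv S φ ψ`. -/
noncomputable def potentialFields {d : ℕ} {X : Type*} [MeasurableSpace X] (S : Space d → X → X)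
    (μ : Measure X) : Submodule ℝ (Lp (Space d) 2 μ) :=
  (Submodule.span ℝ {g : Lp (Space d) 2 μ | ∃ φ ψ, IsTest φ ∧ MemLp ψ 2 μ ∧
    g =ᵐ[μ] gradConv S φ ψ}).topologicalClosure

instance {d : ℕ} {X : Type*} [MeasurableSpace X] (S : Space d → X → X) (μ : Measure X) :
    CompleteSpace (potentialFields S μ) :=
  Submodule.topologicalClosure.completeSpace _

namespace IsFlow

variable {d : ℕ} {X : Type*} [MeasurableSpace X] {S : Space d → X → X} {μ : Measure X} [SFinite μ]

lemma memLp_gradConv (hS : IsFlow S μ) {φ : Space d → ℝ} (hφ : IsTest φ) {ψ : X → ℝ}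
    (hψ : MemLp ψ 2 μ) : MemLp (gradConv S φ ψ) 2 μ :=
  hS.memLp_corr (ContinuousLinearMap.lsmul ℝ ℝ : ℝ →L[ℝ] Space d →L[ℝ] _) hψ
    hφ.continuous_gradient hφ.hasCompactSupport_gradient

lemma toLp_gradConv_mem (hS : IsFlow S μ) {φ : Space d → ℝ} (hφ : IsTest φ) {ψ : X → ℝ}
    (hψ : MemLp ψ 2 μ) : (hS.memLp_gradConv hφ hψ).toLp _ ∈ potentialFields S μ :=
  Submodule.le_topologicalClosure _ (Submodule.subset_span ⟨φ, ψ, hφ, hψ, MemLp.coeFn_toLp _⟩)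

/-- Integration by parts along the flow. -/
lemma integral_inner_gradConv (hS : IsFlow S μ) {φ : Space d → ℝ} (hφ : IsTest φ) {ψ : X → ℝ}
    (hψ : MemLp ψ 2 μ) {f : X → Space d} (hf : MemLp f 2 μ) :
    ∫ x, inner ℝ (f x) (gradConv S φ ψ x) ∂μ =
      -∫ x, ψ x * (∫ y, inner ℝ (f (S y x)) (gradient (fun z => φ (-z)) y)) ∂μ := by
  have h1 := hS.integral_corr_swap (innerL d)
    (ContinuousLinearMap.lsmul ℝ ℝ : ℝ →L[ℝ] Space d →L[ℝ] _) hf hψ hφ.continuous_gradient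
    hφ.hasCompactSupport_gradient
  have h2 := hS.integral_corr_swap (ContinuousLinearMap.lsmul ℝ ℝ : ℝ →L[ℝ] ℝ →L[ℝ] ℝ)
    (innerL d) hψ hf hφ.comp_neg.continuous_gradient
    hφ.comp_neg.hasCompactSupport_gradient
  simp only [innerL_apply, ContinuousLinearMap.lsmul_apply, smul_eq_mul] at h1 h2
  -- After the substitution y ↦ −y, invariance under S_y moves the flow from ψ to f. The minus sign
  -- comes from the gradient of the reflected test function.
  rw [show (∫ x, inner ℝ (f x) (gradConv S φ ψ x) ∂μ) =
    ∫ x, inner ℝ (f x) (∫ y, ψ (S y x) • gradient φ y) ∂μ from rfl, h1, h2,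
    ← integral_neg_eq_self (fun y => ∫ x, inner ℝ (f x) (ψ (S y x) • gradient φ y) ∂μ),
    ← integral_neg]
  refine integral_congr_ae (Eventually.of_forall fun y => ?_)
  have hm : AEStronglyMeasurable
      (fun x => inner ℝ (f x) (ψ (S (-y) x) • gradient φ (-y))) μ :=
    hf.1.inner ((hψ.1.comp_measurePreserving (hS.mp (-y))).smul_const _)
  dsimp only
  rw [← hS.integral_comp hm y, ← integral_neg]
  refine integral_congr_ae ?_
  filter_upwards [hS.ae_neg_comp y] with x hx
  rw [hx, gradient_comp_neg, inner_smul_right, inner_neg_right, mul_neg, neg_neg]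

/-- The orthogonal complement of the potential fields consists of the divergence-free fields. -/
theorem mem_orthogonal_potentialFields (hS : IsFlow S μ) (f : Lp (Space d) 2 μ) :
    f ∈ (potentialFields S μ)ᗮ ↔ ∀ᵐ x ∂μ, DivFree fun y => f (S y x) := by
  have hfm : MemLp f 2 μ := Lp.memLp f
  rw [potentialFields, Submodule.orthogonal_closure]
  constructor
  · intro h
    obtain ⟨φ, hφ, hφd⟩ := exists_seq_isTest_divFree d
    have hzero : ∀ n, ∀ᵐ x ∂μ, ∫ y, inner ℝ (f (S y x)) (gradient (φ n) y) = 0 := by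
      intro n
      -- The weight ψ is taken to be the smoothed flux q itself, so that the integration by parts
      -- yields ∫ q² = 0.
      have hq : MemLp (fun x => ∫ y, inner ℝ (f (S y x)) (gradient (φ n) y)) 2 μ :=
        hS.memLp_corr (innerL d) hfm (hφ n).continuous_gradient
          (hφ n).hasCompactSupport_gradient
      have hort := Submodule.inner_left_of_mem_orthogonal (Submodule.subset_span (s := {g : Lp (Space d) 2 μ |
        ∃ φ ψ, IsTest φ ∧ MemLp ψ 2 μ ∧ g =ᵐ[μ] gradConv S φ ψ})
        ⟨_, _, (hφ n).comp_neg, hq, MemLp.coeFn_toLp (hS.memLp_gradConv (hφ n).comp_neg hq)⟩) h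
      have hpair := hS.integral_inner_gradConv (hφ n).comp_neg hq hfm
      simp only [neg_neg] at hpair
      have hinner : ∫ x, inner ℝ (f x) (gradConv S (fun z => φ n (-z))
          (fun x => ∫ y, inner ℝ (f (S y x)) (gradient (φ n) y)) x) ∂μ = 0 := by
        rw [← hort, L2.inner_def]
        refine integral_congr_ae ?_
        filter_upwards [MemLp.coeFn_toLp (hS.memLp_gradConv (hφ n).comp_neg hq)] with x hx
        rw [hx]
      rw [hinner, eq_comm, neg_eq_zero] at hpair
      have hsq := (integral_eq_zero_iff_of_nonneg (fun x => mul_self_nonneg _)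
        (hq.integrable_mul hq)).1 hpair
      filter_upwards [hsq] with x hx
      exact mul_self_eq_zero.1 hx
    filter_upwards [ae_all_iff.2 hzero, hS.ae_locallyL2 hfm] with x hx hl
    exact hφd _ hl hx
  · intro h
    -- Conversely it is enough to test f against the generators, where integration by parts produces
    -- the pairing that vanishes by hypothesis.
    have hle : Submodule.span ℝ {g : Lp (Space d) 2 μ | ∃ φ ψ, IsTest φ ∧ MemLp ψ 2 μ ∧
        g =ᵐ[μ] gradConv S φ ψ} ≤ (Submodule.span ℝ {f})ᗮ := by
      rw [Submodule.span_le]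
      rintro g ⟨φ, ψ, hφ, hψ, hg⟩
      rw [SetLike.mem_coe, Submodule.mem_orthogonal_singleton_iff_inner_right, L2.inner_def]
      have hpair := hS.integral_inner_gradConv hφ hψ hfm
      have h0 : ∫ x, ψ x * (∫ y, inner ℝ (f (S y x)) (gradient (fun z => φ (-z)) y)) ∂μ = 0 := by
        rw [integral_eq_zero_of_ae]
        filter_upwards [h] with x hx
        rw [hx _ hφ.comp_neg, mul_zero, Pi.zero_apply]
      rw [h0, neg_zero] at hpair
      rw [← hpair]
      refine integral_congr_ae ?_
      filter_upwards [hg] with x hx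
      rw [hx]
    intro g hg
    have := Submodule.mem_orthogonal_singleton_iff_inner_right.1 (hle hg)
    rwa [real_inner_comm]

/-! ### Realisations of potential fields are gradients -/

/-- Along an orbit a generator is the gradient of −(φ(−·)) ⋆ ψ(S_· x), a C¹ function; the rest is
linearity. The clause on periods is kept because it later makes the potentials of the periodic
problems periodic. -/
lemma exists_contDiff_of_mem_span (hS : IsFlow S μ) {g : Lp (Space d) 2 μ}
    (hg : g ∈ Submodule.span ℝ {g : Lp (Space d) 2 μ | ∃ φ ψ, IsTest φ ∧ MemLp ψ 2 μ ∧
      g =ᵐ[μ] gradConv S φ ψ}) :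
    ∀ᵐ x ∂μ, ∃ u : Space d → ℝ, ContDiff ℝ 1 u ∧ (∀ᵐ y, g (S y x) = gradient u y) ∧
      ∀ a, (∀ z, S a z = S 0 z) → ∀ y, u (y + a) = u y := by
  induction hg using Submodule.span_induction with
  | mem g hg =>
    obtain ⟨φ, ψ, hφ, hψ, hg⟩ := hg
    filter_upwards [hS.ae_ae hg, hS.ae_locallyL2 hψ] with x hx hl
    have hli := hl.locallyIntegrable
    refine ⟨fun z => -((fun t => φ (-t)) ⋆[ContinuousLinearMap.lsmul ℝ ℝ] fun y => ψ (S y x)) z,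
      (contDiff_convolution_isTest hφ.comp_neg hli).neg, ?_, fun a ha y => ?_⟩
    · filter_upwards [hx] with z hz
      rw [hz, gradConv]
      have h1 : gradient (fun z => -((fun t => φ (-t)) ⋆[ContinuousLinearMap.lsmul ℝ ℝ]
          fun y => ψ (S y x)) z) z =
          -gradient ((fun t => φ (-t)) ⋆[ContinuousLinearMap.lsmul ℝ ℝ] fun y => ψ (S y x)) z := by
        simp only [gradient, fderiv_fun_neg, map_neg]
      rw [h1, gradient_convolution_isTest hφ.comp_neg hli, ← integral_neg,
        ← integral_neg_eq_self]
      refine integral_congr_ae (Eventually.of_forall fun y => ?_)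
      dsimp only
      rw [gradient_comp_neg, hS.add, smul_neg, neg_neg, neg_add_eq_sub]
    · have h1 : ∀ z, ψ (S (z + a) x) = ψ (S z x) := by
        intro z
        rw [← hS.add, ha, hS.add, add_zero]
      simp only [convolution_def, add_sub_right_comm, h1]
  | zero =>
    filter_upwards [hS.ae_ae (Lp.coeFn_zero (Space d) 2 μ)] with x hx
    refine ⟨fun _ => 0, contDiff_const, ?_, fun _ _ _ => rfl⟩
    filter_upwards [hx] with y hy
    rw [hy]
    simp [gradient]
  | add g₁ g₂ _ _ h₁ h₂ =>
    filter_upwards [h₁, h₂, hS.ae_ae (Lp.coeFn_add g₁ g₂)] with x ⟨u₁, hu₁, hg₁, hp₁⟩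
      ⟨u₂, hu₂, hg₂, hp₂⟩ hx
    refine ⟨fun y => u₁ y + u₂ y, hu₁.add hu₂, ?_, fun a ha y => ?_⟩
    · filter_upwards [hg₁, hg₂, hx] with y h1 h2 h3
      rw [h3, Pi.add_apply, h1, h2]
      simp only [gradient]
      rw [fderiv_fun_add (hu₁.differentiable one_ne_zero y) (hu₂.differentiable one_ne_zero y),
        map_add]
    · simp only [hp₁ a ha, hp₂ a ha]
  | smul c g _ h =>
    filter_upwards [h, hS.ae_ae (Lp.coeFn_smul c g)] with x ⟨u, hu, hg, hp⟩ hx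
    refine ⟨fun y => c * u y, contDiff_const.mul hu, ?_, fun a ha y => ?_⟩
    · filter_upwards [hg, hx] with y h1 h2
      rw [h2, Pi.smul_apply, h1]
      simp only [gradient]
      rw [fderiv_const_mul (hu.differentiable one_ne_zero y), map_smul]
    · simp only [hp a ha]

/-- Borel–Cantelli in summed form: the series of squared errors over a ball has a finite integral,
so for almost every x it converges and its terms tend to 0. -/
lemma ae_tendsto_of_fast (hS : IsFlow S μ) {g : ℕ → Lp (Space d) 2 μ} {F : Lp (Space d) 2 μ}
    (h : ∑' k, eLpNorm (fun x => g k x - F x) 2 μ ^ 2 ≠ ⊤) :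
    ∀ᵐ x ∂μ, ∀ n, Tendsto (fun k => eLpNorm (fun y => g k (S y x) - F (S y x)) 2
      (volume.restrict (bigBall d n))) atTop (𝓝 0) := by
  rw [ae_all_iff]
  intro n
  have hm : ∀ k, MemLp (fun x => g k x - F x) 2 μ := fun k => (Lp.memLp (g k)).sub (Lp.memLp F)
  have hint : ∫⁻ x, ∑' k, eLpNorm (fun y => g k (S y x) - F (S y x)) 2
      (volume.restrict (bigBall d n)) ^ 2 ∂μ ≠ ⊤ := by
    rw [lintegral_tsum fun k => hS.aemeasurable_eLpNorm (hm k).1 _]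
    simp_rw [fun k => hS.lintegral_eLpNorm_sq (hm k).1 (bigBall d n)]
    rw [ENNReal.tsum_mul_left]
    exact ENNReal.mul_ne_top (volume_bigBall_ne_top d n) h
  filter_upwards [ae_lt_top' (AEMeasurable.tsum fun k =>
    hS.aemeasurable_eLpNorm (hm k).1 _) hint] with x hx
  have h0 := ENNReal.tendsto_atTop_zero_of_tsum_ne_top hx.ne
  have h1 := (ENNReal.continuous_rpow_const (y := 1 / 2)).tendsto 0 |>.comp h0
  rw [ENNReal.zero_rpow_of_pos (by norm_num)] at h1
  refine h1.congr fun k => ?_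
  simp only [Function.comp_apply, ← ENNReal.rpow_natCast, ← ENNReal.rpow_mul]
  norm_num

/-- Almost all realisations of a potential field are weak gradients. -/
theorem exists_isWeakGradient (hS : IsFlow S μ) {F : Lp (Space d) 2 μ}
    (hF : F ∈ potentialFields S μ) :
    ∀ᵐ x ∂μ, ∃ u : Space d → ℝ, IsWeakGradient u (fun y => F (S y x)) ∧
      ∀ a, (∀ z, S a z = S 0 z) → ∀ᵐ y, u (y + a) = u y := by
  -- Approximants with error 2^{-k}, so that the squared errors are summable.
  have hex : ∀ k : ℕ, ∃ g ∈ Submodule.span ℝ {g : Lp (Space d) 2 μ | ∃ φ ψ, IsTest φ ∧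
      MemLp ψ 2 μ ∧ g =ᵐ[μ] gradConv S φ ψ},
      eLpNorm (fun x => g x - F x) 2 μ < ENNReal.ofReal ((1 / 2) ^ k) := by
    intro k
    have hF' : F ∈ closure (↑(Submodule.span ℝ {g : Lp (Space d) 2 μ | ∃ φ ψ, IsTest φ ∧
      MemLp ψ 2 μ ∧ g =ᵐ[μ] gradConv S φ ψ}) : Set (Lp (Space d) 2 μ)) := hF
    obtain ⟨g, hg, hd⟩ := EMetric.mem_closure_iff.1 hF' (ENNReal.ofReal ((1 / 2) ^ k))
      (ENNReal.ofReal_pos.2 (by positivity))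
    refine ⟨g, hg, ?_⟩
    rw [edist_comm, Lp.edist_def] at hd
    exact hd
  choose g hg hgd using hex
  have hfast : ∑' k, eLpNorm (fun x => g k x - F x) 2 μ ^ 2 ≠ ⊤ := by
    have hle : ∀ k, eLpNorm (fun x => g k x - F x) 2 μ ^ 2 ≤ ENNReal.ofReal ((1 / 4) ^ k) := by
      intro k
      calc eLpNorm (fun x => g k x - F x) 2 μ ^ 2 ≤ ENNReal.ofReal ((1 / 2) ^ k) ^ 2 := by
            gcongr
            exact (hgd k).le
        _ = ENNReal.ofReal ((1 / 4) ^ k) := by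
            rw [← ENNReal.ofReal_pow (by positivity), ← pow_mul, mul_comm, pow_mul]
            norm_num
    refine ((ENNReal.tsum_le_tsum hle).trans_lt ?_).ne
    rw [← ENNReal.ofReal_tsum_of_nonneg (fun k => by positivity)
      (summable_geometric_of_lt_one (by norm_num) (by norm_num))]
    exact ENNReal.ofReal_lt_top
  have hall : ∀ᵐ x ∂μ, ∀ k, ∃ u : Space d → ℝ, ContDiff ℝ 1 u ∧
      (∀ᵐ y, g k (S y x) = gradient u y) ∧
      ∀ a, (∀ z, S a z = S 0 z) → ∀ y, u (y + a) = u y :=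
    ae_all_iff.2 fun k => hS.exists_contDiff_of_mem_span (hg k)
  filter_upwards [hall, hS.ae_tendsto_of_fast hfast, hS.ae_locallyL2 (Lp.memLp F)] with x hx ht hl
  choose u hu hgu hp using hx
  obtain ⟨v, hv, hvp⟩ := exists_isWeakGradient_of_tendsto hu hl fun n => by
    refine (ht n).congr fun k => eLpNorm_congr_ae ?_
    filter_upwards [ae_restrict_of_ae (hgu k)] with y hy
    rw [hy]
  exact ⟨v, hv, fun a ha => hvp a fun k y => hp k a ha y⟩

lemma curlFree_of_mem (hS : IsFlow S μ) {F : Lp (Space d) 2 μ} (hF : F ∈ potentialFields S μ) :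
    ∀ᵐ x ∂μ, CurlFree fun y => F (S y x) := by
  filter_upwards [hS.exists_isWeakGradient hF] with x ⟨u, hu, _⟩
  exact hu.curlFree

end IsFlow

namespace IsFlow

variable {d : ℕ} {X : Type*} [MeasurableSpace X] {S : Space d → X → X} {μ : Measure X}

/-! ### Invariance under the flow -/

/-- Composition with S_y is unitary on L², with adjoint the composition with S_{-y}. -/
lemma inner_compMeasurePreserving (hS : IsFlow S μ) (y : Space d) (f g : Lp (Space d) 2 μ) :
    inner ℝ (Lp.compMeasurePreserving (S y) (hS.mp y) f) g =
      inner ℝ f (Lp.compMeasurePreserving (S (-y)) (hS.mp (-y)) g) := by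
  have hm : AEStronglyMeasurable (fun x => inner ℝ (f x) (g (S (-y) x))) μ :=
    (Lp.memLp f).1.inner ((Lp.memLp g).1.comp_measurePreserving (hS.mp (-y)))
  rw [L2.inner_def, L2.inner_def]
  calc ∫ x, inner ℝ (Lp.compMeasurePreserving (S y) (hS.mp y) f x) (g x) ∂μ
      = ∫ x, inner ℝ (f (S y x)) (g (S (-y) (S y x))) ∂μ := by
        refine integral_congr_ae ?_
        filter_upwards [Lp.coeFn_compMeasurePreserving f (hS.mp y), hS.ae_neg_comp y] with x h1 h2
        rw [h1, h2, Function.comp_apply]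
    _ = ∫ x, inner ℝ (f x) (g (S (-y) x)) ∂μ := hS.integral_comp hm y
    _ = _ := by
        refine integral_congr_ae ?_
        filter_upwards [Lp.coeFn_compMeasurePreserving g (hS.mp (-y))] with x h1
        rw [h1, Function.comp_apply]

variable [SFinite μ]

lemma compMeasurePreserving_mem_orthogonal (hS : IsFlow S μ) (y : Space d) {f : Lp (Space d) 2 μ}
    (hf : f ∈ (potentialFields S μ)ᗮ) :
    Lp.compMeasurePreserving (S y) (hS.mp y) f ∈ (potentialFields S μ)ᗮ := by
  rw [hS.mem_orthogonal_potentialFields] at hf ⊢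
  filter_upwards [hf, hS.ae_ae (Lp.coeFn_compMeasurePreserving f (hS.mp y))] with x h1 h2
  refine (h1.comp_add y).congr ?_
  filter_upwards [h2] with z hz
  rw [hz, Function.comp_apply, hS.add, add_comm]

/-- Invariance is evident for divergence-free fields, whose realisations are merely translated. It
passes to the potentials, the double orthogonal complement, through the adjoint. -/
lemma compMeasurePreserving_mem (hS : IsFlow S μ) (y : Space d) {f : Lp (Space d) 2 μ}
    (hf : f ∈ potentialFields S μ) :
    Lp.compMeasurePreserving (S y) (hS.mp y) f ∈ potentialFields S μ := by
  rw [← Submodule.orthogonal_orthogonal (potentialFields S μ), Submodule.mem_orthogonal']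
  intro g hg
  rw [hS.inner_compMeasurePreserving]
  exact Submodule.inner_right_of_mem_orthogonal hf (hS.compMeasurePreserving_mem_orthogonal _ hg)

lemma integral_inner_corr (hS : IsFlow S μ) (f g : Lp (Space d) 2 μ) {θ : Space d → ℝ}
    (hθ : Continuous θ) (hθc : HasCompactSupport θ) :
    ∫ x, inner ℝ (g x) (∫ y, θ y • f (S y x)) ∂μ =
      ∫ y, θ y * inner ℝ g (Lp.compMeasurePreserving (S y) (hS.mp y) f) := by
  have h := hS.integral_corr_swap (innerL d)
    (ContinuousLinearMap.lsmul ℝ ℝ : ℝ →L[ℝ] Space d →L[ℝ] _).flip (Lp.memLp g) (Lp.memLp f) hθ hθc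
  simp only [innerL_apply, ContinuousLinearMap.flip_apply, ContinuousLinearMap.lsmul_apply] at h
  rw [h]
  refine integral_congr_ae (Eventually.of_forall fun y => ?_)
  dsimp only
  rw [L2.inner_def, ← integral_const_mul]
  refine integral_congr_ae ?_
  filter_upwards [Lp.coeFn_compMeasurePreserving f (hS.mp y)] with x hx
  rw [hx, inner_smul_right, Function.comp_apply]

/-- A curl-free field is the sum of a potential field and of a field with constant realisations. -/
theorem exists_sub_mem_of_curlFree (hS : IsFlow S μ) {F : Lp (Space d) 2 μ}
    (hF : ∀ᵐ x ∂μ, CurlFree fun y => F (S y x)) :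
    ∃ p ∈ (potentialFields S μ)ᗮ, F - p ∈ potentialFields S μ ∧
      ∀ᵐ x ∂μ, ∃ c, ∀ᵐ y, p (S y x) = c := by
  set V := potentialFields S μ with hV
  set p : Lp (Space d) 2 μ := F - V.starProjection F with hp
  have hpV : p ∈ Vᗮ := V.sub_starProjection_mem_orthogonal F
  have hFp : F - p = V.starProjection F := sub_sub_cancel _ _
  have hFpV : F - p ∈ V := hFp ▸ V.starProjection_apply_mem F
  refine ⟨p, hpV, hFpV, ?_⟩
  have hpm : MemLp p 2 μ := Lp.memLp p
  -- The aim is that the part p orthogonal to the potentials has vanishing derivatives along orbits.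
  -- The smoothed derivative c of p is shown to have norm 0.
  have hzero : ∀ φ : Space d → ℝ, IsTest φ → ∀ j : Fin d,
      ∀ᵐ x ∂μ, ∫ y, gradient φ y j • p (S y x) = 0 := by
    intro φ hφ j
    have hθ := (hφ.gradient_apply j).contDiff_one.continuous
    have hθc := (hφ.gradient_apply j).2
    have hc : MemLp (fun x => ∫ y, gradient φ y j • p (S y x)) 2 μ :=
      hS.memLp_corr (ContinuousLinearMap.lsmul ℝ ℝ : ℝ →L[ℝ] Space d →L[ℝ] _).flip hpm hθ hθc
    set c := hc.toLp _ with hcdef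
    set q := c - V.starProjection c with hq
    have hqV : q ∈ Vᗮ := V.sub_starProjection_mem_orthogonal c
    have hFj : MemLp (fun x => F x j) 2 μ := MemLp.euclidean_apply (Lp.memLp F) j
    -- Both V and its complement are invariant under the flow. Hence only the divergence-free part q
    -- of c sees p ∘ S_y, and q cannot distinguish p from F.
    have hpair : ∀ y, inner ℝ c (Lp.compMeasurePreserving (S y) (hS.mp y) p) =
        inner ℝ q (Lp.compMeasurePreserving (S y) (hS.mp y) F) := by
      intro y
      have h1 : c = q + V.starProjection c := by rw [hq, sub_add_cancel]
      have h2 : F = p + (F - p) := by abel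
      have h3 : inner ℝ (V.starProjection c) (Lp.compMeasurePreserving (S y) (hS.mp y) p) = 0 :=
        Submodule.inner_right_of_mem_orthogonal (V.starProjection_apply_mem c)
          (hS.compMeasurePreserving_mem_orthogonal y hpV)
      have h4 : inner ℝ q (Lp.compMeasurePreserving (S y) (hS.mp y) (F - p)) = 0 :=
        Submodule.inner_left_of_mem_orthogonal (hS.compMeasurePreserving_mem y hFpV) hqV
      calc inner ℝ c (Lp.compMeasurePreserving (S y) (hS.mp y) p)
          = inner ℝ q (Lp.compMeasurePreserving (S y) (hS.mp y) p) := by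
            conv_lhs => rw [h1]
            rw [inner_add_left, h3, add_zero]
        _ = _ := by
            conv_rhs => rw [h2]
            rw [map_add, inner_add_right, h4, add_zero]
    -- Here curl-freeness enters: exchanging the indices turns the ∂_jφ-average of F into the
    -- potential field built from the j-th component of F, which is orthogonal to q.
    have hgrad : ∀ᵐ x ∂μ, ∫ y, gradient φ y j • F (S y x) = gradConv S φ (fun x => F x j) x := by
      filter_upwards [hF, hS.ae_locallyL2 (Lp.memLp F)] with x hx hl
      have i1 : Integrable fun y => gradient φ y j • F (S y x) :=
        integrable_bilin_of_hasCompactSupport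
          (ContinuousLinearMap.lsmul ℝ ℝ : ℝ →L[ℝ] Space d →L[ℝ] _).flip hl hθ hθc
      have i2 : Integrable fun y => F (S y x) j • gradient φ y :=
        integrable_bilin_of_hasCompactSupport
          (ContinuousLinearMap.lsmul ℝ ℝ : ℝ →L[ℝ] Space d →L[ℝ] _) (hl.apply j)
          hφ.continuous_gradient hφ.hasCompactSupport_gradient
      refine PiLp.ext fun i => ?_
      rw [gradConv, integral_euclidean_apply i1, integral_euclidean_apply i2]
      simp only [PiLp.smul_apply, smul_eq_mul]
      rw [← hx φ hφ i j]
      simp only [mul_comm]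
    have hnorm : inner ℝ c c = 0 := by
      have e1 : inner ℝ c c = ∫ x, inner ℝ (c x) (∫ y, gradient φ y j • p (S y x)) ∂μ := by
        rw [L2.inner_def]
        refine integral_congr_ae ?_
        filter_upwards [hc.coeFn_toLp] with x hx
        rw [← hx]
      rw [e1, hS.integral_inner_corr p c hθ hθc]
      simp_rw [hpair]
      rw [← hS.integral_inner_corr F q hθ hθc]
      have e2 := Submodule.inner_left_of_mem_orthogonal (hS.toLp_gradConv_mem hφ hFj) hqV
      rw [← e2, L2.inner_def]
      refine integral_congr_ae ?_
      filter_upwards [hgrad, (hS.memLp_gradConv hφ hFj).coeFn_toLp] with x h1 h2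
      rw [h1, h2]
    have hc0 : c = 0 := inner_self_eq_zero.1 hnorm
    have hae := hc.coeFn_toLp
    rw [← hcdef, hc0] at hae
    filter_upwards [hae, Lp.coeFn_zero (Space d) 2 μ] with x h1 h2
    rw [← h1, h2, Pi.zero_apply]
  obtain ⟨φ, hφ, hφd⟩ := exists_seq_isTest_divFree d
  have hall : ∀ᵐ x ∂μ, ∀ n, ∀ j : Fin d, ∫ y, gradient (φ n) y j • p (S y x) = 0 :=
    ae_all_iff.2 fun n => ae_all_iff.2 fun j => hzero _ (hφ n) j
  filter_upwards [hall, hS.ae_locallyL2 hpm] with x hx hl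
  have hcomp : ∀ i : Fin d, ∃ c, ∀ᵐ y, p (S y x) i = c := by
    intro i
    refine exists_const_of_forall_divFree (hl.apply i) fun j => hφd _ ?_ fun n => ?_
    · intro K hK
      exact (ContinuousLinearMap.toSpanSingleton ℝ (basisVec j)).comp_memLp' ((hl.apply i) K hK)
    · have h1 := congrArg (fun v : Space d => v i) (hx n j)
      have i1 : Integrable fun y => gradient (φ n) y j • p (S y x) :=
        integrable_bilin_of_hasCompactSupport
          (ContinuousLinearMap.lsmul ℝ ℝ : ℝ →L[ℝ] Space d →L[ℝ] _).flip hl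
          ((hφ n).gradient_apply j).contDiff_one.continuous ((hφ n).gradient_apply j).2
      simp only [integral_euclidean_apply i1, PiLp.smul_apply, smul_eq_mul, PiLp.zero_apply] at h1
      rw [← h1]
      refine integral_congr_ae (Eventually.of_forall fun y => ?_)
      dsimp only
      rw [inner_smul_left, basisVec, EuclideanSpace.inner_single_left]
      simp [mul_comm]
  choose c hc using hcomp
  refine ⟨WithLp.toLp 2 c, ?_⟩
  filter_upwards [ae_all_iff.2 hc] with y hy
  exact PiLp.ext hy

end IsFlow

/-! ### Lax–Milgram -/

/-- The form (f, h) ↦ ⟨T f, h⟩ is restricted to V, and −g enters through its projection onto V. No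
symmetry of T is needed. -/
theorem exists_mem_forall_inner_add_eq_zero {H : Type*} [NormedAddCommGroup H]
    [InnerProductSpace ℝ H] (V : Submodule ℝ H) [CompleteSpace V] (T : H →L[ℝ] H) {α : ℝ}
    (hα : 0 < α) (hT : ∀ f ∈ V, α * ‖f‖ ^ 2 ≤ inner ℝ (T f) f) (g : H) :
    ∃ f ∈ V, T f + g ∈ Vᗮ := by
  let B : V →L[ℝ] V →L[ℝ] ℝ :=
    ContinuousLinearMap.bilinearComp (innerSL ℝ : H →L[ℝ] H →L[ℝ] ℝ) (T.comp V.subtypeL) V.subtypeL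
  have hB : IsCoercive B := ⟨α, hα, fun v => by
    have := hT v v.2
    rw [sq, ← mul_assoc] at this
    exact this⟩
  let v : V := (hB.continuousLinearEquivOfBilin).symm (-V.orthogonalProjectionOnto g)
  refine ⟨v, v.2, fun w hw => ?_⟩
  have h1 := hB.continuousLinearEquivOfBilin_apply v ⟨w, hw⟩
  rw [ContinuousLinearEquiv.apply_symm_apply] at h1
  have h2 : inner ℝ (-V.orthogonalProjectionOnto g) (⟨w, hw⟩ : V) = -inner ℝ g w := by
    rw [inner_neg_left, Submodule.inner_orthogonalProjectionOnto_eq_of_mem_right (⟨w, hw⟩ : V) g]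
  have h3 : B v ⟨w, hw⟩ = inner ℝ (T v) w := rfl
  rw [h2, h3] at h1
  rw [real_inner_comm, inner_add_left, ← h1, neg_add_cancel]

/-! ### Multiplication by a matrix field -/

section MatrixField

variable {d : ℕ} {X : Type*} [MeasurableSpace X] {μ : Measure X}

lemma app_apply (A : Matrix (Fin d) (Fin d) ℝ) (v : Space d) (i : Fin d) :
    app A v i = ∑ j, A i j * v j := by
  simp [app, Matrix.toLpLin_apply, Matrix.mulVec, dotProduct]

lemma app_add (A : Matrix (Fin d) (Fin d) ℝ) (v w : Space d) :
    app A (v + w) = app A v + app A w := map_add _ _ _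

lemma app_smul (A : Matrix (Fin d) (Fin d) ℝ) (c : ℝ) (v : Space d) :
    app A (c • v) = c • app A v := map_smul _ _ _

lemma app_sub (A : Matrix (Fin d) (Fin d) ℝ) (v w : Space d) :
    app A (v - w) = app A v - app A w := map_sub _ _ _

@[simp]
lemma app_zero (A : Matrix (Fin d) (Fin d) ℝ) : app A (0 : Space d) = 0 := map_zero _

lemma add_app (A B : Matrix (Fin d) (Fin d) ℝ) (v : Space d) :
    app (A + B) v = app A v + app B v := by simp [app]

lemma smul_app (c : ℝ) (A : Matrix (Fin d) (Fin d) ℝ) (v : Space d) :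
    app (c • A) v = c • app A v := by simp [app]

lemma inner_app_transpose (A : Matrix (Fin d) (Fin d) ℝ) (v w : Space d) :
    inner ℝ (app A.transpose v) w = inner ℝ v (app A w) := by
  rw [PiLp.inner_apply, PiLp.inner_apply]
  simp only [app_apply, Matrix.transpose_apply, RCLike.inner_apply, conj_trivial, Finset.mul_sum,
    Finset.sum_mul]
  rw [Finset.sum_comm]
  refine Finset.sum_congr rfl fun i _ => Finset.sum_congr rfl fun j _ => ?_
  ring

lemma continuous_app (A : Matrix (Fin d) (Fin d) ℝ) : Continuous (app A) :=
  (Matrix.toEuclideanLin A).continuous_of_finiteDimensional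

lemma aestronglyMeasurable_app {a : X → Matrix (Fin d) (Fin d) ℝ}
    (ha : ∀ i j, AEMeasurable (fun x => a x i j) μ) {f : X → Space d}
    (hf : AEStronglyMeasurable f μ) : AEStronglyMeasurable (fun x => app (a x) (f x)) μ := by
  have h1 : AEMeasurable (fun x i => ∑ j, a x i j * f x j) μ := by
    refine aemeasurable_pi_lambda _ fun i => Finset.aemeasurable_fun_sum _ fun j _ =>
      (ha i j).mul ?_
    exact ((EuclideanSpace.proj j : Space d →L[ℝ] ℝ).continuous.comp_aestronglyMeasurable
      hf).aemeasurable
  have h2 : AEMeasurable (fun x => WithLp.toLp 2 fun i => ∑ j, a x i j * f x j) μ :=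
    (PiLp.continuous_toLp 2 fun _ : Fin d => ℝ).measurable.comp_aemeasurable h1
  refine h2.aestronglyMeasurable.congr (Eventually.of_forall fun x => ?_)
  exact PiLp.ext fun i => (app_apply _ _ _).symm

/-- `a` is a measurable matrix field, bounded by `β`. -/
structure IsBoundedField (μ : Measure X) (a : X → Matrix (Fin d) (Fin d) ℝ) (β : ℝ) : Prop where
  meas : ∀ i j, AEMeasurable (fun x => a x i j) μ
  bound : ∀ᵐ x ∂μ, ∀ ξ : Space d, ‖app (a x) ξ‖ ≤ β * ‖ξ‖

namespace IsBoundedField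

variable {a : X → Matrix (Fin d) (Fin d) ℝ} {β : ℝ}

lemma memLp (ha : IsBoundedField μ a β) {f : X → Space d} (hf : MemLp f 2 μ) :
    MemLp (fun x => app (a x) (f x)) 2 μ := by
  refine MemLp.of_le_mul (c := β) hf (aestronglyMeasurable_app ha.meas hf.1) ?_
  filter_upwards [ha.bound] with x hx using hx _

/-- Multiplication by a bounded matrix field, as an operator on `L²`. -/
noncomputable def mulOp (ha : IsBoundedField μ a β) :
    Lp (Space d) 2 μ →L[ℝ] Lp (Space d) 2 μ :=
  LinearMap.mkContinuous
    { toFun := fun f => (ha.memLp (Lp.memLp f)).toLp _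
      map_add' := fun f g => by
        rw [← MemLp.toLp_add, MemLp.toLp_eq_toLp_iff]
        filter_upwards [Lp.coeFn_add f g] with x hx
        rw [hx, Pi.add_apply, app_add, Pi.add_apply]
      map_smul' := fun c f => by
        rw [RingHom.id_apply, ← MemLp.toLp_const_smul, MemLp.toLp_eq_toLp_iff]
        filter_upwards [Lp.coeFn_smul c f] with x hx
        rw [hx, Pi.smul_apply, app_smul, Pi.smul_apply] } β fun f => by
    refine Lp.norm_le_mul_norm_of_ae_le_mul ?_
    filter_upwards [(ha.memLp (Lp.memLp f)).coeFn_toLp, ha.bound] with x h1 h2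
    simp only [LinearMap.coe_mk, AddHom.coe_mk]
    rw [h1]
    exact h2 _

lemma coeFn_mulOp (ha : IsBoundedField μ a β) (f : Lp (Space d) 2 μ) :
    ha.mulOp f =ᵐ[μ] fun x => app (a x) (f x) :=
  (ha.memLp (Lp.memLp f)).coeFn_toLp

lemma mulOp_toLp (ha : IsBoundedField μ a β) {f : X → Space d} (hf : MemLp f 2 μ) :
    ha.mulOp (hf.toLp f) = (ha.memLp hf).toLp _ := by
  refine Lp.ext ?_
  filter_upwards [ha.coeFn_mulOp (hf.toLp f), (ha.memLp hf).coeFn_toLp, hf.coeFn_toLp] with x h1 h2 h3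
  rw [h1, h2, h3]

lemma coercive_mulOp (ha : IsBoundedField μ a β) {α : ℝ}
    (hα : ∀ᵐ x ∂μ, ∀ ξ : Space d, α * ‖ξ‖ ^ 2 ≤ inner ℝ (app (a x) ξ) ξ)
    (f : Lp (Space d) 2 μ) : α * ‖f‖ ^ 2 ≤ inner ℝ (ha.mulOp f) f := by
  have hn : ‖f‖ ^ 2 = ∫ x, ‖f x‖ ^ 2 ∂μ := by
    rw [← real_inner_self_eq_norm_sq, L2.inner_def]
    simp only [real_inner_self_eq_norm_sq]
  rw [hn, L2.inner_def, ← integral_const_mul]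
  refine integral_mono_ae ?_ (L2.integrable_inner _ _) ?_
  · exact ((Lp.memLp f).integrable_norm_pow two_ne_zero).const_mul α
  · filter_upwards [hα, ha.coeFn_mulOp f] with x h1 h2
    rw [h2]
    exact h1 _

end IsBoundedField

end MatrixField

/-! ### The translation flow on `ℝ^d` -/

lemma isFlow_translation (d : ℕ) :
    IsFlow (fun (y x : Space d) => x + y) (volume : Measure (Space d)) where
  measurable := measurable_fst.add measurable_snd
  add y z x := by rw [add_assoc, add_comm z]
  mp y := measurePreserving_add_right volume y
  zero := Eventually.of_forall fun x => add_zero x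

/-- A curl-free field in `L²(ℝ^d)` is a potential field. -/
theorem mem_potentialFields_translation {d : ℕ} (hd : 0 < d)
    {F : Lp (Space d) 2 (volume : Measure (Space d))} (hF : CurlFree F) :
    F ∈ potentialFields (fun (y x : Space d) => x + y) volume := by
  obtain ⟨p, -, hFp, hc⟩ := (isFlow_translation d).exists_sub_mem_of_curlFree (F := F)
    (Eventually.of_forall fun x => by simpa only [add_comm] using hF.comp_add x)
  obtain ⟨x, c, hx⟩ := hc.exists
  have hpc : ∀ᵐ y, p y = c := by
    have := (measurePreserving_add_left volume (-x)).quasiMeasurePreserving.ae hx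
    simpa using this
  have hmem : MemLp (fun _ : Space d => c) 2 volume := (Lp.memLp p).ae_eq hpc
  rw [memLp_const_iff (by simp) (by simp)] at hmem
  -- A nonzero constant is not square integrable when the volume is infinite. In dimension 0 the
  -- space is a point of finite volume, hence the hypothesis `hd`.
  have hinf : ¬ (volume (Set.univ : Set (Space d)) < ⊤) := by
    have : Nonempty (Fin d) := ⟨⟨0, hd⟩⟩
    have : NoncompactSpace (Space d) := NormedSpace.noncompactSpace ℝ _
    simp [measure_univ_of_isAddLeftInvariant]
  have hc0 : c = 0 := hmem.resolve_right hinf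
  have hp0 : p = 0 := by
    refine Lp.ext ?_
    filter_upwards [hpc, Lp.coeFn_zero (Space d) 2 volume] with y h1 h2
    rw [h1, h2, hc0, Pi.zero_apply]
  rwa [hp0, sub_zero] at hFp

/-! ### The lattice and the unit cell -/

section Lattice

variable {d : ℕ}

lemma latt_apply (k : Fin d → ℤ) (i : Fin d) : latt k i = k i := rfl

lemma latt_add (k l : Fin d → ℤ) : latt (k + l) = latt k + latt l := by
  refine PiLp.ext fun i => ?_
  simp [latt_apply]

lemma latt_neg (k : Fin d → ℤ) : latt (-k) = -latt k := by
  refine PiLp.ext fun i => ?_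
  simp [latt_apply]

lemma latt_sub (k l : Fin d → ℤ) : latt (k - l) = latt k - latt l := by
  rw [sub_eq_add_neg, latt_add, latt_neg, sub_eq_add_neg]

@[simp]
lemma latt_zero : latt (0 : Fin d → ℤ) = 0 := by
  refine PiLp.ext fun i => ?_
  simp [latt_apply]

/-- The index of the half-open lattice cell that contains `x`. -/
noncomputable def cellIdx (x : Space d) : Fin d → ℤ := fun i => ⌊x i + 1 / 2⌋

lemma cellIdx_add_latt (x : Space d) (k : Fin d → ℤ) : cellIdx (x + latt k) = cellIdx x + k := by
  funext i
  simp only [cellIdx, PiLp.add_apply, latt_apply, Pi.add_apply]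
  rw [add_right_comm, Int.floor_add_intCast]

lemma cellIdx_sub_latt (x : Space d) (k : Fin d → ℤ) : cellIdx (x - latt k) = cellIdx x - k := by
  rw [sub_eq_add_neg, ← latt_neg, cellIdx_add_latt, sub_eq_add_neg]

lemma measurable_cellIdx : Measurable (cellIdx : Space d → Fin d → ℤ) :=
  measurable_pi_lambda _ fun i => Int.measurable_floor.comp
    ((EuclideanSpace.proj i : Space d →L[ℝ] ℝ).continuous.measurable.add_const _)

lemma measurable_latt : Measurable (latt : (Fin d → ℤ) → Space d) := measurable_of_countable _

lemma measurableSet_cell : MeasurableSet (cell d) := by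
  have : cell d = ⋂ i, {x : Space d | x i ∈ Set.Icc (-(1 / 2) : ℝ) (1 / 2)} := by
    ext x
    simp [cell]
  rw [this]
  exact MeasurableSet.iInter fun i =>
    (EuclideanSpace.proj i : Space d →L[ℝ] ℝ).continuous.measurable measurableSet_Icc

lemma isCompact_cell : IsCompact (cell d) := by
  have h : cell d = WithLp.ofLp ⁻¹' Set.pi Set.univ fun _ : Fin d => Set.Icc (-(1 / 2) : ℝ) (1 / 2) := by
    ext x
    simp only [cell, Set.mem_ofPred_eq, Set.mem_preimage, Set.mem_univ_pi]
  rw [h]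
  exact (PiLp.homeomorph 2 (fun _ : Fin d => ℝ)).isCompact_preimage.2
    (isCompact_univ_pi fun _ => isCompact_Icc)

lemma volume_cell_ne_zero : volume (cell d) ≠ 0 := by
  have hsub : Metric.ball (0 : Space d) (1 / 2) ⊆ cell d := by
    intro x hx i
    rw [mem_ball_zero_iff] at hx
    have h := (PiLp.norm_apply_le x i).trans hx.le
    rw [Real.norm_eq_abs] at h
    exact abs_le.1 h
  exact ((Metric.measure_ball_pos volume _ (by norm_num)).trans_le (measure_mono hsub)).ne'

instance : IsFiniteMeasure (volume.restrict (cell d)) :=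
  ⟨by simpa using (isCompact_cell (d := d)).measure_lt_top⟩

instance : (ae (volume.restrict (cell d))).NeBot := by
  rw [ae_neBot, Ne, Measure.restrict_eq_zero]
  exact volume_cell_ne_zero

/-- Closed cells overlap only on the hyperplanes x_i ∈ ℤ − 1/2, which are null. Off them the closed
and the half-open cells coincide. -/
lemma ae_mem_cell_iff : ∀ᵐ x : Space d, ∀ k : Fin d → ℤ, x - latt k ∈ cell d ↔ cellIdx x = k := by
  have hne : ∀ᵐ x : Space d, ∀ i, ∀ m : ℤ, x i ≠ m - 1 / 2 := by
    rw [ae_all_iff]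
    intro i
    rw [ae_all_iff]
    intro m
    exact (PiLp.volume_preserving_ofLp (Fin d)).quasiMeasurePreserving.ae
      (Measure.ae_eval_ne (μ := fun _ : Fin d => (volume : Measure ℝ)) i ((m : ℝ) - 1 / 2))
  filter_upwards [hne] with x hx k
  simp only [cell, Set.mem_ofPred_eq, PiLp.sub_apply, latt_apply, Set.mem_Icc, funext_iff, cellIdx,
    Int.floor_eq_iff]
  refine forall_congr' fun i => ?_
  have h := hx i (k i + 1)
  push_cast at h
  constructor
  · rintro ⟨h1, h2⟩
    refine ⟨by linarith, lt_of_le_of_ne (by linarith) fun h3 => h (by linarith)⟩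
  · rintro ⟨h1, h2⟩
    exact ⟨by linarith, by linarith⟩

lemma ae_mem_cell_iff_zero : ∀ᵐ x : Space d, x ∈ cell d ↔ cellIdx x = 0 := by
  filter_upwards [ae_mem_cell_iff (d := d)] with x hx
  simpa using hx 0

lemma ae_restrict_cellIdx : ∀ᵐ x ∂volume.restrict (cell d), cellIdx x = 0 := by
  filter_upwards [ae_restrict_of_ae (ae_mem_cell_iff_zero (d := d)),
    ae_restrict_mem (measurableSet_cell (d := d))] with x h1 h2 using h1.1 h2

/-- Unfolding an integral over `ℝ^d` into cells. -/
lemma lintegral_eq_tsum_cell {H : Space d → ℝ≥0∞} (hH : Measurable H) :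
    ∫⁻ x, H x = ∑' k : Fin d → ℤ, ∫⁻ x in cell d, H (x + latt k) := by
  have h1 : ∀ k : Fin d → ℤ, ∫⁻ x in cell d, H (x + latt k) =
      ∫⁻ x, {x | x - latt k ∈ cell d}.indicator H x := by
    intro k
    rw [← lintegral_indicator measurableSet_cell,
      ← lintegral_add_right_eq_self ({x | x - latt k ∈ cell d}.indicator H) (latt k)]
    refine lintegral_congr fun x => ?_
    by_cases h : x ∈ cell d <;> simp [Set.indicator, h]
  have hms : ∀ k : Fin d → ℤ, MeasurableSet {x : Space d | x - latt k ∈ cell d} := fun k =>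
    (measurable_id.sub_const _) measurableSet_cell
  simp_rw [h1]
  rw [← lintegral_tsum fun k => (hH.indicator (hms k)).aemeasurable]
  refine lintegral_congr_ae ?_
  filter_upwards [ae_mem_cell_iff (d := d)] with x hx
  simp only [Set.indicator, Set.mem_ofPred_eq, hx]
  rw [tsum_eq_single (cellIdx x) fun k hk => if_neg (Ne.symm hk), if_pos rfl]

/-- The integral of a periodic function over a translated cell. -/
lemma lintegral_cell_comp_add {H : Space d → ℝ≥0∞} (hH : Measurable H)
    (hp : ∀ x (k : Fin d → ℤ), H (x + latt k) = H x) (y : Space d) :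
    ∫⁻ x in cell d, H (x + y) = ∫⁻ x in cell d, H x := by
  have hms : ∀ z : Space d, MeasurableSet {x : Space d | x + z ∈ cell d} := fun z =>
    (measurable_id.add_const _) measurableSet_cell
  calc ∫⁻ x in cell d, H (x + y) = ∫⁻ x, {x | x + -y ∈ cell d}.indicator H x := by
        rw [← lintegral_indicator measurableSet_cell,
          ← lintegral_add_right_eq_self ({x | x + -y ∈ cell d}.indicator H) y]
        refine lintegral_congr fun x => ?_
        by_cases h : x ∈ cell d <;> simp [Set.indicator, h]
    -- Periodicity of H moves all pieces of the translated cell back to Q, where their indicators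
    -- add up to 1 almost everywhere.
    _ = ∑' k : Fin d → ℤ, ∫⁻ x in cell d, {x | x + (latt k - y) ∈ cell d}.indicator H x := by
        rw [lintegral_eq_tsum_cell (hH.indicator (hms _))]
        refine tsum_congr fun k => lintegral_congr fun x => ?_
        have h1 : x + latt k + -y = x + (latt k - y) := by abel
        by_cases h : x + (latt k - y) ∈ cell d <;> simp [Set.indicator, h, h1, hp]
    _ = ∫⁻ x in cell d, ∑' k : Fin d → ℤ, {x | x + (latt k - y) ∈ cell d}.indicator H x :=
        (lintegral_tsum fun k => (hH.indicator (hms _)).aemeasurable).symm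
    _ = _ := by
        refine lintegral_congr_ae (ae_restrict_of_ae ?_)
        have h := (measurePreserving_sub_right (volume : Measure (Space d))
          y).quasiMeasurePreserving.ae (ae_mem_cell_iff (d := d))
        filter_upwards [h] with x hx
        have h1 : ∀ k : Fin d → ℤ, x + (latt k - y) ∈ cell d ↔ -cellIdx (x - y) = k := by
          intro k
          have h2 := hx (-k)
          rw [latt_neg, sub_neg_eq_add] at h2
          rw [show x + (latt k - y) = x - y + latt k by abel, h2, neg_eq_iff_eq_neg]
        simp only [Set.indicator, Set.mem_ofPred_eq, h1]
        rw [tsum_eq_single (-cellIdx (x - y)) fun k hk => if_neg (Ne.symm hk), if_pos rfl]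

end Lattice

/-! ### The suspension flow -/

section Suspension

variable {d : ℕ} {Ω : Type*}

/-- The measure `1_Q dx ⊗ P`. -/
noncomputable abbrev cellMeasure (d : ℕ) [MeasurableSpace Ω] (P : Measure Ω) : Measure (Space d × Ω) :=
  (volume.restrict (cell d)).prod P

variable [AddAction (Fin d → ℤ) Ω]

/-- The suspension of the action of `ℤ^d` on `Ω`. -/
noncomputable def susp (y : Space d) (p : Space d × Ω) : Space d × Ω :=
  (p.1 + y - latt (cellIdx (p.1 + y)), cellIdx (p.1 + y) +ᵥ p.2)

lemma susp_eq (y x : Space d) (ω : Ω) : susp y (x, ω) = susp (x + y) (0, ω) := by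
  simp only [susp, zero_add]

/-- The identity that makes x ↦ f(susp x (0, ω)) stationary at every point, for any function f. -/
lemma susp_add_latt (x : Space d) (k : Fin d → ℤ) (ω : Ω) :
    susp (x + latt k) (0, ω) = susp x (0, k +ᵥ ω) := by
  simp only [susp, zero_add, cellIdx_add_latt, latt_add]
  rw [add_vadd]
  congr 1
  abel

lemma susp_add (y z : Space d) (p : Space d × Ω) : susp y (susp z p) = susp (y + z) p := by
  have h : p.1 + z - latt (cellIdx (p.1 + z)) + y = p.1 + (y + z) - latt (cellIdx (p.1 + z)) := by
    abel
  simp only [susp, h, cellIdx_sub_latt, latt_sub]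
  refine Prod.ext ?_ ?_
  · simp
  · simp only
    rw [← add_vadd, sub_add_cancel]

lemma susp_zero_of_cellIdx {x : Space d} (hx : cellIdx x = 0) (ω : Ω) :
    susp 0 (x, ω) = (x, ω) := by
  simp [susp, hx]

variable [MeasurableSpace Ω] [MeasurableConstVAdd (Fin d → ℤ) Ω]

lemma measurable_susp : Measurable fun p : (Space d × Ω) × Space d => susp p.2 p.1 := by
  have h1 : Measurable fun p : (Space d × Ω) × Space d => p.1.1 + p.2 := by fun_prop
  have h2 : Measurable fun p : (Space d × Ω) × Space d => cellIdx (p.1.1 + p.2) :=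
    measurable_cellIdx.comp h1
  have h3 : Measurable fun q : (Fin d → ℤ) × Ω => q.1 +ᵥ q.2 :=
    measurable_from_prod_countable_right fun k => measurable_const_vadd k
  exact (h1.sub (measurable_latt.comp h2)).prodMk (h3.comp (h2.prodMk (by fun_prop)))

lemma measurable_susp_zero : Measurable fun p : Space d × Ω => susp p.1 (0, p.2) :=
  measurable_susp.comp (f := fun p : Space d × Ω => (((0 : Space d), p.2), p.1)) (by fun_prop)

variable (P : Measure Ω) [VAddInvariantMeasure (Fin d → ℤ) Ω P]

lemma lintegral_susp_right {g : Space d × Ω → ℝ≥0∞} (hg : Measurable g) (x y : Space d) :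
    ∫⁻ ω, g (susp y (x, ω)) ∂P = ∫⁻ ω, g (x + y - latt (cellIdx (x + y)), ω) ∂P := by
  simp only [susp]
  exact (measurePreserving_vadd (cellIdx (x + y)) P).lintegral_comp
    (hg.comp measurable_prodMk_left)

variable [SFinite P]

/-- Invariance: integrating over ω first removes the group element, since P is invariant. What
remains is the integral over Q of a periodic function shifted by y. The identity at time 0 fails on
faces of Q, because the cell is closed and `cellIdx` uses half-open cells. -/
lemma isFlow_susp : IsFlow (susp : Space d → Space d × Ω → Space d × Ω) (cellMeasure d P) where
  measurable := measurable_susp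
  add := susp_add
  mp y := by
    have hm : Measurable (susp y : Space d × Ω → Space d × Ω) :=
      measurable_susp.comp measurable_prodMk_right
    refine ⟨hm, Measure.ext_of_lintegral _ fun g hg => ?_⟩
    have hgm : Measurable fun p => g (susp y p) := hg.comp hm
    rw [lintegral_map hg hm, lintegral_prod _ hgm.aemeasurable,
      lintegral_prod _ hg.aemeasurable]
    simp_rw [lintegral_susp_right P hg]
    have hh : Measurable fun x : Space d => ∫⁻ ω, g (x, ω) ∂P := hg.lintegral_prod_right'
    have hf : Measurable fun x : Space d => x - latt (cellIdx x) :=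
      measurable_id.sub (measurable_latt.comp measurable_cellIdx)
    rw [lintegral_cell_comp_add (H := fun x => ∫⁻ ω, g (x - latt (cellIdx x), ω) ∂P)
      (hh.comp hf) fun x k => by
        rw [cellIdx_add_latt, latt_add, add_sub_add_right_eq_sub]]
    refine lintegral_congr_ae ?_
    filter_upwards [ae_restrict_cellIdx (d := d)] with x hx
    rw [hx, latt_zero, sub_zero]
  zero := by
    have := (Measure.quasiMeasurePreserving_fst (μ := volume.restrict (cell d)) (ν := P)).ae
      (ae_restrict_cellIdx (d := d))
    filter_upwards [this] with p hp using susp_zero_of_cellIdx hp p.2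

/-- The projection `(x, ω) ↦ (x - [x], τ_[x] ω)` onto the cell. -/
lemma quasiMeasurePreserving_susp_zero :
    Measure.QuasiMeasurePreserving (fun p : Space d × Ω => susp p.1 (0, p.2))
      ((volume : Measure (Space d)).prod P) (cellMeasure d P) := by
  refine ⟨measurable_susp_zero, Measure.AbsolutelyContinuous.mk fun s hs h => ?_⟩
  have hg : Measurable (s.indicator (1 : Space d × Ω → ℝ≥0∞)) := measurable_one.indicator hs
  have hgm : Measurable fun p : Space d × Ω =>
      s.indicator (1 : Space d × Ω → ℝ≥0∞) (susp p.1 (0, p.2)) := hg.comp measurable_susp_zero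
  rw [← lintegral_indicator_one hs, lintegral_map hg measurable_susp_zero,
    lintegral_prod _ hgm.aemeasurable]
  simp_rw [lintegral_susp_right P hg, zero_add]
  have hh : Measurable fun x : Space d => ∫⁻ ω, s.indicator (1 : Space d × Ω → ℝ≥0∞) (x, ω) ∂P :=
    hg.lintegral_prod_right'
  have hf : Measurable fun x : Space d => x - latt (cellIdx x) :=
    measurable_id.sub (measurable_latt.comp measurable_cellIdx)
  have hH : Measurable fun x : Space d =>
      ∫⁻ ω, s.indicator (1 : Space d × Ω → ℝ≥0∞) (x - latt (cellIdx x), ω) ∂P := hh.comp hf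
  rw [lintegral_eq_tsum_cell hH, ENNReal.tsum_eq_zero]
  intro k
  have h0 : ∫⁻ x in cell d, ∫⁻ ω, s.indicator (1 : Space d × Ω → ℝ≥0∞) (x, ω) ∂P = 0 := by
    rw [← lintegral_prod _ hg.aemeasurable, lintegral_indicator_one hs]
    exact h
  rw [← h0]
  refine lintegral_congr_ae ?_
  filter_upwards [ae_restrict_cellIdx (d := d)] with x hx
  simp only [cellIdx_add_latt, latt_add, hx, latt_zero]
  congr 1
  funext ω
  congr 2
  abel

end Suspension

/-! ### Stationary fields as functions on the suspension -/

section Stationary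

variable {d : ℕ} {Ω : Type*} [MeasurableSpace Ω] {P : Measure Ω}

lemma ae_cellMeasure_ae_add [SFinite P] {q : Space d × Ω → Prop}
    (h : ∀ᵐ p ∂(volume : Measure (Space d)).prod P, q p) :
    ∀ᵐ p ∂cellMeasure d P, ∀ᵐ y, q (p.1 + y, p.2) := by
  have h1 : ∀ᵐ p ∂P.prod (volume : Measure (Space d)), q p.swap :=
    Measure.measurePreserving_swap.quasiMeasurePreserving.ae h
  have h2 : ∀ᵐ ω ∂P, ∀ᵐ x : Space d, q (x, ω) := Measure.ae_ae_of_ae_prod h1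
  have h3 := (Measure.quasiMeasurePreserving_snd (μ := volume.restrict (cell d)) (ν := P)).ae h2
  filter_upwards [h3] with p hp
  exact (measurePreserving_add_left volume p.1).quasiMeasurePreserving.ae hp

lemma ae_exists_of_ae_cellMeasure [SFinite P] {r : Space d × Ω → Prop} (h : ∀ᵐ p ∂cellMeasure d P, r p) :
    ∀ᵐ ω ∂P, ∃ x, r (x, ω) := by
  have h1 : ∀ᵐ p ∂P.prod (volume.restrict (cell d)), r p.swap :=
    Measure.measurePreserving_swap.quasiMeasurePreserving.ae h
  filter_upwards [Measure.ae_ae_of_ae_prod h1] with ω hω using hω.exists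

variable [AddAction (Fin d → ℤ) Ω]

/-- The countably many stationarity relations hold simultaneously, so the lattice vector may depend
on x; it is taken to be the index of the cell of x. A stationary field is thereby recovered from its
values on Q × Ω. -/
lemma IsStationary.ae_prod [SFinite P] {β : Type*} {F : Space d → Ω → β} (hF : IsStationary P F) :
    ∀ᵐ p ∂(volume : Measure (Space d)).prod P,
      F p.1 p.2 = Function.uncurry F (susp p.1 (0, p.2)) := by
  have h : ∀ᵐ p ∂(volume : Measure (Space d)).prod P, ∀ k : Fin d → ℤ,
      F (p.1 - latt k + latt k) p.2 = F (p.1 - latt k) (k +ᵥ p.2) := by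
    rw [ae_all_iff]
    intro k
    exact ((measurePreserving_sub_right volume (latt k)).prod
      (MeasurePreserving.id P)).quasiMeasurePreserving.ae (hF k)
  filter_upwards [h] with p hp
  have h1 := hp (cellIdx p.1)
  rw [sub_add_cancel] at h1
  simpa only [susp, zero_add, Function.uncurry] using h1

lemma IsStationary.ae_ae [SFinite P] {β : Type*} {F : Space d → Ω → β} (hF : IsStationary P F) :
    ∀ᵐ p ∂cellMeasure d P, ∀ᵐ y, F (p.1 + y) p.2 = Function.uncurry F (susp y p) := by
  filter_upwards [ae_cellMeasure_ae_add hF.ae_prod] with p hp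
  filter_upwards [hp] with y hy
  rw [hy, ← susp_eq]

/-- A translation invariant property holds for almost all realisations of a stationary field iff
it holds along almost all orbits of the suspension flow. -/
lemma IsStationary.ae_iff [SFinite P] {β : Type*} {F : Space d → Ω → β} (hF : IsStationary P F)
    {R : (Space d → β) → Prop} (hc : ∀ f g, f =ᵐ[volume] g → R f → R g)
    (ht : ∀ f a, R f → R fun x => f (x + a)) :
    (∀ᵐ p ∂cellMeasure d P, R fun y => Function.uncurry F (susp y p)) ↔
      ∀ᵐ ω ∂P, R fun x => F x ω := by
  constructor
  · intro h
    have h1 : ∀ᵐ p ∂cellMeasure d P, R fun y => F (p.1 + y) p.2 := by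
      filter_upwards [h, hF.ae_ae] with p hp h2
      exact hc _ _ (h2.mono fun y hy => hy.symm) hp
    filter_upwards [ae_exists_of_ae_cellMeasure h1] with ω ⟨x, hx⟩
    have := ht _ (-x) hx
    simpa only [add_neg_cancel_comm_assoc, add_comm _ (-x), add_neg_cancel_left] using this
  · intro h
    have h3 := (Measure.quasiMeasurePreserving_snd (μ := volume.restrict (cell d)) (ν := P)).ae h
    filter_upwards [h3, hF.ae_ae] with p hp h2
    refine hc _ _ h2 ?_
    simpa only [add_comm] using ht _ p.1 hp

lemma IsStationary.comp {β γ : Type*} {F : Space d → Ω → β} (hF : IsStationary P F) (φ : β → γ) :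
    IsStationary P fun x ω => φ (F x ω) := fun k => by
  filter_upwards [hF k] with p hp using by rw [hp]

lemma IsStationary.comp₂ {β γ δ : Type*} {F : Space d → Ω → β} {G : Space d → Ω → γ}
    (hF : IsStationary P F) (hG : IsStationary P G) (φ : β → γ → δ) :
    IsStationary P fun x ω => φ (F x ω) (G x ω) := fun k => by
  filter_upwards [hF k, hG k] with p hp hq using by rw [hp, hq]

lemma IsPeriodic.isStationary {β : Type*} {f : Space d → β} (hf : IsPeriodic f) :
    IsStationary P fun x _ => f x := fun k =>
  (Measure.quasiMeasurePreserving_fst (μ := volume) (ν := P)).ae (hf k)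

lemma isStationary_susp {β : Type*} (f : Space d × Ω → β) :
    IsStationary P fun x ω => f (susp x (0, ω)) := fun k =>
  Eventually.of_forall fun p => by simp only [susp_add_latt]

lemma ae_susp_zero : ∀ᵐ p ∂cellMeasure d P, susp p.1 (0, p.2) = p := by
  have := (Measure.quasiMeasurePreserving_fst (μ := volume.restrict (cell d)) (ν := P)).ae
    (ae_restrict_cellIdx (d := d))
  filter_upwards [this] with p hp
  have h := susp_zero_of_cellIdx hp p.2
  rwa [susp_eq, add_zero] at h

lemma ae_cellField_eq (X : Ω → ℝ) :
    ∀ᵐ x : Space d, ∀ ω, cellField X x ω = X (cellIdx x +ᵥ ω) := by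
  filter_upwards [ae_mem_cell_iff (d := d)] with x hx ω
  rw [cellField, tsum_eq_single (cellIdx x)]
  · exact Set.indicator_of_mem (s := {y | y - latt (cellIdx x) ∈ cell d}) ((hx _).2 rfl) _
  · intro k hk
    exact Set.indicator_of_notMem (s := {y | y - latt k ∈ cell d}) (fun h => hk ((hx _).1 h).symm) _

lemma ae_cellField_cell (X : Ω → ℝ) :
    ∀ᵐ x ∂volume.restrict (cell d), ∀ ω, cellField X x ω = X ω := by
  filter_upwards [ae_restrict_of_ae (ae_cellField_eq (d := d) X), ae_restrict_cellIdx (d := d)]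
    with x h1 h2 ω
  rw [h1, h2, zero_vadd]

lemma uncurry_cellField_ae (X : Ω → ℝ) :
    ∀ᵐ p ∂cellMeasure d P, Function.uncurry (cellField (d := d) X) p = X p.2 := by
  have := (Measure.quasiMeasurePreserving_fst (μ := volume.restrict (cell d)) (ν := P)).ae
    (ae_cellField_cell (d := d) X)
  filter_upwards [this] with p hp using hp p.2

lemma isStationary_cellField (X : Ω → ℝ) : IsStationary P (cellField (d := d) X) := fun k => by
  have h1 := (Measure.quasiMeasurePreserving_fst (μ := (volume : Measure (Space d))) (ν := P)).ae
    (ae_cellField_eq (d := d) X)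
  have h2 := (Measure.quasiMeasurePreserving_fst (μ := (volume : Measure (Space d))) (ν := P)).ae
    ((measurePreserving_add_right volume (latt k)).quasiMeasurePreserving.ae
      (ae_cellField_eq (d := d) X))
  filter_upwards [h1, h2] with p h1 h2
  rw [h1, h2, cellIdx_add_latt, add_vadd]

end Stationary

/-! ### Square integrable stationary fields -/

section L2Field

variable {d : ℕ} {Ω : Type*} [MeasurableSpace Ω] [AddAction (Fin d → ℤ) Ω]

/-- Stationary fields in `L²(Q × Ω)`. -/
structure IsL2Field (P : Measure Ω) {E : Type*} [NormedAddCommGroup E] (G : Space d → Ω → E) :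
    Prop where
  memLp : MemLp (Function.uncurry G) 2 (cellMeasure d P)
  stationary : IsStationary P G

/-- The stationary potential fields in `L²(Q × Ω)`. -/
noncomputable abbrev stationaryPotentials (d : ℕ) [AddAction (Fin d → ℤ) Ω] (P : Measure Ω) :
    Submodule ℝ (Lp (Space d) 2 (cellMeasure d P)) :=
  potentialFields susp (cellMeasure d P)

variable {P : Measure Ω} {E : Type*} [NormedAddCommGroup E]

lemma IsL2Field.add {F G : Space d → Ω → E} (hF : IsL2Field P F) (hG : IsL2Field P G) :
    IsL2Field P fun x ω => F x ω + G x ω :=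
  ⟨hF.memLp.add hG.memLp, hF.stationary.comp₂ hG.stationary _⟩

lemma IsL2Field.sub {F G : Space d → Ω → E} (hF : IsL2Field P F) (hG : IsL2Field P G) :
    IsL2Field P fun x ω => F x ω - G x ω :=
  ⟨hF.memLp.sub hG.memLp, hF.stationary.comp₂ hG.stationary _⟩

lemma IsL2Field.app {a : Space d → Ω → Matrix (Fin d) (Fin d) ℝ} {β : ℝ} (ha : IsStationary P a)
    (hb : IsBoundedField (cellMeasure d P) (Function.uncurry a) β) {F : Space d → Ω → Space d}
    (hF : IsL2Field P F) : IsL2Field P fun x ω => app (a x ω) (F x ω) :=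
  ⟨hb.memLp hF.memLp, ha.comp₂ hF.stationary _⟩

lemma isL2Field_const [IsFiniteMeasure P] (c : E) :
    IsL2Field P fun (_ : Space d) (_ : Ω) => c :=
  ⟨memLp_const c, fun _ => Eventually.of_forall fun _ => rfl⟩

lemma isL2Field_of_periodic [IsFiniteMeasure P] {f : Space d → E} (hf : LocallyL2 f)
    (hp : IsPeriodic f) : IsL2Field P fun x (_ : Ω) => f x :=
  ⟨(hf _ isCompact_cell).comp_fst P, hp.isStationary⟩

/-- Every class in L²(Q × Ω) extends to a stationary field on ℝ^d × Ω. Hence the Hilbert-space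
solutions are genuine fields. -/
lemma isL2Field_susp [IsFiniteMeasure P] (f : Lp E 2 (cellMeasure d P)) :
    IsL2Field P fun x ω => f (susp x (0, ω)) := by
  refine ⟨(memLp_congr_ae ?_).1 (Lp.memLp f), isStationary_susp f⟩
  filter_upwards [ae_susp_zero (P := P)] with p hp
  simp only [Function.uncurry, hp]

lemma toLp_susp [IsFiniteMeasure P] (f : Lp E 2 (cellMeasure d P)) :
    (isL2Field_susp f).memLp.toLp _ = f := by
  refine Lp.ext ?_
  filter_upwards [MemLp.coeFn_toLp (isL2Field_susp f).memLp, ae_susp_zero (P := P)] with p h1 hp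
  simp only [h1, Function.uncurry, hp]

variable [MeasurableConstVAdd (Fin d → ℤ) Ω]

lemma IsL2Field.aestronglyMeasurable [SFinite P] [VAddInvariantMeasure (Fin d → ℤ) Ω P]
    {F : Space d → Ω → E} (hF : IsL2Field P F) :
    AEStronglyMeasurable (Function.uncurry F) ((volume : Measure (Space d)).prod P) :=
  (hF.memLp.1.comp_quasiMeasurePreserving (quasiMeasurePreserving_susp_zero P)).congr
    (hF.stationary.ae_prod.mono fun _ hp => hp.symm)

lemma IsL2Field.ae_locallyL2 [SFinite P] [VAddInvariantMeasure (Fin d → ℤ) Ω P]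
    {F : Space d → Ω → E} (hF : IsL2Field P F) : ∀ᵐ ω ∂P, LocallyL2 fun x => F x ω :=
  (hF.stationary.ae_iff (fun _ _ h hf => hf.congr h) fun _ a hf => hf.comp_add a).1
    ((isFlow_susp P).ae_locallyL2 hF.memLp)

/-- Dictionary between orbits of the suspension and realisations, for properties insensitive to null
sets and to translations; applied to divergence-freeness, curl-freeness, being a gradient and being
constant. -/
lemma IsL2Field.ae_toLp_iff [SFinite P] [VAddInvariantMeasure (Fin d → ℤ) Ω P]
    {F : Space d → Ω → E} (hF : IsL2Field P F) {R : (Space d → E) → Prop}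
    (hc : ∀ f g, f =ᵐ[volume] g → R f → R g) (ht : ∀ f a, R f → R fun x => f (x + a)) :
    (∀ᵐ p ∂cellMeasure d P, R fun y => hF.memLp.toLp _ (susp y p)) ↔
      ∀ᵐ ω ∂P, R fun x => F x ω := by
  rw [← hF.stationary.ae_iff hc ht]
  refine eventually_congr ?_
  filter_upwards [(isFlow_susp P).ae_ae (MemLp.coeFn_toLp hF.memLp)] with p hp
  exact ⟨hc _ _ hp, hc _ _ (EventuallyEq.symm hp)⟩

variable [IsProbabilityMeasure P] [VAddInvariantMeasure (Fin d → ℤ) Ω P]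

theorem IsL2Field.mem_orthogonal_iff {F : Space d → Ω → Space d} (hF : IsL2Field P F) :
    hF.memLp.toLp _ ∈ (stationaryPotentials d P)ᗮ ↔ ∀ᵐ ω ∂P, DivFree fun x => F x ω := by
  rw [(isFlow_susp P).mem_orthogonal_potentialFields]
  exact hF.ae_toLp_iff (fun _ _ h hf => hf.congr h) fun _ a hf => hf.comp_add a

lemma divFree_const (c : Space d) : DivFree fun _ => c := fun φ hφ => by
  have h := integral_smul_gradient (u := fun _ : Space d => (1 : ℝ)) contDiff_const hφ
  have h0 : gradient (fun _ : Space d => (1 : ℝ)) = fun _ => 0 := by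
    funext x
    simp [gradient]
  simp only [one_smul, h0, smul_zero, integral_zero, neg_zero] at h
  have hi : Integrable (gradient φ) :=
    hφ.continuous_gradient.integrable_of_hasCompactSupport hφ.hasCompactSupport_gradient
  rw [integral_inner hi, h, inner_zero_right]

/-- Constant fields are divergence-free, hence orthogonal to the potentials. -/
lemma integral_eq_zero_of_mem {f : Lp (Space d) 2 (cellMeasure d P)}
    (hf : f ∈ stationaryPotentials d P) : ∫ p, f p ∂cellMeasure d P = 0 := by
  have hi : Integrable f (cellMeasure d P) := (Lp.memLp f).integrable (by norm_num)
  refine ext_inner_left ℝ fun c => ?_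
  have hc := isL2Field_const (d := d) (P := P) c
  have h := hc.mem_orthogonal_iff.2 (Eventually.of_forall fun _ => divFree_const c)
  have h2 := Submodule.inner_left_of_mem_orthogonal hf h
  rw [L2.inner_def] at h2
  rw [inner_zero_right, ← integral_inner hi, ← h2]
  refine integral_congr_ae ?_
  filter_upwards [MemLp.coeFn_toLp hc.memLp] with p hp
  rw [hp]
  rfl

lemma IsL2Field.integral_eq {F : Space d → Ω → Space d} (hF : IsL2Field P F) :
    ∫ ω, (∫ x in cell d, F x ω) ∂P = ∫ p, hF.memLp.toLp _ p ∂cellMeasure d P := by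
  have hi : Integrable (Function.uncurry F) (cellMeasure d P) := hF.memLp.integrable (by norm_num)
  rw [integral_congr_ae (MemLp.coeFn_toLp hF.memLp), cellMeasure, integral_prod_symm _ hi]
  rfl

lemma IsStationaryGradient.isL2Field {u : Space d → Ω → ℝ} {Du : Space d → Ω → Space d}
    (h : IsStationaryGradient P u Du) : IsL2Field P Du := ⟨h.memLp, h.stationary⟩

/-- The potential is chosen separately for each ω, without any measurability in ω; only its gradient
has to be jointly measurable. -/
theorem exists_isStationaryGradient {F : Space d → Ω → Space d} (hF : IsL2Field P F)
    (hV : hF.memLp.toLp _ ∈ stationaryPotentials d P) :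
    ∃ u : Space d → Ω → ℝ, IsStationaryGradient P u F := by
  have h := (hF.ae_toLp_iff (R := fun g => ∃ u, IsWeakGradient u g)
    (fun _ _ h ⟨u, hu⟩ => ⟨u, hu.congr h⟩)
    (fun _ a ⟨u, hu⟩ => ⟨_, hu.comp_add a⟩)).1
    (((isFlow_susp P).exists_isWeakGradient hV).mono fun _ ⟨u, hu, _⟩ => ⟨u, hu⟩)
  classical
  refine ⟨fun x ω => if h : ∃ u, IsWeakGradient u fun x => F x ω then h.choose x else 0,
    hF.aestronglyMeasurable, hF.memLp, ?_, hF.stationary, ?_⟩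
  · filter_upwards [h] with ω hω
    simp only [dif_pos hω]
    exact hω.choose_spec
  · rw [hF.integral_eq, integral_eq_zero_of_mem hV]

/-- Solvability of elliptic equations with stationary coefficients. -/
theorem exists_potential_divFree {a : Space d → Ω → Matrix (Fin d) (Fin d) ℝ} {α β : ℝ}
    (ha : IsStationary P a) (hb : IsBoundedField (cellMeasure d P) (Function.uncurry a) β)
    (hα : 0 < α) (hco : ∀ᵐ p ∂cellMeasure d P, ∀ ξ : Space d,
      α * ‖ξ‖ ^ 2 ≤ inner ℝ (app (Function.uncurry a p) ξ) ξ)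
    {g : Space d → Ω → Space d} (hg : IsL2Field P g) :
    ∃ f ∈ stationaryPotentials d P,
      ∀ᵐ ω ∂P, DivFree fun x => app (a x ω) (f (susp x (0, ω))) + g x ω := by
  obtain ⟨f, hf, h⟩ := exists_mem_forall_inner_add_eq_zero (stationaryPotentials d P) hb.mulOp hα
    (fun f _ => hb.coercive_mulOp hco f) (hg.memLp.toLp _)
  refine ⟨f, hf, ?_⟩
  have hF := (IsL2Field.app ha hb (isL2Field_susp f)).add hg
  rw [← hF.mem_orthogonal_iff]
  convert h
  have h1 : hb.mulOp f = (IsL2Field.app ha hb (isL2Field_susp f)).memLp.toLp _ := by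
    conv_lhs => rw [← toLp_susp f, hb.mulOp_toLp]
    rfl
  rw [h1]
  rfl

end L2Field

/-! ### Ergodicity: stationary gradients of mean zero are potential fields -/

section Ergodic

variable {d : ℕ} {Ω : Type*} [MeasurableSpace Ω] [AddAction (Fin d → ℤ) Ω] {P : Measure Ω}
  [ErgodicVAdd (Fin d → ℤ) Ω P]

/-- By ergodicity each preimage of a Borel set is null or conull, and countably many such sets
separate the points of E. -/
lemma exists_ae_eq_const_of_invariant {E : Type*} [NormedAddCommGroup E]
    [SecondCountableTopology E] [MeasurableSpace E] [BorelSpace E] {C : Ω → E}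
    (hC : AEStronglyMeasurable C P) (h : ∀ k : Fin d → ℤ, ∀ᵐ ω ∂P, C (k +ᵥ ω) = C ω) :
    ∃ c, ∀ᵐ ω ∂P, C ω = c := by
  refine exists_eventuallyEq_const_of_forall_separating MeasurableSet fun U hU => ?_
  have hm : NullMeasurableSet (C ⁻¹' U) P := hC.aemeasurable.nullMeasurable hU
  have := aeconst_of_forall_preimage_vadd_ae_eq (Fin d → ℤ) hm fun k => by
    filter_upwards [h k] with ω hω
    change (C (k +ᵥ ω) ∈ U) = (C ω ∈ U)
    rw [hω]
  rw [eventuallyConst_set] at this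
  exact this

variable [IsProbabilityMeasure P] [MeasurableConstVAdd (Fin d → ℤ) Ω]

/-- A mean-zero stationary gradient is a stationary potential field, if the action is ergodic. -/
theorem IsStationaryGradient.mem {u : Space d → Ω → ℝ} {Du : Space d → Ω → Space d}
    (h : IsStationaryGradient P u Du) : h.isL2Field.memLp.toLp _ ∈ stationaryPotentials d P := by
  have hF := h.isL2Field
  obtain ⟨p, hp, hFp, hpc⟩ := (isFlow_susp P).exists_sub_mem_of_curlFree (F := hF.memLp.toLp _)
    ((hF.ae_toLp_iff (fun _ _ h hf => hf.congr h) fun _ a hf => hf.comp_add a).2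
      (h.isGrad.mono fun ω hω => hω.curlFree))
  set G : Space d → Ω → Space d := fun x ω => p (susp x (0, ω)) with hGdef
  have hG : IsL2Field P G := isL2Field_susp p
  have hGp : hG.memLp.toLp _ = p := toLp_susp p
  have hGc : ∀ᵐ ω ∂P, ∃ c, ∀ᵐ x, G x ω = c := by
    refine (hG.ae_toLp_iff (R := fun g => ∃ c, ∀ᵐ x, g x = c) ?_ ?_).1 (by rwa [hGp])
    · rintro f g hfg ⟨c, hc⟩
      exact ⟨c, by filter_upwards [hfg, hc] with x h1 h2 using h1 ▸ h2⟩
    · rintro f a ⟨c, hc⟩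
      exact ⟨c, (measurePreserving_add_right volume a).quasiMeasurePreserving.ae hc⟩
  -- The constant of each realisation is only known to exist; the cell average selects it
  -- measurably.
  set C : Ω → Space d := fun ω => ⨍ x in cell d, G x ω with hC
  have hCc : ∀ ω c, (∀ᵐ x, G x ω = c) → C ω = c := by
    intro ω c hc
    have h1 : C ω = ⨍ _ in cell d, c := average_congr (ae_restrict_of_ae hc)
    rw [h1, setAverage_const volume_cell_ne_zero isCompact_cell.measure_lt_top.ne]
  have hCm : AEStronglyMeasurable C P := by
    have h1 : AEStronglyMeasurable (fun ω => ∫ x in cell d, G x ω) P :=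
      AEStronglyMeasurable.integral_prod_right' (μ := P) (ν := volume.restrict (cell d))
        (f := fun q => G q.2 q.1) hG.memLp.1.prod_swap
    simp only [hC, setAverage_eq]
    exact AEStronglyMeasurable.const_smul h1 (volume.real (cell d))⁻¹
  -- Passing from ω to τ_k ω translates the realisation by k and so leaves its constant unchanged.
  obtain ⟨c, hc⟩ := exists_ae_eq_const_of_invariant (d := d) hCm fun k => by
    filter_upwards [hGc] with ω ⟨c, hc⟩
    rw [hCc ω c hc]
    refine hCc _ c ?_
    have := (measurePreserving_add_right volume (latt k)).quasiMeasurePreserving.ae hc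
    filter_upwards [this] with x hx
    rw [← hx, hGdef]
    simp only [susp_add_latt]
  have hGc' : ∀ᵐ ω ∂P, ∀ᵐ x, G x ω = c := by
    filter_upwards [hGc, hc] with ω ⟨c', hc'⟩ h2
    rw [← h2, hCc ω c' hc']
    exact hc'
  have hpc' : ∀ᵐ q ∂cellMeasure d P, p q = c := by
    have hms : MeasurableSet {q : Ω × Space d | G q.2 q.1 = c} :=
      ((Lp.stronglyMeasurable p).measurable.comp (measurable_susp_zero.comp measurable_swap))
        (measurableSet_singleton c)
    have h1 : ∀ᵐ q ∂P.prod (volume.restrict (cell d)), G q.2 q.1 = c :=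
      (Measure.ae_prod_iff_ae_ae hms).2 (hGc'.mono fun ω hω => ae_restrict_of_ae hω)
    have h2 : ∀ᵐ q ∂cellMeasure d P, G q.1 q.2 = c :=
      Measure.measurePreserving_swap.quasiMeasurePreserving.ae h1
    filter_upwards [h2, ae_susp_zero (P := P)] with q h3 h4
    simp only [hGdef, h4] at h3
    exact h3
  -- As F − p is a potential and p equals the constant c, ‖p‖² = ⟨F, p⟩ is the scalar product of c
  -- with the mean of F, which vanishes.
  have h0 : inner ℝ p p = 0 := by
    have h1 : inner ℝ (hF.memLp.toLp _ - p) p = 0 :=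
      Submodule.inner_right_of_mem_orthogonal hFp hp
    rw [inner_sub_left, sub_eq_zero] at h1
    rw [← h1, L2.inner_def]
    have h2 : ∫ q, inner ℝ (hF.memLp.toLp _ q) (p q) ∂cellMeasure d P =
        ∫ q, inner ℝ (hF.memLp.toLp _ q) c ∂cellMeasure d P := by
      refine integral_congr_ae ?_
      filter_upwards [hpc'] with q hq
      rw [hq]
    have hi : Integrable (hF.memLp.toLp _) (cellMeasure d P) :=
      (Lp.memLp _).integrable (by norm_num)
    rw [h2]
    simp_rw [real_inner_comm c]
    rw [integral_inner hi, ← hF.integral_eq, h.mean_zero, inner_zero_right]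
  rw [inner_self_eq_zero.1 h0, sub_zero] at hFp
  exact hFp

end Ergodic

/-! ### Periodic gradients -/

lemma exists_isTest_integral_eq_one (d : ℕ) : ∃ χ : Space d → ℝ, IsTest χ ∧ ∫ x, χ x = 1 := by
  let f : ContDiffBump (0 : Space d) := ⟨1, 2, one_pos, one_lt_two⟩
  exact ⟨f.normed volume, ⟨f.contDiff_normed, f.hasCompactSupport_normed⟩, f.integral_normed⟩

lemma integral_gradient_eq_zero {d : ℕ} {φ : Space d → ℝ} (hφ : IsTest φ) :
    ∫ x, gradient φ x = 0 := by
  have h := integral_smul_gradient (u := fun _ : Space d => (1 : ℝ)) contDiff_const hφ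
  have h0 : gradient (fun _ : Space d => (1 : ℝ)) = fun _ => 0 := by
    funext x
    simp [gradient]
  simpa only [one_smul, h0, smul_zero, integral_zero, neg_zero] using h

/-- The gradient of a square integrable function has mean zero. -/
theorem IsFlow.integral_eq_zero_of_isWeakGradient {d : ℕ} {X : Type*} [MeasurableSpace X]
    {S : Space d → X → X} {μ : Measure X} [IsFiniteMeasure μ] (hS : IsFlow S μ) {w : X → ℝ}
    {F : X → Space d} (hw : MemLp w 2 μ) (hF : MemLp F 2 μ)
    (h : ∀ᵐ x ∂μ, IsWeakGradient (fun y => w (S y x)) fun y => F (S y x)) :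
    ∫ x, F x ∂μ = 0 := by
  obtain ⟨χ, hχ, hχ1⟩ := exists_isTest_integral_eq_one d
  -- With ∫ χ = 1 and invariance, the mean of F equals the mean of its χ-smoothing. Integration by
  -- parts moves the derivative to χ, and ∫ ∇χ = 0.
  have h1 := hS.integral_corr_swap (ContinuousLinearMap.lsmul ℝ ℝ)
    (ContinuousLinearMap.lsmul ℝ ℝ : ℝ →L[ℝ] Space d →L[ℝ] Space d).flip
    (memLp_const (1 : ℝ)) hF hχ.1.continuous hχ.2
  have h2 := hS.integral_corr_swap (ContinuousLinearMap.lsmul ℝ ℝ)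
    (ContinuousLinearMap.lsmul ℝ ℝ : ℝ →L[ℝ] Space d →L[ℝ] Space d)
    (memLp_const (1 : ℝ)) hw hχ.continuous_gradient hχ.hasCompactSupport_gradient
  simp only [ContinuousLinearMap.flip_apply, ContinuousLinearMap.lsmul_apply, one_smul] at h1 h2
  simp only [integral_smul, hS.integral_comp hF.1, integral_smul_const, hχ1, one_smul] at h1
  simp only [integral_smul_const, hS.integral_comp hw.1, integral_smul,
    integral_gradient_eq_zero hχ, smul_zero] at h2
  rw [← h1, integral_congr_ae (h.mono fun x hx => neg_eq_iff_eq_neg.2 (hx.by_parts χ hχ) |>.symm),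
    integral_neg, h2, neg_zero]

lemma IsWeakGradient.congr_left {d : ℕ} {u v : Space d → ℝ} {F : Space d → Space d}
    (hF : IsWeakGradient u F) (h : u =ᵐ[volume] v) : IsWeakGradient v F where
  fun_loc := hF.fun_loc.congr h
  grad_loc := hF.grad_loc
  by_parts φ hφ := by
    rw [← hF.by_parts φ hφ]
    refine integral_congr_ae ?_
    filter_upwards [h] with x hx
    rw [hx]

lemma IsWeakGradient.unique {d : ℕ} {u : Space d → ℝ} {F G : Space d → Space d}
    (hF : IsWeakGradient u F) (hG : IsWeakGradient u G) : F =ᵐ[volume] G := by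
  refine ae_eq_of_integral_contDiff_smul_eq hF.grad_loc.locallyIntegrable
    hG.grad_loc.locallyIntegrable fun φ hφ hφc => ?_
  have h1 := hF.by_parts φ ⟨hφ, hφc⟩
  rw [hG.by_parts φ ⟨hφ, hφc⟩] at h1
  exact (neg_injective h1).symm

/-- A lattice translate of F is a weak gradient of the same function, and weak gradients are unique
almost everywhere. -/
lemma IsWeakGradient.isPeriodic {d : ℕ} {u : Space d → ℝ} {F : Space d → Space d}
    (hF : IsWeakGradient u F) (hu : IsPeriodic u) : IsPeriodic F := fun k =>
  ((hF.comp_add (latt k)).congr_left (hu k)).unique hF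

lemma IsPeriodic.comp {d : ℕ} {β γ : Type*} {f : Space d → β} (hf : IsPeriodic f) (φ : β → γ) :
    IsPeriodic fun x => φ (f x) := fun k => (hf k).mono fun _ hx => congrArg φ hx

lemma IsPeriodic.comp₂ {d : ℕ} {β γ δ : Type*} {f : Space d → β} {g : Space d → γ}
    (hf : IsPeriodic f) (hg : IsPeriodic g) (φ : β → γ → δ) :
    IsPeriodic fun x => φ (f x) (g x) := fun k => by
  filter_upwards [hf k, hg k] with x h1 h2
  rw [h1, h2]

/-- A periodic gradient is a deterministic stationary gradient. -/
theorem IsWeakGradient.isStationaryGradient {d : ℕ} {Ω : Type*} [MeasurableSpace Ω]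
    [AddAction (Fin d → ℤ) Ω] [MeasurableConstVAdd (Fin d → ℤ) Ω] {P : Measure Ω}
    [IsProbabilityMeasure P] [VAddInvariantMeasure (Fin d → ℤ) Ω P]
    {u : Space d → ℝ} {F : Space d → Space d} (hF : IsWeakGradient u F) (hu : IsPeriodic u) :
    IsStationaryGradient P (fun x _ => u x) fun x _ => F x := by
  have h1 : IsL2Field P fun x (_ : Ω) => F x := isL2Field_of_periodic hF.grad_loc (hF.isPeriodic hu)
  have h2 : IsL2Field P fun x (_ : Ω) => u x := isL2Field_of_periodic hF.fun_loc hu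
  refine ⟨h1.aestronglyMeasurable, h1.memLp, Eventually.of_forall fun _ => hF, h1.stationary, ?_⟩
  rw [h1.integral_eq, integral_congr_ae (MemLp.coeFn_toLp h1.memLp)]
  refine (isFlow_susp P).integral_eq_zero_of_isWeakGradient h2.memLp h1.memLp ?_
  refine ((h2.stationary.comp₂ h1.stationary Prod.mk).ae_iff
    (R := fun g => IsWeakGradient (fun y => (g y).1) fun y => (g y).2) ?_ ?_).2
    (Eventually.of_forall fun _ => hF)
  · intro f g hfg hf
    exact (hf.congr_left (hfg.mono fun x hx => congrArg Prod.fst hx)).congr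
      (hfg.mono fun x hx => congrArg Prod.snd hx)
  · intro f a hf
    exact hf.comp_add a

/-! ### Elliptic coefficients -/

section Coefficients

variable {d : ℕ}

lemma negDivEqDiv_zero {F : Space d → Space d} : NegDivEqDiv F (fun _ => 0) ↔ DivFree F := by
  simp only [NegDivEqDiv, DivFree, inner_zero_left, integral_zero, neg_zero]

lemma norm_app_transpose_le {A : Matrix (Fin d) (Fin d) ℝ} {β : ℝ}
    (h : ∀ ξ : Space d, ‖app A ξ‖ ≤ β * ‖ξ‖) (ξ : Space d) :
    ‖app A.transpose ξ‖ ≤ β * ‖ξ‖ := by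
  by_cases h0 : ‖app A.transpose ξ‖ = 0
  · have h1 := (norm_nonneg _).trans (h ξ)
    rwa [h0]
  · have hpos : 0 < ‖app A.transpose ξ‖ := lt_of_le_of_ne (norm_nonneg _) (Ne.symm h0)
    have h1 : ‖app A.transpose ξ‖ ^ 2 ≤ ‖ξ‖ * (β * ‖app A.transpose ξ‖) := by
      rw [← real_inner_self_eq_norm_sq, inner_app_transpose]
      exact (real_inner_le_norm _ _).trans (mul_le_mul_of_nonneg_left (h _) (norm_nonneg _))
    nlinarith

lemma IsBoundedField.transpose {X : Type*} [MeasurableSpace X] {μ : Measure X}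
    {a : X → Matrix (Fin d) (Fin d) ℝ} {β : ℝ} (ha : IsBoundedField μ a β) :
    IsBoundedField μ (fun x => (a x).transpose) β :=
  ⟨fun i j => ha.meas j i, ha.bound.mono fun _ hx => norm_app_transpose_le hx⟩

lemma IsBoundedField.restrict {X : Type*} [MeasurableSpace X] {μ : Measure X}
    {a : X → Matrix (Fin d) (Fin d) ℝ} {β : ℝ} (ha : IsBoundedField μ a β) (K : Set X) :
    IsBoundedField (μ.restrict K) a β :=
  ⟨fun i j => (ha.meas i j).restrict, ae_restrict_of_ae ha.bound⟩

lemma IsBoundedField.locallyL2 {a : Space d → Matrix (Fin d) (Fin d) ℝ} {β : ℝ}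
    (ha : IsBoundedField volume a β) {F : Space d → Space d} (hF : LocallyL2 F) :
    LocallyL2 fun x => app (a x) (F x) := fun K hK => (ha.restrict K).memLp (hF K hK)

lemma IsBoundedField.comp_fst {Ω : Type*} [MeasurableSpace Ω]
    {a : Space d → Matrix (Fin d) (Fin d) ℝ} {β : ℝ} (ha : IsBoundedField volume a β)
    (P : Measure Ω) : IsBoundedField (cellMeasure d P) (Function.uncurry fun x _ => a x) β :=
  ⟨fun i j => ((ha.restrict (cell d)).meas i j).comp_quasiMeasurePreserving
      Measure.quasiMeasurePreserving_fst,
    Measure.quasiMeasurePreserving_fst.ae (ha.restrict (cell d)).bound⟩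

/-- The uniform ellipticity of `A + s C` for `|s| ≤ M`. -/
def IsElliptic (A C : Matrix (Fin d) (Fin d) ℝ) (M α β : ℝ) : Prop :=
  ∀ s ∈ Set.Icc (-M) M, ∀ ξ : Space d,
    α * ‖ξ‖ ^ 2 ≤ inner ℝ (app (A + s • C) ξ) ξ ∧ ‖app (A + s • C) ξ‖ ≤ β * ‖ξ‖

/-- The exceptional null set is made independent of ξ: a countable dense set of directions is
enough, since both inequalities are closed conditions in ξ. -/
lemma ae_isElliptic {A C : Space d → Matrix (Fin d) (Fin d) ℝ} {M α β : ℝ}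
    (h_coercive : ∀ ξ : Space d, ∀ᵐ x, ∀ s ∈ Set.Icc (-M) M,
      α * ‖ξ‖ ^ 2 ≤ inner ℝ (app (A x + s • C x) ξ) ξ)
    (h_bounded : ∀ ξ : Space d, ∀ᵐ x, ∀ s ∈ Set.Icc (-M) M,
      ‖app (A x + s • C x) ξ‖ ≤ β * ‖ξ‖) : ∀ᵐ x, IsElliptic (A x) (C x) M α β := by
  have h : ∀ᵐ x, ∀ n, (∀ s ∈ Set.Icc (-M) M,
      α * ‖TopologicalSpace.denseSeq (Space d) n‖ ^ 2 ≤
        inner ℝ (app (A x + s • C x) (TopologicalSpace.denseSeq (Space d) n))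
          (TopologicalSpace.denseSeq (Space d) n)) ∧ ∀ s ∈ Set.Icc (-M) M,
      ‖app (A x + s • C x) (TopologicalSpace.denseSeq (Space d) n)‖ ≤
        β * ‖TopologicalSpace.denseSeq (Space d) n‖ :=
    ae_all_iff.2 fun n => (h_coercive _).and (h_bounded _)
  filter_upwards [h] with x hx s hs ξ
  have hc := continuous_app (A x + s • C x)
  refine (TopologicalSpace.denseRange_denseSeq (Space d)).induction_on
    (p := fun ξ => α * ‖ξ‖ ^ 2 ≤ inner ℝ (app (A x + s • C x) ξ) ξ ∧
      ‖app (A x + s • C x) ξ‖ ≤ β * ‖ξ‖) ξ ?_ fun n => ⟨(hx n).1 s hs, (hx n).2 s hs⟩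
  exact (isClosed_le (by fun_prop) (hc.inner continuous_id)).and
    (isClosed_le hc.norm (by fun_prop))

/-- The bounds at s = M and s = −M are subtracted, which isolates 2M C. -/
lemma IsElliptic.norm_app_le {A C : Matrix (Fin d) (Fin d) ℝ} {M α β : ℝ}
    (h : IsElliptic A C M α β) (hM : 0 < M) (ξ : Space d) : ‖app C ξ‖ ≤ β / M * ‖ξ‖ := by
  have h1 := (h M ⟨by linarith, le_rfl⟩ ξ).2
  have h2 := (h (-M) ⟨le_rfl, by linarith⟩ ξ).2
  have h3 : (2 * M) • app C ξ = app (A + M • C) ξ - app (A + (-M) • C) ξ := by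
    simp only [add_app, smul_app]
    module
  have h4 : 2 * M * ‖app C ξ‖ ≤ 2 * (β * ‖ξ‖) := by
    rw [← abs_of_pos (show 0 < 2 * M by linarith), ← Real.norm_eq_abs, ← norm_smul, h3]
    exact (norm_sub_le _ _).trans (by linarith)
  rw [div_mul_eq_mul_div, le_div_iff₀ hM]
  linarith

/-- The hypotheses on the deterministic coefficients. -/
structure IsCoefficientPair (A C : Space d → Matrix (Fin d) (Fin d) ℝ) (M α β : ℝ) : Prop where
  meas_left : ∀ i j, AEMeasurable fun x => A x i j
  meas_right : ∀ i j, AEMeasurable fun x => C x i j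
  per_left : IsPeriodic A
  per_right : IsPeriodic C
  pos : 0 < M
  coer_pos : 0 < α
  elliptic : ∀ᵐ x, IsElliptic (A x) (C x) M α β

namespace IsCoefficientPair

variable {A C : Space d → Matrix (Fin d) (Fin d) ℝ} {M α β : ℝ}

lemma left (h : IsCoefficientPair A C M α β) : IsBoundedField volume A β :=
  ⟨h.meas_left, h.elliptic.mono fun x hx ξ => by
    simpa using (hx 0 ⟨by linarith [h.pos], h.pos.le⟩ ξ).2⟩

lemma right (h : IsCoefficientPair A C M α β) : IsBoundedField volume C (β / M) :=
  ⟨h.meas_right, h.elliptic.mono fun _ hx => hx.norm_app_le h.pos⟩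

lemma coercive (h : IsCoefficientPair A C M α β) :
    ∀ᵐ x, ∀ ξ : Space d, α * ‖ξ‖ ^ 2 ≤ inner ℝ (app (A x) ξ) ξ :=
  h.elliptic.mono fun x hx ξ => by
    simpa using (hx 0 ⟨by linarith [h.pos], h.pos.le⟩ ξ).1

lemma coercive_transpose (h : IsCoefficientPair A C M α β) :
    ∀ᵐ x, ∀ ξ : Space d, α * ‖ξ‖ ^ 2 ≤ inner ℝ (app (A x).transpose ξ) ξ :=
  h.coercive.mono fun x hx ξ => by
    rw [inner_app_transpose, real_inner_comm]
    exact hx ξ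

variable {Ω : Type*} [MeasurableSpace Ω] [AddAction (Fin d → ℤ) Ω] {P : Measure Ω}
  [IsProbabilityMeasure P] {B : Ω → ℝ}

lemma isStationary_perturbed (h : IsCoefficientPair A C M α β) (B : Ω → ℝ) :
    IsStationary P (perturbed A C (cellField B)) := by
  have h1 := (h.per_left.isStationary (P := P)).comp₂ (h.per_right.isStationary (P := P)) Prod.mk
  exact h1.comp₂ (isStationary_cellField B) fun a b => a.1 + b • a.2

lemma ae_elliptic_perturbed (h : IsCoefficientPair A C M α β) (hB : ∀ᵐ ω ∂P, |B ω| ≤ M) :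
    ∀ᵐ p ∂cellMeasure d P, ∀ ξ : Space d,
      α * ‖ξ‖ ^ 2 ≤ inner ℝ (app (Function.uncurry (perturbed A C (cellField B)) p) ξ) ξ ∧
        ‖app (Function.uncurry (perturbed A C (cellField B)) p) ξ‖ ≤ β * ‖ξ‖ := by
  have h1 := (Measure.quasiMeasurePreserving_fst (μ := volume.restrict (cell d)) (ν := P)).ae
    (ae_restrict_of_ae h.elliptic)
  have h2 := (Measure.quasiMeasurePreserving_snd (μ := volume.restrict (cell d)) (ν := P)).ae hB
  filter_upwards [h1, h2, uncurry_cellField_ae (P := P) B] with p h1 h2 h3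
  have h4 : Function.uncurry (perturbed A C (cellField B)) p = A p.1 + B p.2 • C p.1 := by
    rw [← h3]
    rfl
  rw [h4]
  exact h1 _ (abs_le.1 h2)

lemma isBoundedField_perturbed (h : IsCoefficientPair A C M α β)
    (hBm : AEStronglyMeasurable B P) (hB : ∀ᵐ ω ∂P, |B ω| ≤ M) :
    IsBoundedField (cellMeasure d P) (Function.uncurry (perturbed A C (cellField B))) β := by
  refine ⟨fun i j => ?_, (h.ae_elliptic_perturbed hB).mono fun p hp ξ => (hp ξ).2⟩
  have hA := ((h.left.restrict (cell d)).meas i j).comp_quasiMeasurePreserving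
    (Measure.quasiMeasurePreserving_fst (ν := P))
  have hC := ((h.right.restrict (cell d)).meas i j).comp_quasiMeasurePreserving
    (Measure.quasiMeasurePreserving_fst (ν := P))
  have hb : AEMeasurable (fun p : Space d × Ω => B p.2) (cellMeasure d P) :=
    hBm.aemeasurable.comp_quasiMeasurePreserving Measure.quasiMeasurePreserving_snd
  refine (hA.add (hb.mul hC)).congr ?_
  filter_upwards [uncurry_cellField_ae (P := P) B] with p h3
  rw [Pi.add_apply, Pi.mul_apply, ← h3]
  rfl

end IsCoefficientPair

end Coefficients

/-! ### Solvability of the periodic problems -/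

/-- Periodic fields are stationary fields over a one-point probability space, so the stochastic
solvability result applies. -/
theorem exists_periodic_divFree {d : ℕ} {a : Space d → Matrix (Fin d) (Fin d) ℝ} {α β : ℝ}
    (ha : IsPeriodic a) (hb : IsBoundedField volume a β) (hα : 0 < α)
    (hco : ∀ᵐ x, ∀ ξ : Space d, α * ‖ξ‖ ^ 2 ≤ inner ℝ (app (a x) ξ) ξ)
    {g : Space d → Space d} (hg : LocallyL2 g) (hgp : IsPeriodic g) :
    ∃ u Du, IsWeakGradient u Du ∧ IsPeriodic u ∧ DivFree fun x => app (a x) (Du x) + g x := by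
  letI : AddAction (Fin d → ℤ) Unit :=
    { vadd := fun _ _ => (), zero_vadd := fun _ => rfl, add_vadd := fun _ _ _ => rfl }
  letI : MeasurableConstVAdd (Fin d → ℤ) Unit := ⟨fun _ => measurable_const⟩
  let P : Measure Unit := Measure.dirac ()
  have : VAddInvariantMeasure (Fin d → ℤ) Unit P := ⟨fun _ _ _ => rfl⟩
  obtain ⟨f, hf, h⟩ := exists_potential_divFree (P := P) ha.isStationary (hb.comp_fst P) hα
    (Measure.quasiMeasurePreserving_fst.ae (ae_restrict_of_ae hco))
    (isL2Field_of_periodic hg hgp)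
  obtain ⟨ω, hω⟩ := h.exists
  obtain ⟨ω', x, u, hu, hup⟩ :=
    (ae_exists_of_ae_cellMeasure ((isFlow_susp P).exists_isWeakGradient hf)).exists
  refine ⟨fun y => u (y + -x), fun y => f (susp y (0, ω)), ?_, fun k => ?_, hω⟩
  · have := hu.comp_add (-x)
    simpa only [susp_eq _ x, add_neg_cancel_comm_assoc, add_comm _ (-x), add_neg_cancel_left]
      using this
  · have h1 := hup (latt k) fun z => by
      rw [← zero_add (latt k)]
      rcases z with ⟨z, _⟩
      rw [susp_eq, susp_eq 0, zero_add, susp_add_latt, add_zero]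
    have h2 := (measurePreserving_add_right (volume : Measure (Space d))
      (-x)).quasiMeasurePreserving.ae h1
    filter_upwards [h2] with y hy
    rw [← hy, add_right_comm]

/-! ### Potential fields on `ℝ^d` -/

section WholeSpace

variable {d : ℕ}

/-- The potential fields in `L²(ℝ^d)`. -/
noncomputable abbrev wholePotentials (d : ℕ) :
    Submodule ℝ (Lp (Space d) 2 (volume : Measure (Space d))) :=
  potentialFields (fun (y x : Space d) => x + y) volume

theorem toLp_mem_wholePotentials_orthogonal_iff {F : Space d → Space d} (hF : MemLp F 2 volume) :
    hF.toLp F ∈ (wholePotentials d)ᗮ ↔ DivFree F := by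
  rw [(isFlow_translation d).mem_orthogonal_potentialFields]
  have h : ∀ x, (fun y => hF.toLp F (x + y)) =ᵐ[volume] fun y => F (x + y) := fun x =>
    (measurePreserving_add_left volume x).quasiMeasurePreserving.ae (MemLp.coeFn_toLp hF)
  constructor
  · intro h1
    obtain ⟨x, hx⟩ := h1.exists
    have h2 := (hx.congr (h x)).comp_add (-x)
    simpa only [add_comm _ (-x), add_neg_cancel_left] using h2
  · intro h1
    refine Eventually.of_forall fun x => DivFree.congr ?_ (EventuallyEq.symm (h x))
    simpa only [add_comm] using h1.comp_add x

theorem toLp_mem_wholePotentials (hd : 0 < d) {F : Space d → Space d} (hF : MemLp F 2 volume)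
    (h : CurlFree F) : hF.toLp F ∈ wholePotentials d :=
  mem_potentialFields_translation hd (h.congr (EventuallyEq.symm (MemLp.coeFn_toLp hF)))

/-- Solvability in `ℝ^d` with a square integrable right-hand side. -/
theorem exists_divFree_of_memLp {a : Space d → Matrix (Fin d) (Fin d) ℝ} {α β : ℝ}
    (hb : IsBoundedField volume a β) (hα : 0 < α)
    (hco : ∀ᵐ x, ∀ ξ : Space d, α * ‖ξ‖ ^ 2 ≤ inner ℝ (app (a x) ξ) ξ)
    {g : Space d → Space d} (hg : MemLp g 2 volume) :
    ∃ u Du, IsWeakGradient u Du ∧ MemLp Du 2 volume ∧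
      DivFree fun x => app (a x) (Du x) + g x := by
  obtain ⟨f, hf, h⟩ := exists_mem_forall_inner_add_eq_zero (wholePotentials d) hb.mulOp hα
    (fun f _ => hb.coercive_mulOp hco f) (hg.toLp g)
  obtain ⟨x, u, hu, -⟩ := ((isFlow_translation d).exists_isWeakGradient hf).exists
  refine ⟨fun y => u (y + -x), f, ?_, Lp.memLp f, ?_⟩
  · have := hu.comp_add (-x)
    simpa only [add_comm _ (-x), add_neg_cancel_left] using this
  · refine (toLp_mem_wholePotentials_orthogonal_iff ((hb.memLp (Lp.memLp f)).add hg)).1 ?_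
    have h1 : hb.mulOp f = (hb.memLp (Lp.memLp f)).toLp _ := by
      rw [← hb.mulOp_toLp (Lp.memLp f), Lp.toLp_coeFn]
    rw [h1, ← MemLp.toLp_add] at h
    exact h

end WholeSpace

/-! ### A Bessel-type inequality -/

/-- A family in a Hilbert space with a summable stationary Gram matrix is a Bessel family. -/
theorem sum_inner_sq_le_of_summable {G H : Type*} [AddCommGroup G] [NormedAddCommGroup H]
    [InnerProductSpace ℝ H] {b : G → H} {γ : G → ℝ} (hb : ∀ k l, inner ℝ (b k) (b l) = γ (k - l))
    (hγ : Summable fun k => |γ k|) (z : H) (s : Finset G) :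
    ∑ k ∈ s, inner ℝ (b k) z ^ 2 ≤ (∑' k, |γ k|) * ‖z‖ ^ 2 := by
  set c : G → ℝ := fun k => inner ℝ (b k) z with hc
  set S := ∑' k, |γ k| with hS
  set N := ∑ k ∈ s, c k ^ 2 with hN
  have hN0 : 0 ≤ N := Finset.sum_nonneg fun k _ => sq_nonneg _
  -- Duality: N = ⟨v, z⟩ ≤ ‖v‖‖z‖, while ‖v‖² ≤ S N; dividing by N gives the claim.
  set v := ∑ k ∈ s, c k • b k with hv
  have h1 : inner ℝ v z = N := by
    rw [hv, sum_inner]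
    refine Finset.sum_congr rfl fun k _ => ?_
    rw [real_inner_smul_left, sq]
  have hrow : ∀ k, ∑ l ∈ s, |γ (k - l)| ≤ S := by
    intro k
    have h2 : Summable fun l => |γ (k - l)| := (Equiv.subLeft k).summable_iff.2 hγ
    calc ∑ l ∈ s, |γ (k - l)| ≤ ∑' l, |γ (k - l)| :=
          h2.sum_le_tsum _ fun _ _ => abs_nonneg _
      _ = S := (Equiv.subLeft k).tsum_eq fun l => |γ l|
  have hcol : ∀ l, ∑ k ∈ s, |γ (k - l)| ≤ S := by
    intro l
    have h2 : Summable fun k => |γ (k - l)| := (Equiv.subRight l).summable_iff.2 hγ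
    calc ∑ k ∈ s, |γ (k - l)| ≤ ∑' k, |γ (k - l)| :=
          h2.sum_le_tsum _ fun _ _ => abs_nonneg _
      _ = S := (Equiv.subRight l).tsum_eq fun l => |γ l|
  -- Schur's test for the Gram matrix γ(k − l), all of whose absolute row and column sums are at
  -- most S.
  have h2 : ‖v‖ ^ 2 ≤ S * N := by
    rw [← real_inner_self_eq_norm_sq, hv, sum_inner]
    simp_rw [inner_sum, real_inner_smul_left, real_inner_smul_right, hb]
    calc ∑ k ∈ s, ∑ l ∈ s, c k * (c l * γ (k - l))
        ≤ ∑ k ∈ s, ∑ l ∈ s, (|γ (k - l)| * c k ^ 2 / 2 + |γ (k - l)| * c l ^ 2 / 2) := by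
          refine Finset.sum_le_sum fun k _ => Finset.sum_le_sum fun l _ => ?_
          have h3 : c k * (c l * γ (k - l)) ≤ |γ (k - l)| * (|c k| * |c l|) := by
            refine (le_abs_self _).trans_eq ?_
            rw [abs_mul, abs_mul]
            ring
          have h4 : |c k| * |c l| ≤ (c k ^ 2 + c l ^ 2) / 2 := by
            rw [← sq_abs (c k), ← sq_abs (c l)]
            nlinarith [sq_nonneg (|c k| - |c l|)]
          nlinarith [mul_le_mul_of_nonneg_left h4 (abs_nonneg (γ (k - l)))]
      _ = (∑ k ∈ s, (∑ l ∈ s, |γ (k - l)|) * c k ^ 2) / 2 +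
          (∑ l ∈ s, (∑ k ∈ s, |γ (k - l)|) * c l ^ 2) / 2 := by
          simp_rw [Finset.sum_add_distrib, Finset.sum_div, Finset.sum_mul, Finset.sum_div]
          congr 1
          exact Finset.sum_comm
      _ ≤ (∑ k ∈ s, S * c k ^ 2) / 2 + (∑ l ∈ s, S * c l ^ 2) / 2 := by
          gcongr with k _ l _
          · exact hrow k
          · exact hcol l
      _ = S * N := by
          rw [← Finset.mul_sum]
          ring
  have h3 : N ≤ ‖v‖ * ‖z‖ := h1 ▸ real_inner_le_norm v z
  have h4 : N * N ≤ S * N * ‖z‖ ^ 2 := by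
    calc N * N ≤ (‖v‖ * ‖z‖) * (‖v‖ * ‖z‖) := mul_self_le_mul_self hN0 h3
      _ = ‖v‖ ^ 2 * ‖z‖ ^ 2 := by ring
      _ ≤ _ := by gcongr
  rcases hN0.eq_or_lt with h5 | h5
  · rw [← h5]
    exact mul_nonneg (tsum_nonneg fun _ => abs_nonneg _) (sq_nonneg _)
  · nlinarith

/-! ### Correlation of a stationary field with a random variable -/

section Correlation

variable {d : ℕ} {Ω : Type*} [MeasurableSpace Ω] [AddAction (Fin d → ℤ) Ω]
  [MeasurableConstVAdd (Fin d → ℤ) Ω] {P : Measure Ω} [IsProbabilityMeasure P]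
  [VAddInvariantMeasure (Fin d → ℤ) Ω P]

lemma integral_mul_vadd {X Y : Ω → ℝ} (hX : AEStronglyMeasurable X P)
    (hY : AEStronglyMeasurable Y P) (k : Fin d → ℤ) :
    ∫ ω, X ω * Y (k +ᵥ ω) ∂P = ∫ ω, X (-k +ᵥ ω) * Y ω ∂P := by
  have hm := measurePreserving_vadd (-k) P
  have hXY : AEStronglyMeasurable (fun ω => X ω * Y (k +ᵥ ω)) P :=
    hX.mul (hY.comp_quasiMeasurePreserving (measurePreserving_vadd k P).quasiMeasurePreserving)
  have h := integral_map hm.aemeasurable (f := fun ω => X ω * Y (k +ᵥ ω)) (by rwa [hm.map_eq])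
  rw [hm.map_eq] at h
  rw [h]
  simp only [vadd_neg_vadd]

/-- The Bessel-type inequality for the translates of a random variable with summable
correlations. -/
lemma tsum_enorm_integral_sq_le {X : Ω → ℝ} (hX : MemLp X 2 P)
    (hs : Summable fun k : Fin d → ℤ => |∫ ω, X ω * X (k +ᵥ ω) ∂P|) {z : Ω → ℝ}
    (hz : MemLp z 2 P) :
    ∑' k : Fin d → ℤ, ‖∫ ω, X ω * z (k +ᵥ ω) ∂P‖ₑ ^ 2 ≤
      ENNReal.ofReal (∑' k : Fin d → ℤ, |∫ ω, X ω * X (k +ᵥ ω) ∂P|) *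
        ∫⁻ ω, ‖z ω‖ₑ ^ 2 ∂P := by
  have hXk : ∀ k : Fin d → ℤ, MemLp (fun ω => X (-k +ᵥ ω)) 2 P := fun k =>
    hX.comp_measurePreserving (measurePreserving_vadd (-k) P)
  have hin : ∀ (f g : Ω → ℝ) (hf : MemLp f 2 P) (hg : MemLp g 2 P),
      inner ℝ (hf.toLp f) (hg.toLp g) = ∫ ω, f ω * g ω ∂P := by
    intro f g hf hg
    rw [L2.inner_def]
    refine integral_congr_ae ?_
    filter_upwards [MemLp.coeFn_toLp hf, MemLp.coeFn_toLp hg] with ω h1 h2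
    rw [h1, h2, real_inner_eq_re_inner, RCLike.inner_apply]
    simp [mul_comm]
  have hb : ∀ k l : Fin d → ℤ, inner ℝ ((hXk k).toLp _) ((hXk l).toLp _) =
      ∫ ω, X ω * X ((k - l) +ᵥ ω) ∂P := by
    intro k l
    rw [hin]
    have h := integral_mul_vadd (d := d) hX.1 (hXk l).1 k
    rw [← h]
    refine integral_congr_ae (Eventually.of_forall fun ω => ?_)
    simp only [← add_vadd]
    rw [neg_add_eq_sub]
  rw [ENNReal.tsum_eq_iSup_sum]
  refine iSup_le fun s => ?_
  have h := sum_inner_sq_le_of_summable hb hs (hz.toLp z) s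
  have h1 : ∀ k : Fin d → ℤ, ‖∫ ω, X ω * z (k +ᵥ ω) ∂P‖ₑ ^ 2 =
      ENNReal.ofReal (inner ℝ ((hXk k).toLp _) (hz.toLp z) ^ 2) := by
    intro k
    rw [hin, integral_mul_vadd hX.1 hz.1, ← sq_abs, ENNReal.ofReal_pow (abs_nonneg _),
      ← Real.norm_eq_abs, ofReal_norm]
  have h2 : ∫⁻ ω, ‖z ω‖ₑ ^ 2 ∂P = ENNReal.ofReal (‖hz.toLp z‖ ^ 2) := by
    rw [Lp.norm_toLp, ENNReal.ofReal_pow ENNReal.toReal_nonneg, ENNReal.ofReal_toReal hz.2.ne,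
      eLpNorm_two_sq]
  simp_rw [h1]
  rw [h2, ← ENNReal.ofReal_sum_of_nonneg fun _ _ => sq_nonneg _,
    ← ENNReal.ofReal_mul (tsum_nonneg fun _ => abs_nonneg _)]
  exact ENNReal.ofReal_le_ofReal h

lemma lintegral_eq_tsum_cell' {H : Space d → ℝ≥0∞} (hH : AEMeasurable H) :
    ∫⁻ x, H x = ∑' k : Fin d → ℤ, ∫⁻ x in cell d, H (x + latt k) := by
  rw [lintegral_congr_ae hH.ae_eq_mk, lintegral_eq_tsum_cell hH.measurable_mk]
  refine tsum_congr fun k => lintegral_congr_ae (ae_restrict_of_ae ?_)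
  exact (measurePreserving_add_right volume (latt k)).quasiMeasurePreserving.ae
    (hH.ae_eq_mk.mono fun _ h => h.symm)

lemma aestronglyMeasurable_corrField {E : Type*} [NormedAddCommGroup E] [NormedSpace ℝ E]
    {X : Ω → ℝ} (hX : AEStronglyMeasurable X P) {ζ : Space d → Ω → E} (hζ : IsL2Field P ζ) :
    AEStronglyMeasurable (fun p : Space d × Ω => X p.2 • ζ p.1 p.2)
      ((volume : Measure (Space d)).prod P) :=
  (hX.comp_quasiMeasurePreserving Measure.quasiMeasurePreserving_snd).smul
    hζ.aestronglyMeasurable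

/-- Unfold the squared norm into cells. By stationarity the value at x + k is 𝔼(X ζ(x, τ_k·)), so
for fixed x ∈ Q the sum over k is controlled by the Bessel inequality; integrating over Q gives a
finite bound. -/
lemma memLp_corrField_real {X : Ω → ℝ} (hX : MemLp X 2 P)
    (hs : Summable fun k : Fin d → ℤ => |∫ ω, X ω * X (k +ᵥ ω) ∂P|) {ζ : Space d → Ω → ℝ}
    (hζ : IsL2Field P ζ) : MemLp (fun x => ∫ ω, X ω * ζ x ω ∂P) 2 (volume : Measure (Space d)) := by
  have hm : AEStronglyMeasurable (fun x => ∫ ω, X ω * ζ x ω ∂P) (volume : Measure (Space d)) :=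
    (aestronglyMeasurable_corrField hX.1 hζ).integral_prod_right'
  refine ⟨hm, ?_⟩
  suffices h : eLpNorm (fun x => ∫ ω, X ω * ζ x ω ∂P) 2 volume ^ 2 < ⊤ by simpa using h
  rw [eLpNorm_two_sq, lintegral_eq_tsum_cell' (hm.enorm.pow_const 2),
    ← lintegral_tsum fun k => ?_]
  swap
  · exact ((hm.comp_quasiMeasurePreserving (measurePreserving_add_right volume
      (latt k)).quasiMeasurePreserving).enorm.pow_const 2).restrict
  have hae : ∀ᵐ x ∂volume.restrict (cell d), MemLp (ζ x) 2 P ∧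
      ∀ k, ∀ᵐ ω ∂P, ζ (x + latt k) ω = ζ x (k +ᵥ ω) := by
    have h1 : ∀ᵐ x ∂volume.restrict (cell d), AEStronglyMeasurable (ζ x) P :=
      hζ.memLp.1.prodMk_left
    have h2 : ∫⁻ x in cell d, ∫⁻ ω, ‖ζ x ω‖ₑ ^ 2 ∂P ≠ ⊤ := by
      have h3 := hζ.memLp.2
      have h4 : eLpNorm (Function.uncurry ζ) 2 (cellMeasure d P) ^ 2 ≠ ⊤ :=
        ENNReal.pow_ne_top h3.ne
      rw [eLpNorm_two_sq, lintegral_prod _ (hζ.memLp.1.enorm.pow_const 2)] at h4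
      exact h4
    have h3 := ae_lt_top' ((hζ.memLp.1.enorm.pow_const 2).lintegral_prod_right') h2
    have h4 : ∀ᵐ x ∂volume.restrict (cell d), ∀ k, ∀ᵐ ω ∂P, ζ (x + latt k) ω = ζ x (k +ᵥ ω) :=
      ae_all_iff.2 fun k => ae_restrict_of_ae (Measure.ae_ae_of_ae_prod (hζ.stationary k))
    filter_upwards [h1, h3, h4] with x h1 h3 h4
    refine ⟨⟨h1, ?_⟩, h4⟩
    rw [← eLpNorm_two_sq] at h3
    simpa using h3
  refine (lintegral_mono_ae (g := fun x => ENNReal.ofReal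
    (∑' k : Fin d → ℤ, |∫ ω, X ω * X (k +ᵥ ω) ∂P|) * ∫⁻ ω, ‖ζ x ω‖ₑ ^ 2 ∂P) ?_).trans_lt ?_
  · filter_upwards [hae] with x hx
    refine le_trans (le_of_eq ?_) (tsum_enorm_integral_sq_le hX hs hx.1)
    refine tsum_congr fun k => ?_
    congr 2
    exact integral_congr_ae ((hx.2 k).mono fun ω hω => by simp only [hω])
  · rw [lintegral_const_mul' _ _ ENNReal.ofReal_ne_top]
    refine ENNReal.mul_lt_top ENNReal.ofReal_lt_top ?_
    have h4 : eLpNorm (Function.uncurry ζ) 2 (cellMeasure d P) ^ 2 < ⊤ :=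
      ENNReal.pow_lt_top hζ.memLp.2
    rw [eLpNorm_two_sq, lintegral_prod _ (hζ.memLp.1.enorm.pow_const 2)] at h4
    exact h4

end Correlation

/-! ### Vector correlation fields: integrability and preserved differential constraints -/

section Correlation

variable {d : ℕ} {Ω : Type*} [MeasurableSpace Ω] [AddAction (Fin d → ℤ) Ω]
  [MeasurableConstVAdd (Fin d → ℤ) Ω] {P : Measure Ω} [IsProbabilityMeasure P]
  [VAddInvariantMeasure (Fin d → ℤ) Ω P]

/-- Averaging over a base point in Q bounds the integral over a fixed ball by that over a larger
piece of orbit, whose mean is controlled by the norm on Q × Ω. -/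
lemma IsL2Field.memLp_bigBall {E : Type*} [NormedAddCommGroup E] {ζ : Space d → Ω → E}
    (hζ : IsL2Field P ζ) (n : ℕ) :
    MemLp (Function.uncurry ζ) 2 ((volume.restrict (bigBall d n)).prod P) := by
  have hac : ((volume.restrict (bigBall d n)).prod P) ≪ (volume : Measure (Space d)).prod P :=
    Measure.restrict_le_self.absolutelyContinuous.prod Measure.AbsolutelyContinuous.rfl
  have hm := hζ.aestronglyMeasurable.mono_ac hac
  refine ⟨hm, ?_⟩
  suffices h : eLpNorm (Function.uncurry ζ) 2 ((volume.restrict (bigBall d n)).prod P) ^ 2 < ⊤ by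
    simpa using h
  obtain ⟨m, hmc⟩ := exists_subset_bigBall (isCompact_cell (d := d))
  -- The ball of index n has radius n + 1. If Q lies in that of index m, displacements from Q to the
  -- ball of index n have length at most n + m + 2, that is, index n + m + 1.
  have h1 := (isFlow_susp P).lintegral_eLpNorm_sq hζ.memLp.1 (bigBall d (n + m + 1))
  have h2 : ∫⁻ p : Space d × Ω, (∫⁻ x in bigBall d n, ‖ζ x p.2‖ₑ ^ 2) ∂cellMeasure d P ≤
      volume (bigBall d (n + m + 1)) * eLpNorm (Function.uncurry ζ) 2 (cellMeasure d P) ^ 2 := by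
    rw [← h1]
    refine lintegral_mono_ae ?_
    have hcell := (Measure.quasiMeasurePreserving_fst (μ := volume.restrict (cell d))
      (ν := P)).ae (ae_restrict_mem (measurableSet_cell (d := d)))
    filter_upwards [hζ.stationary.ae_ae, hcell] with p hp hpc
    rw [eLpNorm_two_sq]
    calc ∫⁻ x in bigBall d n, ‖ζ x p.2‖ₑ ^ 2
        = ∫⁻ x, (bigBall d n).indicator (fun x => ‖ζ x p.2‖ₑ ^ 2) x :=
          (lintegral_indicator (measurableSet_bigBall d n) _).symm
      _ = ∫⁻ y, (bigBall d n).indicator (fun x => ‖ζ x p.2‖ₑ ^ 2) (p.1 + y) :=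
          (lintegral_add_left_eq_self _ p.1).symm
      _ ≤ ∫⁻ y, (bigBall d (n + m + 1)).indicator (fun y => ‖ζ (p.1 + y) p.2‖ₑ ^ 2) y := by
          refine lintegral_mono fun y => ?_
          by_cases hy : p.1 + y ∈ bigBall d n
          · have hy' : y ∈ bigBall d (n + m + 1) := by
              have h3 := hmc hpc
              rw [bigBall, mem_closedBall_zero_iff] at hy h3 ⊢
              have h4 := norm_sub_le (p.1 + y) p.1
              rw [add_sub_cancel_left] at h4
              push_cast
              linarith
            rw [Set.indicator_of_mem hy, Set.indicator_of_mem hy']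
          · rw [Set.indicator_of_notMem hy]
            exact zero_le
      _ = ∫⁻ y in bigBall d (n + m + 1), ‖ζ (p.1 + y) p.2‖ₑ ^ 2 :=
          lintegral_indicator (measurableSet_bigBall d _) _
      _ = _ := lintegral_congr_ae (ae_restrict_of_ae (hp.mono fun y hy => by simp only [hy]))
  have h3 : AEMeasurable (fun ω => ∫⁻ x in bigBall d n, ‖ζ x ω‖ₑ ^ 2) P :=
    (hm.enorm.pow_const 2).lintegral_prod_left'
  have h4 : ∫⁻ p : Space d × Ω, (∫⁻ x in bigBall d n, ‖ζ x p.2‖ₑ ^ 2) ∂cellMeasure d P =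
      (∫⁻ ω, (∫⁻ x in bigBall d n, ‖ζ x ω‖ₑ ^ 2) ∂P) * volume (cell d) := by
    have h6 : AEMeasurable (fun p : Space d × Ω => ∫⁻ x in bigBall d n, ‖ζ x p.2‖ₑ ^ 2)
        (cellMeasure d P) := h3.comp_quasiMeasurePreserving Measure.quasiMeasurePreserving_snd
    rw [lintegral_prod _ h6]
    simp only
    rw [lintegral_const, Measure.restrict_apply_univ]
  rw [eLpNorm_two_sq, lintegral_prod_symm _ (hm.enorm.pow_const 2)]
  have h5 := h2.trans_lt (ENNReal.mul_lt_top (volume_bigBall_ne_top d _).lt_top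
    (ENNReal.pow_lt_top hζ.memLp.2))
  rw [h4] at h5
  exact (ENNReal.lt_top_of_mul_ne_top_left h5.ne volume_cell_ne_zero)

/-- The product of a random variable and a field on `ℝ^d`. -/
lemma memLp_smul_prod {X : Ω → ℝ} (hX : MemLp X 2 P) {ν : Measure (Space d)} [SFinite ν]
    {G : Space d → Space d} (hG : MemLp G 2 ν) :
    MemLp (fun p : Space d × Ω => X p.2 • G p.1) 2 (ν.prod P) := by
  have hm : AEStronglyMeasurable (fun p : Space d × Ω => X p.2 • G p.1) (ν.prod P) :=
    (hX.1.comp_quasiMeasurePreserving Measure.quasiMeasurePreserving_snd).smul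
      (hG.1.comp_quasiMeasurePreserving Measure.quasiMeasurePreserving_fst)
  refine ⟨hm, ?_⟩
  suffices h : eLpNorm (fun p : Space d × Ω => X p.2 • G p.1) 2 (ν.prod P) ^ 2 < ⊤ by
    simpa using h
  rw [eLpNorm_two_sq]
  simp only [enorm_smul, mul_pow]
  have h1 := lintegral_prod_mul (μ := ν) (ν := P) (hG.1.enorm.pow_const 2) (hX.1.enorm.pow_const 2)
  simp only [mul_comm (‖X _‖ₑ ^ 2)]
  rw [h1, ← eLpNorm_two_sq, ← eLpNorm_two_sq]
  exact ENNReal.mul_lt_top (ENNReal.pow_lt_top hG.2) (ENNReal.pow_lt_top hX.2)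

lemma IsL2Field.ae_memLp {E : Type*} [NormedAddCommGroup E] {ζ : Space d → Ω → E}
    (hζ : IsL2Field P ζ) : ∀ᵐ x : Space d, MemLp (ζ x) 2 P := by
  have h : ∀ n, ∀ᵐ x : Space d, x ∈ bigBall d n → MemLp (ζ x) 2 P := by
    intro n
    rw [← ae_restrict_iff'₀ (measurableSet_bigBall d n).nullMeasurableSet]
    have hn := hζ.memLp_bigBall n
    have h4 : eLpNorm (Function.uncurry ζ) 2 ((volume.restrict (bigBall d n)).prod P) ^ 2 ≠ ⊤ :=
      ENNReal.pow_ne_top hn.2.ne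
    rw [eLpNorm_two_sq, lintegral_prod _ (hn.1.enorm.pow_const 2)] at h4
    have h3 := ae_lt_top' ((hn.1.enorm.pow_const 2).lintegral_prod_right') h4
    filter_upwards [hn.1.prodMk_left, h3] with x h1 h3
    refine ⟨h1, ?_⟩
    have h5 : eLpNorm (ζ x) 2 P ^ 2 < ⊤ := by
      rw [eLpNorm_two_sq]
      exact h3
    simpa using h5
  filter_upwards [ae_all_iff.2 h] with x hx using hx _ (mem_bigBall_ceil x)

variable {X : Ω → ℝ}

lemma IsL2Field.ae_integrable_smul {E : Type*} [NormedAddCommGroup E] [NormedSpace ℝ E]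
    {ζ : Space d → Ω → E} (hζ : IsL2Field P ζ) (hX : MemLp X 2 P) :
    ∀ᵐ x : Space d, Integrable (fun ω => X ω • ζ x ω) P := by
  filter_upwards [hζ.ae_memLp] with x hx
  exact integrable_bilin (ContinuousLinearMap.lsmul ℝ ℝ) hX hx

/-- The correlation `𝔼(X ζ(x, ·))` of a stationary field with a random variable. -/
noncomputable def corrField (P : Measure Ω) (X : Ω → ℝ) (ζ : Space d → Ω → Space d)
    (x : Space d) : Space d := ∫ ω, X ω • ζ x ω ∂P

theorem memLp_corrField (hX : MemLp X 2 P)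
    (hs : Summable fun k : Fin d → ℤ => |∫ ω, X ω * X (k +ᵥ ω) ∂P|) {ζ : Space d → Ω → Space d}
    (hζ : IsL2Field P ζ) : MemLp (corrField P X ζ) 2 volume := by
  refine MemLp.of_eval_piLp fun i => ?_
  have h := memLp_corrField_real hX hs (ζ := fun x ω => ζ x ω i)
    ⟨MemLp.euclidean_apply hζ.memLp i, hζ.stationary.comp fun v => v i⟩
  refine (memLp_congr_ae ?_).1 h
  filter_upwards [hζ.ae_integrable_smul hX] with x hx
  rw [corrField, integral_euclidean_apply hx]
  rfl

/-- Fubini on a ball containing the support of θ. Being divergence-free or curl-free is a linear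
condition tested by such θ, so it survives the averaging. -/
lemma integral_inner_corrField (hX : MemLp X 2 P) {ζ : Space d → Ω → Space d}
    (hζ : IsL2Field P ζ) {θ : Space d → Space d} (hθ : Continuous θ)
    (hθc : HasCompactSupport θ) :
    ∫ x, inner ℝ (corrField P X ζ x) (θ x) = ∫ ω, X ω * (∫ x, inner ℝ (ζ x ω) (θ x)) ∂P := by
  obtain ⟨n, hn⟩ := exists_forall_integral_eq_bigBall hθc
  have hint : Integrable (fun p : Space d × Ω => inner ℝ (ζ p.1 p.2) (X p.2 • θ p.1))
      ((volume.restrict (bigBall d n)).prod P) :=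
    integrable_bilin (innerL d) (hζ.memLp_bigBall n)
      (memLp_smul_prod hX (hθ.locallyL2 _ (isCompact_bigBall d n)))
  calc ∫ x, inner ℝ (corrField P X ζ x) (θ x)
      = ∫ x in bigBall d n, inner ℝ (corrField P X ζ x) (θ x) :=
        (setIntegral_bigBall_bilin (innerL d) _ hn).symm
    _ = ∫ x in bigBall d n, ∫ ω, inner ℝ (ζ x ω) (X ω • θ x) ∂P := by
        refine integral_congr_ae (ae_restrict_of_ae ?_)
        filter_upwards [hζ.ae_integrable_smul hX] with x hx
        rw [real_inner_comm, corrField, ← integral_inner hx]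
        refine integral_congr_ae (Eventually.of_forall fun ω => ?_)
        simp only [real_inner_smul_right]
        rw [real_inner_comm]
    _ = ∫ ω, (∫ x in bigBall d n, inner ℝ (ζ x ω) (X ω • θ x)) ∂P :=
        integral_integral_swap hint
    _ = _ := by
        refine integral_congr_ae (Eventually.of_forall fun ω => ?_)
        simp only [real_inner_smul_right, integral_const_mul]
        congr 1
        exact setIntegral_bigBall_bilin (innerL d) _ hn

theorem divFree_corrField (hX : MemLp X 2 P) {ζ : Space d → Ω → Space d}
    (hζ : IsL2Field P ζ) (h : ∀ᵐ ω ∂P, DivFree fun x => ζ x ω) : DivFree (corrField P X ζ) :=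
  fun φ hφ => by
    rw [integral_inner_corrField hX hζ hφ.continuous_gradient hφ.hasCompactSupport_gradient,
      integral_congr_ae (h.mono fun ω hω => by
        change _ = (0 : ℝ)
        rw [hω φ hφ, mul_zero]), integral_zero]

theorem curlFree_corrField (hX : MemLp X 2 P) {ζ : Space d → Ω → Space d}
    (hζ : IsL2Field P ζ) (h : ∀ᵐ ω ∂P, CurlFree fun x => ζ x ω) : CurlFree (corrField P X ζ) :=
  fun φ hφ i j => by
    have key : ∀ i j : Fin d, ∫ x, corrField P X ζ x i * gradient φ x j =
        ∫ ω, X ω * (∫ x, ζ x ω i * gradient φ x j) ∂P := by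
      intro i j
      have h1 := integral_inner_corrField hX hζ
        (θ := fun x => gradient φ x j • (basisVec i : Space d))
        ((hφ.gradient_apply j).1.continuous.smul continuous_const)
        ((hφ.gradient_apply j).2.smul_right)
      have h2 : ∀ v : Space d, inner ℝ v (basisVec i) = v i := fun v => by
        simp [basisVec, EuclideanSpace.inner_single_right]
      simp only [real_inner_smul_right, h2] at h1
      simpa only [mul_comm (gradient φ _ j)] using h1
    rw [key, key]
    refine integral_congr_ae ?_
    filter_upwards [h] with ω hω
    rw [hω φ hφ i j]

end Correlation

/-! ### The pairing on Q × Ω and its orthogonality relations -/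

section Pairing

variable {d : ℕ} {Ω : Type*} [MeasurableSpace Ω]

/-- The pairing `𝔼 ∫_Q F · G`. -/
noncomputable def ip (P : Measure Ω) (F G : Space d → Ω → Space d) : ℝ :=
  ∫ p, inner ℝ (F p.1 p.2) (G p.1 p.2) ∂cellMeasure d P

variable {P : Measure Ω} {F F' G G' : Space d → Ω → Space d}

lemma ip_comm (F G : Space d → Ω → Space d) : ip P F G = ip P G F := by
  simp only [ip, real_inner_comm]

lemma ip_app (a : Space d → Ω → Matrix (Fin d) (Fin d) ℝ) (F G : Space d → Ω → Space d) :
    ip P (fun x ω => app (a x ω) (F x ω)) G =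
      ip P F fun x ω => app (a x ω).transpose (G x ω) := by
  simp only [ip]
  refine integral_congr_ae (Eventually.of_forall fun p => ?_)
  simp only
  rw [real_inner_comm (app _ _), inner_app_transpose, real_inner_comm]

lemma ip_smul_left (c : ℝ) (F G : Space d → Ω → Space d) :
    ip P (fun x ω => c • F x ω) G = c * ip P F G := by
  simp only [ip, real_inner_smul_left, integral_const_mul]

variable [AddAction (Fin d → ℤ) Ω]

lemma IsL2Field.integrable_inner (hF : IsL2Field P F) (hG : IsL2Field P G) :
    Integrable (fun p : Space d × Ω => inner ℝ (F p.1 p.2) (G p.1 p.2)) (cellMeasure d P) :=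
  integrable_bilin (innerL d) hF.memLp hG.memLp

lemma ip_add_left (hF : IsL2Field P F) (hF' : IsL2Field P F') (hG : IsL2Field P G) :
    ip P (fun x ω => F x ω + F' x ω) G = ip P F G + ip P F' G := by
  simp only [ip, inner_add_left]
  exact integral_add (hF.integrable_inner hG) (hF'.integrable_inner hG)

lemma ip_sub_left (hF : IsL2Field P F) (hF' : IsL2Field P F') (hG : IsL2Field P G) :
    ip P (fun x ω => F x ω - F' x ω) G = ip P F G - ip P F' G := by
  simp only [ip, inner_sub_left]
  exact integral_sub (hF.integrable_inner hG) (hF'.integrable_inner hG)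

lemma ip_add_right (hF : IsL2Field P F) (hG : IsL2Field P G) (hG' : IsL2Field P G') :
    ip P F (fun x ω => G x ω + G' x ω) = ip P F G + ip P F G' := by
  rw [ip_comm, ip_add_left hG hG' hF, ip_comm G, ip_comm G']

lemma ip_eq_inner (hF : IsL2Field P F) (hG : IsL2Field P G) :
    ip P F G = inner ℝ (hF.memLp.toLp _) (hG.memLp.toLp _) := by
  rw [L2.inner_def]
  refine integral_congr_ae ?_
  filter_upwards [MemLp.coeFn_toLp hF.memLp, MemLp.coeFn_toLp hG.memLp] with p h1 h2
  rw [h1, h2]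
  rfl

variable [MeasurableConstVAdd (Fin d → ℤ) Ω] [IsProbabilityMeasure P]
  [VAddInvariantMeasure (Fin d → ℤ) Ω P]

/-- Potential and divergence-free stationary fields are orthogonal. -/
lemma ip_eq_zero (hF : IsL2Field P F) (hG : IsL2Field P G)
    (hFV : hF.memLp.toLp _ ∈ stationaryPotentials d P)
    (hGd : ∀ᵐ ω ∂P, DivFree fun x => G x ω) : ip P F G = 0 := by
  rw [ip_eq_inner hF hG]
  exact Submodule.inner_right_of_mem_orthogonal hFV (hG.mem_orthogonal_iff.2 hGd)

lemma isL2Field_cellField_smul {X : Ω → ℝ} (hX : MemLp X 2 P) {H : Space d → Space d}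
    (hH : LocallyL2 H) (hp : IsPeriodic H) :
    IsL2Field P fun x ω => cellField X x ω • H x := by
  refine ⟨(memLp_congr_ae ?_).1 (memLp_smul_prod hX (hH _ isCompact_cell)),
    (isStationary_cellField X).comp₂ hp.isStationary _⟩
  filter_upwards [uncurry_cellField_ae (P := P) X] with p hp
  simp only [Function.uncurry] at hp ⊢
  rw [hp]

end Pairing

/-! ### Solvability -/

section Existence

variable {d : ℕ}

lemma IsPeriodicCorrector.divFree {A : Space d → Matrix (Fin d) (Fin d) ℝ} {i : Fin d}
    {w : Space d → ℝ} {Dw : Space d → Space d} (h : IsPeriodicCorrector A i w Dw) :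
    DivFree fun x => app (A x) (Dw x + basisVec i) := negDivEqDiv_zero.1 h.eqn

lemma IsPeriodicCorrector.locallyL2 {A : Space d → Matrix (Fin d) (Fin d) ℝ} {i : Fin d}
    {w : Space d → ℝ} {Dw : Space d → Space d} (h : IsPeriodicCorrector A i w Dw) :
    LocallyL2 fun x => Dw x + basisVec i := h.isGrad.grad_loc.add continuous_const.locallyL2

lemma IsPeriodicCorrector.isPeriodic {A : Space d → Matrix (Fin d) (Fin d) ℝ} {i : Fin d}
    {w : Space d → ℝ} {Dw : Space d → Space d} (h : IsPeriodicCorrector A i w Dw) :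
    IsPeriodic fun x => Dw x + basisVec i := (h.isGrad.isPeriodic h.periodic).comp (· + basisVec i)

lemma exists_isPeriodicCorrector {a : Space d → Matrix (Fin d) (Fin d) ℝ} {α β : ℝ}
    (ha : IsPeriodic a) (hb : IsBoundedField volume a β) (hα : 0 < α)
    (hco : ∀ᵐ x, ∀ ξ : Space d, α * ‖ξ‖ ^ 2 ≤ inner ℝ (app (a x) ξ) ξ) (i : Fin d) :
    ∃ w Dw, IsPeriodicCorrector a i w Dw := by
  obtain ⟨u, Du, h1, h2, h3⟩ := exists_periodic_divFree ha hb hα hco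
    (g := fun x => app (a x) (basisVec i)) (hb.locallyL2 continuous_const.locallyL2)
    (ha.comp fun m => app m (basisVec i))
  refine ⟨u, Du, h1, h2, negDivEqDiv_zero.2 ?_⟩
  simpa only [app_add] using h3

namespace IsCoefficientPair

variable {A C : Space d → Matrix (Fin d) (Fin d) ℝ} {M α β : ℝ}

lemma locallyL2_right (h : IsCoefficientPair A C M α β) {i : Fin d} {w : Space d → ℝ}
    {Dw : Space d → Space d} (hw : IsPeriodicCorrector A i w Dw) :
    LocallyL2 fun x => app (C x) (Dw x + basisVec i) := h.right.locallyL2 hw.locallyL2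

lemma isPeriodic_right (h : IsCoefficientPair A C M α β) {i : Fin d} {w : Space d → ℝ}
    {Dw : Space d → Space d} (hw : IsPeriodicCorrector A i w Dw) :
    IsPeriodic fun x => app (C x) (Dw x + basisVec i) := h.per_right.comp₂ hw.isPeriodic app

lemma exists_isPeriodicResponse (h : IsCoefficientPair A C M α β) {i : Fin d} {w : Space d → ℝ}
    {Dw : Space d → Space d} (hw : IsPeriodicCorrector A i w Dw) :
    ∃ s Ds, IsPeriodicResponse A C i Dw s Ds := by
  obtain ⟨u, Du, h1, h2, h3⟩ := exists_periodic_divFree h.per_left h.left h.coer_pos h.coercive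
    (h.locallyL2_right hw) (h.isPeriodic_right hw)
  exact ⟨u, Du, h1, h2,
    (negDivEqDiv_iff (h.left.locallyL2 h1.grad_loc) (h.locallyL2_right hw)).2 h3⟩

lemma memLp_defect (h : IsCoefficientPair A C M α β) {i : Fin d} {w : Space d → ℝ}
    {Dw : Space d → Space d} (hw : IsPeriodicCorrector A i w Dw) :
    MemLp (fun x => app (C x) ((cell d).indicator (fun y => Dw y + basisVec i) x)) 2 volume :=
  h.right.memLp ((memLp_indicator_iff_restrict measurableSet_cell).2
    (hw.locallyL2 _ isCompact_cell))

lemma exists_isDefectSolution (h : IsCoefficientPair A C M α β) {i : Fin d} {w : Space d → ℝ}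
    {Dw : Space d → Space d} (hw : IsPeriodicCorrector A i w Dw) :
    ∃ t Dt, IsDefectSolution A C i Dw t Dt := by
  obtain ⟨u, Du, h1, h2, h3⟩ := exists_divFree_of_memLp h.left h.coer_pos h.coercive
    (h.memLp_defect hw)
  exact ⟨u, Du, h1, h2, (negDivEqDiv_iff (h.left.locallyL2 h1.grad_loc)
    fun K _ => (h.memLp_defect hw).restrict K).2 h3⟩

variable {Ω : Type*} [MeasurableSpace Ω] [AddAction (Fin d → ℤ) Ω]
  [MeasurableConstVAdd (Fin d → ℤ) Ω] {P : Measure Ω} [IsProbabilityMeasure P]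
  [VAddInvariantMeasure (Fin d → ℤ) Ω P] {B : Ω → ℝ}

lemma isL2Field_left (h : IsCoefficientPair A C M α β) {F : Space d → Ω → Space d}
    (hF : IsL2Field P F) : IsL2Field P fun x ω => app (A x) (F x ω) :=
  IsL2Field.app h.per_left.isStationary (h.left.comp_fst P) hF

lemma isL2Field_left_transpose (h : IsCoefficientPair A C M α β) {F : Space d → Ω → Space d}
    (hF : IsL2Field P F) : IsL2Field P fun x ω => app (A x).transpose (F x ω) :=
  IsL2Field.app (h.per_left.comp Matrix.transpose).isStationary (h.left.transpose.comp_fst P) hF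

lemma exists_isCorrector (h : IsCoefficientPair A C M α β) (hBm : AEStronglyMeasurable B P)
    (hB : ∀ᵐ ω ∂P, |B ω| ≤ M) (i : Fin d) :
    ∃ w Dw, IsCorrector P (perturbed A C (cellField B)) i w Dw := by
  have hb := h.isBoundedField_perturbed hBm hB
  have hs := h.isStationary_perturbed (P := P) B
  obtain ⟨f, hf, h1⟩ := exists_potential_divFree hs hb h.coer_pos
    ((h.ae_elliptic_perturbed hB).mono fun p hp ξ => (hp ξ).1)
    (IsL2Field.app hs hb (isL2Field_const (basisVec i)))
  obtain ⟨u, hu⟩ := exists_isStationaryGradient (isL2Field_susp f) (by rwa [toLp_susp])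
  refine ⟨u, _, hu, h1.mono fun ω hω => negDivEqDiv_zero.2 ?_⟩
  simpa only [app_add] using hω

lemma exists_isRandomResponse (h : IsCoefficientPair A C M α β) (hB : MemLp B 2 P) {i : Fin d}
    {w : Space d → ℝ} {Dw : Space d → Space d} (hw : IsPeriodicCorrector A i w Dw) :
    ∃ v Dv, IsRandomResponse P A C i (cellField B) Dw v Dv := by
  have hg := isL2Field_cellField_smul hB (h.locallyL2_right hw) (h.isPeriodic_right hw)
  obtain ⟨f, hf, h1⟩ := exists_potential_divFree (P := P) h.per_left.isStationary
    (h.left.comp_fst P) h.coer_pos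
    (Measure.quasiMeasurePreserving_fst.ae (ae_restrict_of_ae h.coercive)) hg
  have hf2 := isL2Field_susp f
  obtain ⟨u, hu⟩ := exists_isStationaryGradient hf2 (by rwa [toLp_susp])
  refine ⟨u, _, hu, ?_⟩
  filter_upwards [h1, hg.ae_locallyL2, (h.isL2Field_left hf2).ae_locallyL2] with ω h1 h2 h3
  exact (negDivEqDiv_iff h3 h2).2 h1

lemma ae_divFree_randomResponse (h : IsCoefficientPair A C M α β) (hB : MemLp B 2 P) {i : Fin d}
    {w : Space d → ℝ} {Dw : Space d → Space d} (hw : IsPeriodicCorrector A i w Dw)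
    {v : Space d → Ω → ℝ} {Dv : Space d → Ω → Space d}
    (hv : IsRandomResponse P A C i (cellField B) Dw v Dv) :
    ∀ᵐ ω ∂P, DivFree fun x =>
      app (A x) (Dv x ω) + cellField B x ω • app (C x) (Dw x + basisVec i) := by
  have hg := isL2Field_cellField_smul hB (h.locallyL2_right hw) (h.isPeriodic_right hw)
  filter_upwards [hv.eqn, hg.ae_locallyL2, (h.isL2Field_left hv.isGrad.isL2Field).ae_locallyL2]
    with ω h1 h2 h3
  exact (negDivEqDiv_iff h3 h2).1 h1

end IsCoefficientPair

end Existence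

lemma hasSum_of_eq {ι : Type*} {f g : ι → ℝ} {a : ℝ} (hg : HasSum g a) (h : ∀ k, f k = g k) :
    HasSum f a := by rwa [funext h]

/-- Disjoint half-open cells give countable additivity; they differ from translates of the closed
cell by null sets. -/
lemma hasSum_integral_cell {d : ℕ} {f : Space d → ℝ} (hf : Integrable f) :
    HasSum (fun k : Fin d → ℤ => ∫ x in cell d, f (x + latt k)) (∫ x, f x) := by
  have hU : (⋃ k : Fin d → ℤ, cellIdx ⁻¹' {k}) = (Set.univ : Set (Space d)) :=
    Set.iUnion_eq_univ_iff.2 fun x => ⟨cellIdx x, rfl⟩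
  have h := hasSum_integral_iUnion (μ := volume) (f := f)
    (s := fun k : Fin d → ℤ => (cellIdx ⁻¹' {k} : Set (Space d)))
    (fun k => measurable_cellIdx (measurableSet_singleton k))
    (fun k l hkl => (Set.disjoint_singleton.2 hkl).preimage cellIdx)
    (hf.integrableOn)
  rw [hU, Measure.restrict_univ] at h
  refine hasSum_of_eq h fun k => ?_
  have hms : MeasurableSet (cellIdx ⁻¹' {k} : Set (Space d)) :=
    measurable_cellIdx (measurableSet_singleton k)
  rw [← integral_indicator measurableSet_cell, ← integral_indicator hms,
    ← integral_add_right_eq_self ((cellIdx ⁻¹' {k}).indicator f) (latt k)]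
  refine integral_congr_ae ?_
  filter_upwards [ae_mem_cell_iff_zero (d := d)] with x hx
  have h1 : x + latt k ∈ (cellIdx ⁻¹' {k} : Set (Space d)) ↔ x ∈ cell d := by
    rw [hx, Set.mem_preimage, Set.mem_singleton_iff, cellIdx_add_latt, add_eq_right]
  by_cases hxc : x ∈ cell d
  · rw [Set.indicator_of_mem hxc, Set.indicator_of_mem (h1.2 hxc)]
  · rw [Set.indicator_of_notMem hxc, Set.indicator_of_notMem (mt h1.1 hxc)]

/-- Orthogonality of the Helmholtz decomposition in L²(ℝ^d). It applies to Φ, for which no potential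
has been constructed. -/
lemma integral_inner_eq_zero_of_curlFree {d : ℕ} (hd : 0 < d) {F G : Space d → Space d}
    (hF : MemLp F 2 volume) (hG : MemLp G 2 volume) (hFc : CurlFree F) (hGd : DivFree G) :
    ∫ x, inner ℝ (F x) (G x) = 0 := by
  have h := Submodule.inner_right_of_mem_orthogonal (toLp_mem_wholePotentials hd hF hFc)
    ((toLp_mem_wholePotentials_orthogonal_iff hG).2 hGd)
  rw [L2.inner_def] at h
  rw [← h]
  refine integral_congr_ae ?_
  filter_upwards [MemLp.coeFn_toLp hF, MemLp.coeFn_toLp hG] with p h1 h2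
  rw [h1, h2]

lemma integrable_inner {d : ℕ} {X : Type*} [MeasurableSpace X] {ν : Measure X}
    {F G : X → Space d} (hF : MemLp F 2 ν) (hG : MemLp G 2 ν) :
    Integrable (fun x => inner ℝ (F x) (G x)) ν := integrable_bilin (innerL d) hF hG

/-! ### The covariance series through the dual problem -/

section Formula

variable {d : ℕ} {Ω : Type*} [MeasurableSpace Ω] [AddAction (Fin d → ℤ) Ω]
  [MeasurableConstVAdd (Fin d → ℤ) Ω] {P : Measure Ω} [IsProbabilityMeasure P]

section Invariant

variable [VAddInvariantMeasure (Fin d → ℤ) Ω P]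

lemma integral_cell_inner_corrField {X : Ω → ℝ} (hX : MemLp X 2 P) {ζ : Space d → Ω → Space d}
    (hζ : IsL2Field P ζ) {G : Space d → Space d} (hG : LocallyL2 G) :
    ∫ x in cell d, inner ℝ (G x) (corrField P X ζ x) =
      ∫ p, X p.2 * inner ℝ (G p.1) (ζ p.1 p.2) ∂cellMeasure d P := by
  have hint : Integrable (fun p : Space d × Ω => inner ℝ (X p.2 • G p.1) (ζ p.1 p.2))
      (cellMeasure d P) :=
    integrable_inner (memLp_smul_prod hX (hG _ isCompact_cell)) hζ.memLp
  simp only [real_inner_smul_left] at hint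
  rw [integral_prod _ hint]
  refine integral_congr_ae (ae_restrict_of_ae ?_)
  filter_upwards [hζ.ae_integrable_smul hX] with x hx
  rw [corrField, ← integral_inner hx]
  simp only [real_inner_smul_right]

lemma integral_vadd (X : Ω → ℝ) (hX : AEStronglyMeasurable X P) (k : Fin d → ℤ) :
    ∫ ω, X (k +ᵥ ω) ∂P = ∫ ω, X ω ∂P := by
  have hm := measurePreserving_vadd k P
  have h := integral_map hm.aemeasurable (f := X) (by rwa [hm.map_eq])
  rw [hm.map_eq] at h
  exact h.symm

lemma covariance_vadd_eq {B : Ω → ℝ} (hB : MemLp B 2 P) (k : Fin d → ℤ) :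
    cov[B, fun ω => B (k +ᵥ ω); P] =
      ∫ ω, (B ω - ∫ ω, B ω ∂P) * (B (k +ᵥ ω) - ∫ ω, B ω ∂P) ∂P := by
  rw [covariance, integral_vadd B hB.1]

/-- Centring one factor already produces the covariance, since B − 𝔼B has mean zero. -/
lemma covariance_vadd_eq' {B : Ω → ℝ} (hB : MemLp B 2 P) (k : Fin d → ℤ) :
    cov[B, fun ω => B (k +ᵥ ω); P] = ∫ ω, (B ω - ∫ ω, B ω ∂P) * B (k +ᵥ ω) ∂P := by
  have hBk : MemLp (fun ω => B (k +ᵥ ω)) 2 P :=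
    hB.comp_measurePreserving (measurePreserving_vadd k P)
  have hβ : MemLp (fun ω => B ω - ∫ ω, B ω ∂P) 2 P := hB.sub (memLp_const _)
  have hi : Integrable (fun ω => (B ω - ∫ ω, B ω ∂P) * B (k +ᵥ ω)) P := hβ.integrable_mul hBk
  rw [covariance_vadd_eq hB]
  simp only [mul_sub _ (B _)]
  rw [integral_sub hi ((hβ.integrable (by norm_num)).mul_const _),
    integral_mul_const, integral_sub (hB.integrable (by norm_num)) (integrable_const _)]
  simp

lemma covariance_vadd_neg {B : Ω → ℝ} (hB : MemLp B 2 P) (k : Fin d → ℤ) :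
    cov[B, fun ω => B (-k +ᵥ ω); P] = cov[B, fun ω => B (k +ᵥ ω); P] := by
  have hβ : MemLp (fun ω => B ω - ∫ ω, B ω ∂P) 2 P := hB.sub (memLp_const _)
  rw [covariance_vadd_eq hB, covariance_vadd_eq hB,
    integral_mul_vadd (X := fun ω => B ω - ∫ ω, B ω ∂P) (Y := fun ω => B ω - ∫ ω, B ω ∂P)
      hβ.1 hβ.1 k]
  simp only [mul_comm]

end Invariant

variable [ErgodicVAdd (Fin d → ℤ) Ω P]
  {A C : Space d → Matrix (Fin d) (Fin d) ℝ} {M α β : ℝ} {i j : Fin d} {w wt : Space d → ℝ}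
  {Dw Dwt : Space d → Space d} {B : Ω → ℝ}

namespace IsCoefficientPair

lemma locallyL2_right_transpose (h : IsCoefficientPair A C M α β)
    (hwt : IsPeriodicCorrector (fun x => (A x).transpose) j wt Dwt) :
    LocallyL2 fun x => app (C x).transpose (Dwt x + basisVec j) :=
  h.right.transpose.locallyL2 hwt.locallyL2

lemma isPeriodic_right_transpose (h : IsCoefficientPair A C M α β)
    (hwt : IsPeriodicCorrector (fun x => (A x).transpose) j wt Dwt) :
    IsPeriodic fun x => app (C x).transpose (Dwt x + basisVec j) :=
  (h.per_right.comp Matrix.transpose).comp₂ hwt.isPeriodic app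

/-- The random part of the response, tested with the dual field, through the whole-space
problem. -/
theorem hasSum_ip_sub (h : IsCoefficientPair A C M α β)
    (hw : IsPeriodicCorrector A i w Dw)
    (hwt : IsPeriodicCorrector (fun x => (A x).transpose) j wt Dwt) (hB : MemLp B 2 P)
    (h_cov : Summable fun k : Fin d → ℤ => |cov[B, fun ω => B (k +ᵥ ω); P]|)
    {v : Space d → Ω → ℝ} {Dv : Space d → Ω → Space d}
    (hv : IsRandomResponse P A C i (cellField B) Dw v Dv)
    {s : Space d → ℝ} {Ds : Space d → Space d} (hs : IsPeriodicResponse A C i Dw s Ds)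
    {t : Space d → ℝ} {Dt : Space d → Space d} (ht : IsDefectSolution A C i Dw t Dt) :
    HasSum (fun k : Fin d → ℤ => covTerm P C j B Dwt Dt k)
      (ip P Dv (fun x ω => cellField B x ω • app (C x).transpose (Dwt x + basisVec j)) -
        (∫ ω, B ω ∂P) * ip P (fun x _ => Ds x)
          (fun x ω => cellField B x ω • app (C x).transpose (Dwt x + basisVec j))) := by
  -- The existence of an index i excludes dimension 0, as the whole-space orthogonality requires.
  have hd : 0 < d := i.pos
  set m := ∫ ω, B ω ∂P with hm
  set Y : Space d → Space d := fun x => app (C x) (Dw x + basisVec i) with hY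
  set Z : Space d → Space d := fun x => app (C x).transpose (Dwt x + basisVec j) with hZ
  have hYl : LocallyL2 Y := h.locallyL2_right hw
  have hYp : IsPeriodic Y := h.isPeriodic_right hw
  have hZl : LocallyL2 Z := h.locallyL2_right_transpose hwt
  have hZp : IsPeriodic Z := h.isPeriodic_right_transpose hwt
  set G : Space d → Ω → Space d := fun x ω => cellField B x ω • Z x with hGdef
  have hG : IsL2Field P G := isL2Field_cellField_smul hB hZl hZp
  have hbY : IsL2Field P fun x ω => cellField B x ω • Y x := isL2Field_cellField_smul hB hYl hYp
  have hYf : IsL2Field P fun x (_ : Ω) => Y x := isL2Field_of_periodic hYl hYp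
  set X : Ω → ℝ := fun ω => B ω - m with hXdef
  have hX : MemLp X 2 P := hB.sub (memLp_const _)
  have hXs : Summable fun k : Fin d → ℤ => |∫ ω, X ω * X (k +ᵥ ω) ∂P| := by
    simpa only [covariance_vadd_eq hB] using h_cov
  -- the dual problem
  obtain ⟨f, hf, hfd⟩ := exists_potential_divFree (P := P)
    (h.per_left.comp Matrix.transpose).isStationary (h.left.transpose.comp_fst P) h.coer_pos
    (Measure.quasiMeasurePreserving_fst.ae (ae_restrict_of_ae h.coercive_transpose)) hG
  set ψ : Space d → Ω → Space d := fun x ω => f (susp x (0, ω)) with hψdef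
  have hψ : IsL2Field P ψ := isL2Field_susp f
  have hψV : hψ.memLp.toLp _ ∈ stationaryPotentials d P := by
    rw [toLp_susp]
    exact hf
  have hAψ := h.isL2Field_left_transpose hψ
  have hv2 := hv.isGrad.isL2Field
  have hsg : IsStationaryGradient P (fun x (_ : Ω) => s x) fun x _ => Ds x :=
    hs.isGrad.isStationaryGradient hs.periodic
  have hs2 := hsg.isL2Field
  -- duality on the suspension
  have e1 : ip P Dv G = ip P (fun x ω => cellField B x ω • Y x) ψ := by
    -- Each potential is orthogonal to the total flux of the other problem; transposing A makes the
    -- two cross terms equal.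
    have h1 := ip_eq_zero hv2 (hAψ.add hG) hv.isGrad.mem hfd
    have h2 := ip_eq_zero hψ ((h.isL2Field_left hv2).add hbY) hψV
      (h.ae_divFree_randomResponse hB hw hv)
    rw [ip_add_right hv2 hAψ hG] at h1
    rw [ip_add_right hψ (h.isL2Field_left hv2) hbY, ip_comm ψ, ip_comm ψ,
      ip_app (fun x _ => A x)] at h2
    linarith
  have e2 : ip P (fun x _ => Ds x) G = ip P (fun x _ => Y x) ψ := by
    have hsd : DivFree fun x => app (A x) (Ds x) + Y x :=
      (negDivEqDiv_iff (h.left.locallyL2 hs.isGrad.grad_loc) hYl).1 hs.eqn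
    have h1 := ip_eq_zero hs2 (hAψ.add hG) hsg.mem hfd
    have h2 := ip_eq_zero hψ ((h.isL2Field_left hs2).add hYf) hψV
      (Eventually.of_forall fun _ => hsd)
    rw [ip_add_right hs2 hAψ hG] at h1
    rw [ip_add_right hψ (h.isL2Field_left hs2) hYf, ip_comm ψ, ip_comm ψ,
      ip_app (fun x _ => A x)] at h2
    linarith
  -- passage to `ℝ^d`
  set Φ := corrField P X ψ with hΦ
  have hΦ2 : MemLp Φ 2 volume := memLp_corrField hX hXs hψ
  have hΦc : CurlFree Φ := curlFree_corrField hX hψ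
    ((hψ.ae_toLp_iff (fun _ _ h hf => hf.congr h) fun _ a hf => hf.comp_add a).1
      ((isFlow_susp P).curlFree_of_mem hψV))
  set g : Space d → Space d :=
    fun x => app (C x) ((cell d).indicator (fun y => Dw y + basisVec i) x) with hg
  have hg2 : MemLp g 2 volume := h.memLp_defect hw
  -- Subtracting m times the periodic response centres B̄₀. The field Y does not depend on ω, so the
  -- expectation falls on (B̄₀ − m)ψ, and the integral over Q becomes one over ℝ^d against the
  -- defect source.
  have e3 : ip P (fun x ω => cellField B x ω • Y x) ψ - m * ip P (fun x _ => Y x) ψ =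
      ∫ x, inner ℝ (g x) (Φ x) := by
    have h1 : ∫ x, inner ℝ (g x) (Φ x) = ∫ x in cell d, inner ℝ (Y x) (Φ x) := by
      rw [← integral_indicator measurableSet_cell]
      refine integral_congr_ae (Eventually.of_forall fun x => ?_)
      by_cases hx : x ∈ cell d
      · simp only [hg, hY, Set.indicator_of_mem hx]
      · simp only [hg, Set.indicator_of_notMem hx, app_zero, inner_zero_left]
    rw [h1, integral_cell_inner_corrField hX hψ hYl, ← ip_smul_left, ip, ip,
      ← integral_sub (hbY.integrable_inner hψ)
        ((show IsL2Field P fun x (_ : Ω) => m • Y x from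
          ⟨hYf.memLp.const_smul m, hYf.stationary.comp _⟩).integrable_inner hψ)]
    refine integral_congr_ae ?_
    filter_upwards [uncurry_cellField_ae (P := P) B] with p hp
    simp only [Function.uncurry] at hp
    simp only [hp, real_inner_smul_left, hXdef]
    ring
  -- The same duality in ℝ^d, between the defect problem for Dt and the adjoint problem for Φ.
  have e4 : ∫ x, inner ℝ (g x) (Φ x) = ∫ x, inner ℝ (Dt x) (corrField P X G x) := by
    have hADt : MemLp (fun x => app (A x) (Dt x)) 2 volume := h.left.memLp ht.grad_memLp
    have htd : DivFree fun x => app (A x) (Dt x) + g x :=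
      (negDivEqDiv_iff (h.left.locallyL2 ht.isGrad.grad_loc) fun K _ => hg2.restrict K).1 ht.eqn
    have h1 := integral_inner_eq_zero_of_curlFree hd hΦ2 (hADt.add hg2) hΦc htd
    have h2 := integral_inner_eq_zero_of_curlFree hd ht.grad_memLp
      (memLp_corrField hX hXs (hAψ.add hG)) ht.isGrad.curlFree
      (divFree_corrField hX (hAψ.add hG) hfd)
    have hAΦ : MemLp (fun x => app (A x).transpose (Φ x)) 2 volume := h.left.transpose.memLp hΦ2
    have hGc := memLp_corrField hX hXs hG
    have h3 : ∀ᵐ x, corrField P X (fun x ω => app (A x).transpose (ψ x ω) + G x ω) x =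
        app (A x).transpose (Φ x) + corrField P X G x := by
      filter_upwards [hψ.ae_integrable_smul hX, hAψ.ae_integrable_smul hX,
        hG.ae_integrable_smul hX] with x i1 i2 i3
      simp only [corrField, smul_add, hΦ]
      rw [integral_add i2 i3]
      congr 1
      have h4 := ((Matrix.toEuclideanLin (A x).transpose).toContinuousLinearMap).integral_comp_comm
        i1
      refine Eq.trans ?_ h4
      refine integral_congr_ae (Eventually.of_forall fun ω => ?_)
      exact (app_smul _ _ _).symm
    rw [integral_congr_ae (h3.mono fun x hx => by
      change _ = inner ℝ (Dt x) (app (A x).transpose (Φ x)) + inner ℝ (Dt x) (corrField P X G x)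
      rw [← inner_add_right, ← hx]),
      integral_add (integrable_inner ht.grad_memLp hAΦ)
        (integrable_inner ht.grad_memLp hGc)] at h2
    simp only [Pi.add_apply, inner_add_right] at h1
    rw [integral_add (integrable_inner hΦ2 hADt)
      (integrable_inner hΦ2 hg2)] at h1
    have h5 : ∀ x, inner ℝ (Dt x) (app (A x).transpose (Φ x)) =
        inner ℝ (Φ x) (app (A x) (Dt x)) := fun x => by
      rw [real_inner_comm, inner_app_transpose]
    simp only [h5] at h2
    simp only [real_inner_comm (Φ _) (g _)] at h1 ⊢
    linarith
  -- unfolding into cells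
  have e5 : ∀ᵐ x, corrField P X G x = cov[B, fun ω => B (cellIdx x +ᵥ ω); P] • Z x := by
    filter_upwards [ae_cellField_eq (d := d) B] with x hx
    simp only [corrField, hGdef, hx, smul_smul]
    rw [integral_smul_const, covariance_vadd_eq' hB]
  have hint := integrable_inner ht.grad_memLp (memLp_corrField hX hXs hG)
  have e6 := hasSum_integral_cell hint
  rw [e1, e2, e3, e4]
  -- Unfolding produces Dt(x + k), the formula Dt(x − k). Reversing k is harmless because the
  -- covariance is even.
  rw [← (Equiv.neg (Fin d → ℤ)).hasSum_iff] at e6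
  refine hasSum_of_eq e6 fun k => ?_
  simp only [Function.comp_apply, Equiv.neg_apply, covTerm, pairing]
  rw [← integral_const_mul]
  refine integral_congr_ae ?_
  have h6 := (measurePreserving_add_right (volume : Measure (Space d))
    (latt (-k))).quasiMeasurePreserving.ae e5
  filter_upwards [ae_restrict_of_ae h6, ae_restrict_of_ae (hZp (-k)),
    ae_restrict_cellIdx (d := d)] with x h6 h7 h8
  rw [h6, h7, cellIdx_add_latt, h8, zero_add, covariance_vadd_neg hB, real_inner_smul_right,
    latt_neg, ← sub_eq_add_neg, hZ]
  simp only
  rw [← real_inner_comm (Dt _), inner_app_transpose, real_inner_comm]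

end IsCoefficientPair

end Formula

/-! ### Pairings weighted by a random variable -/

section WeightedPairing

variable {d : ℕ} {Ω : Type*} [MeasurableSpace Ω]

/-- The pairing `𝔼 ∫_Q X F · Z`. -/
noncomputable def wip (P : Measure Ω) (Z : Space d → Space d) (X : Ω → ℝ)
    (F : Space d → Ω → Space d) : ℝ :=
  ∫ p, X p.2 * inner ℝ (F p.1 p.2) (Z p.1) ∂cellMeasure d P

variable {P : Measure Ω} [AddAction (Fin d → ℤ) Ω] {F F' : Space d → Ω → Space d}
  {Z : Space d → Space d} {X Y : Ω → ℝ}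

lemma ip_cellField_smul (F : Space d → Ω → Space d) (Z : Space d → Space d) (X : Ω → ℝ) :
    ip P F (fun x ω => cellField X x ω • Z x) = wip P Z X F := by
  refine integral_congr_ae ?_
  filter_upwards [uncurry_cellField_ae (P := P) X] with p hp
  simp only [Function.uncurry] at hp
  simp only [hp, real_inner_smul_right]

variable [MeasurableConstVAdd (Fin d → ℤ) Ω] [IsProbabilityMeasure P]
  [VAddInvariantMeasure (Fin d → ℤ) Ω P]

lemma integrable_wip (hX : MemLp X 2 P) (hZ : LocallyL2 Z) (hF : IsL2Field P F) :
    Integrable (fun p : Space d × Ω => X p.2 * inner ℝ (F p.1 p.2) (Z p.1))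
      (cellMeasure d P) := by
  have h := integrable_inner hF.memLp (memLp_smul_prod hX (hZ _ isCompact_cell))
  simpa only [real_inner_smul_right] using! h

lemma wip_add_smul_right (hX : MemLp X 2 P) (hZ : LocallyL2 Z) (hF : IsL2Field P F)
    (hF' : IsL2Field P F') (c : ℝ) :
    wip P Z X (fun x ω => F x ω + c • F' x ω) = wip P Z X F + c * wip P Z X F' := by
  rw [wip, wip, wip, ← integral_const_mul, ← integral_add (integrable_wip hX hZ hF)
    ((integrable_wip hX hZ hF').const_mul c)]
  refine integral_congr_ae (Eventually.of_forall fun p => ?_)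
  simp only [inner_add_left, real_inner_smul_left]
  ring

lemma wip_add_mul_left (hX : MemLp X 2 P) (hY : MemLp Y 2 P) (hZ : LocallyL2 Z)
    (hF : IsL2Field P F) (c : ℝ) :
    wip P Z (fun ω => X ω + c * Y ω) F = wip P Z X F + c * wip P Z Y F := by
  rw [wip, wip, wip, ← integral_const_mul, ← integral_add (integrable_wip hX hZ hF)
    ((integrable_wip hY hZ hF).const_mul c)]
  refine integral_congr_ae (Eventually.of_forall fun p => ?_)
  simp only
  ring

lemma wip_const (X : Ω → ℝ) (Z W : Space d → Space d) :
    wip P Z X (fun x _ => W x) = (∫ ω, X ω ∂P) * ∫ x in cell d, inner ℝ (W x) (Z x) := by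
  rw [wip, mul_comm, ← integral_prod_mul]
  simp only [mul_comm]

lemma abs_wip_le (hX : MemLp X 2 P) (hZ : LocallyL2 Z) (hF : IsL2Field P F) :
    |wip P Z X F| ≤ (eLpNorm (fun p : Space d × Ω => X p.2 • Z p.1) 2 (cellMeasure d P)).toReal *
      (eLpNorm (Function.uncurry F) 2 (cellMeasure d P)).toReal := by
  have hXZ := memLp_smul_prod hX (hZ _ isCompact_cell)
  have h : wip P Z X F = inner ℝ (hXZ.toLp _) (hF.memLp.toLp _) := by
    rw [L2.inner_def]
    refine integral_congr_ae ?_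
    filter_upwards [MemLp.coeFn_toLp hXZ, MemLp.coeFn_toLp hF.memLp] with p h1 h2
    rw [h1, h2, real_inner_smul_left, real_inner_comm]
    rfl
  rw [h, ← Lp.norm_toLp _ hXZ, ← Lp.norm_toLp _ hF.memLp]
  exact abs_real_inner_le_norm _ _

lemma pairing_eq (C : Space d → Matrix (Fin d) (Fin d) ℝ) (F G : Space d → Space d) :
    pairing C F G = ∫ x in cell d, inner ℝ (F x) (app (C x).transpose (G x)) := by
  refine integral_congr_ae (Eventually.of_forall fun x => ?_)
  simp only
  rw [real_inner_comm, real_inner_comm _ (F x), inner_app_transpose]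

end WeightedPairing

/-! ### The coefficients as weighted pairings, and the formula -/

section Formula

variable {d : ℕ} {Ω : Type*} [MeasurableSpace Ω] [AddAction (Fin d → ℤ) Ω]
  [MeasurableConstVAdd (Fin d → ℤ) Ω] {P : Measure Ω} [IsProbabilityMeasure P]
  [ErgodicVAdd (Fin d → ℤ) Ω P]
  {A C : Space d → Matrix (Fin d) (Fin d) ℝ} {M α β : ℝ} {i j : Fin d} {w wt : Space d → ℝ}
  {Dw Dwt : Space d → Space d} {B R : Ω → ℝ}
  {v : Space d → Ω → ℝ} {Dv : Space d → Ω → Space d}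

lemma integral_cell_basisVec {F : Space d → Space d} (hF : IntegrableOn F (cell d)) (j : Fin d) :
    (∫ x in cell d, F x) j = ∫ x in cell d, inner ℝ (F x) (basisVec j) := by
  rw [integral_euclidean_apply hF]
  refine integral_congr_ae (Eventually.of_forall fun x => ?_)
  simp [basisVec, EuclideanSpace.inner_single_right]

namespace IsCoefficientPair

lemma secondOrder_eq_wip (h : IsCoefficientPair A C M α β)
    (hwt : IsPeriodicCorrector (fun x => (A x).transpose) j wt Dwt) (hB : MemLp B 2 P)
    (hv : IsRandomResponse P A C i (cellField B) Dw v Dv) :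
    secondOrder P C i j (cellField B) (cellField R) Dw Dwt Dv =
      wip P (fun x => app (C x).transpose (Dwt x + basisVec j)) R
          (fun x _ => Dw x + basisVec i) +
        wip P (fun x => app (C x).transpose (Dwt x + basisVec j)) B Dv := by
  rw [secondOrder, wip_const, ← pairing_eq]
  congr 1
  · rw [pairing, ← integral_const_mul]
    refine integral_congr_ae ?_
    filter_upwards [ae_cellField_cell (d := d) R] with x hx
    simp only [hx, real_inner_smul_left]
  · have h1 := integral_cell_inner_corrField hB hv.isGrad.isL2Field
      (h.locallyL2_right_transpose hwt)
    simp only [real_inner_comm (Dv _ _)] at h1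
    rw [pairing_eq, wip, ← h1]
    refine integral_congr_ae ?_
    filter_upwards [ae_cellField_cell (d := d) B] with x hx
    simp only [hx, corrField]
    rw [real_inner_comm]

/-- The deterministic formula, with the summability of the correlation series. -/
theorem secondOrder_eq (h : IsCoefficientPair A C M α β)
    (hw : IsPeriodicCorrector A i w Dw)
    (hwt : IsPeriodicCorrector (fun x => (A x).transpose) j wt Dwt) (hB : MemLp B 2 P)
    (h_cov : Summable fun k : Fin d → ℤ => |cov[B, fun ω => B (k +ᵥ ω); P]|)
    (hv : IsRandomResponse P A C i (cellField B) Dw v Dv)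
    {s : Space d → ℝ} {Ds : Space d → Space d} (hs : IsPeriodicResponse A C i Dw s Ds)
    {t : Space d → ℝ} {Dt : Space d → Space d} (ht : IsDefectSolution A C i Dw t Dt) :
    (Summable fun k : {k : Fin d → ℤ // k ≠ 0} => covTerm P C j B Dwt Dt k) ∧
      secondOrder P C i j (cellField B) (cellField R) Dw Dwt Dv =
        deterministicSecondOrder P C i j B R Dw Dwt Ds Dt := by
  have hsum := h.hasSum_ip_sub hw hwt hB h_cov hv hs ht
  refine ⟨hsum.summable.subtype _, ?_⟩
  -- A second factor 𝔼 B̄₀ appears because Ds is deterministic; this is the origin of (𝔼 B̄₀)² in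
  -- the formula.
  rw [ip_cellField_smul, ip_cellField_smul, wip_const, ← pairing_eq] at hsum
  have h0 : covTerm P C j B Dwt Dt 0 =
      Var[B; P] * pairing C Dt fun x => Dwt x + basisVec j := by
    simp only [covTerm, zero_vadd, latt_zero, sub_zero]
    rw [covariance_self hB.1.aemeasurable]
  -- The term k = 0 is split off: it is the variance term.
  have h1 := hsum.summable.sum_add_tsum_subtype_compl {0}
  rw [Finset.sum_singleton, hsum.tsum_eq, h0] at h1
  have h2 : ∑' k : {k : Fin d → ℤ // k ∉ ({0} : Finset (Fin d → ℤ))}, covTerm P C j B Dwt Dt k =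
      ∑' k : {k : Fin d → ℤ // k ≠ 0}, covTerm P C j B Dwt Dt k := by
    exact (Equiv.subtypeEquivRight fun k => by simp :
      {k : Fin d → ℤ // k ∉ ({0} : Finset (Fin d → ℤ))} ≃ {k : Fin d → ℤ // k ≠ 0}).tsum_eq
        fun k => covTerm P C j B Dwt Dt k
  rw [h.secondOrder_eq_wip hwt hB hv, wip_const, ← pairing_eq, deterministicSecondOrder, ← h2]
  linear_combination -h1

/-- The total flux A∇v + bY is divergence-free, so e_j may be replaced by ∇w̃ + e_j. Then the
contribution of A∇v vanishes, because Aᵀ(∇w̃ + e_j) is divergence-free. -/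
lemma firstOrder_eq_wip (h : IsCoefficientPair A C M α β)
    (hw : IsPeriodicCorrector A i w Dw)
    (hwt : IsPeriodicCorrector (fun x => (A x).transpose) j wt Dwt) (hB : MemLp B 2 P)
    (hv : IsRandomResponse P A C i (cellField B) Dw v Dv) :
    firstOrder P A C i (cellField B) Dw Dv j =
      wip P (fun x => app (C x).transpose (Dwt x + basisVec j)) B
        (fun x _ => Dw x + basisVec i) := by
  have hv2 := hv.isGrad.isL2Field
  have hADv := h.isL2Field_left hv2
  have hY : LocallyL2 fun x => app (C x) (Dw x + basisVec i) := h.locallyL2_right hw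
  have hbY := isL2Field_cellField_smul hB hY (h.isPeriodic_right hw)
  have hej : IsL2Field P fun (_ : Space d) (_ : Ω) => (basisVec j : Space d) := isL2Field_const _
  have hwtg : IsStationaryGradient P (fun x (_ : Ω) => wt x) fun x _ => Dwt x :=
    hwt.isGrad.isStationaryGradient hwt.periodic
  have hwt2 := hwtg.isL2Field
  have hWt : IsL2Field P fun x (_ : Ω) => app (A x).transpose (Dwt x + basisVec j) :=
    h.isL2Field_left_transpose (hwt2.add hej)
  have hp := ip_eq_zero hwt2 (hADv.add hbY) hwtg.mem (h.ae_divFree_randomResponse hB hw hv)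
  have hq := ip_eq_zero hv2 hWt hv.isGrad.mem (Eventually.of_forall fun _ => hwt.divFree)
  have e1 : firstOrder P A C i (cellField B) Dw Dv j =
      ip P (fun x ω => app (A x) (Dv x ω) + cellField B x ω • app (C x) (Dw x + basisVec i))
        fun _ _ => basisVec j := by
    rw [ip_add_left hADv hbY hej, firstOrder, PiLp.add_apply, add_comm]
    have hmem : MemLp (Function.uncurry Dv) 1 (cellMeasure d P) := hv2.memLp.mono_exponent (by norm_num)
    have hDvi : ∀ᵐ x ∂volume.restrict (cell d), Integrable (Dv x) P :=
      (memLp_one_iff_integrable.1 hmem).prod_right_ae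
    have hADvi : Integrable (fun p : Space d × Ω => app (A p.1) (Dv p.1 p.2)) (cellMeasure d P) :=
      hADv.memLp.integrable (by norm_num)
    have hcomm : ∀ᵐ x ∂volume.restrict (cell d), app (A x) (∫ ω, Dv x ω ∂P) =
        ∫ ω, app (A x) (Dv x ω) ∂P := by
      filter_upwards [hDvi] with x hx
      exact (((Matrix.toEuclideanLin (A x)).toContinuousLinearMap).integral_comp_comm hx).symm
    congr 1
    · rw [integral_congr_ae hcomm, integral_cell_basisVec hADvi.integral_prod_left, ip,
        integral_prod _ (hADv.integrable_inner hej)]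
      refine integral_congr_ae ?_
      filter_upwards [hADvi.prod_right_ae] with x hx
      rw [real_inner_comm, ← integral_inner hx]
      simp only [real_inner_comm (basisVec j)]
    · have hYi : IntegrableOn (fun x => app (C x) (Dw x + basisVec i)) (cell d) :=
        (hY _ isCompact_cell).integrable (by norm_num)
      have hb : ∀ᵐ x ∂volume.restrict (cell d),
          (∫ ω, cellField B x ω ∂P) • app (C x) (Dw x + basisVec i) =
            (∫ ω, B ω ∂P) • app (C x) (Dw x + basisVec i) := by
        filter_upwards [ae_cellField_cell (d := d) B] with x hx
        simp only [hx]
      have hYs : IntegrableOn (fun x => (∫ ω, B ω ∂P) • app (C x) (Dw x + basisVec i)) (cell d) :=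
        hYi.smul (∫ ω, B ω ∂P)
      rw [integral_congr_ae hb, integral_cell_basisVec hYs, ip_comm, ip_cellField_smul,
        wip_const, ← integral_const_mul]
      refine integral_congr_ae (Eventually.of_forall fun x => ?_)
      simp only [real_inner_smul_left]
      rw [real_inner_comm]
  have e2 : ip P (fun x ω => app (A x) (Dv x ω) + cellField B x ω • app (C x) (Dw x + basisVec i))
      (fun _ _ => basisVec j) = ip P (fun x ω => app (A x) (Dv x ω) +
        cellField B x ω • app (C x) (Dw x + basisVec i)) fun x _ => Dwt x + basisVec j := by
    rw [ip_add_right (hADv.add hbY) hwt2 hej, ip_comm _ fun x _ => Dwt x, hp, zero_add]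
  rw [e1, e2, ip_add_left hADv hbY (hwt2.add hej), ip_app (fun x _ => A x), hq, zero_add, ip_comm,
    ip_cellField_smul, wip_const, wip_const]
  congr 1
  rw [← pairing_eq, pairing]
  simp only [real_inner_comm (app _ _)]

/-- Testing with ∇w̃ + e_j reduces the A-parts of both tensors to their pairings with the constant
e_i, and these cancel. No remainder is left, and an explicit factor B is gained: this is why a
first-order expansion of the corrector yields a second-order one of the tensor. -/
lemma homogenized_sub_eq_wip (h : IsCoefficientPair A C M α β)
    (hw : IsPeriodicCorrector A i w Dw)
    (hwt : IsPeriodicCorrector (fun x => (A x).transpose) j wt Dwt)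
    (hBm : AEStronglyMeasurable B P) (hB : ∀ᵐ ω ∂P, |B ω| ≤ M)
    (hv : IsCorrector P (perturbed A C (cellField B)) i v Dv) :
    homogenized P (perturbed A C (cellField B)) i Dv j - periodicHomogenized A i Dw j =
      wip P (fun x => app (C x).transpose (Dwt x + basisVec j)) B
        (fun x ω => Dv x ω + basisVec i) := by
  have hB2 : MemLp B 2 P := MemLp.of_bound hBm M hB
  have hb := h.isBoundedField_perturbed hBm hB
  have hst := h.isStationary_perturbed (P := P) B
  have hv2 := hv.isGrad.isL2Field
  have hei : IsL2Field P fun (_ : Space d) (_ : Ω) => (basisVec i : Space d) := isL2Field_const _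
  have hej : IsL2Field P fun (_ : Space d) (_ : Ω) => (basisVec j : Space d) := isL2Field_const _
  have hW := hv2.add hei
  have hAW := IsL2Field.app hst hb hW
  have hLW := h.isL2Field_left hW
  have hwtg : IsStationaryGradient P (fun x (_ : Ω) => wt x) fun x _ => Dwt x :=
    hwt.isGrad.isStationaryGradient hwt.periodic
  have hwt2 := hwtg.isL2Field
  have hwg : IsStationaryGradient P (fun x (_ : Ω) => w x) fun x _ => Dw x :=
    hw.isGrad.isStationaryGradient hw.periodic
  have hw2 := hwg.isL2Field
  have hWt : IsL2Field P fun x (_ : Ω) => app (A x).transpose (Dwt x + basisVec j) :=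
    h.isL2Field_left_transpose (hwt2.add hej)
  have hZ : IsL2Field P fun x ω => cellField B x ω • app (C x).transpose (Dwt x + basisVec j) :=
    isL2Field_cellField_smul hB2 (h.locallyL2_right_transpose hwt)
      (h.isPeriodic_right_transpose hwt)
  have hAw : IsL2Field P fun x (_ : Ω) => app (A x) (Dw x + basisVec i) :=
    h.isL2Field_left (hw2.add hei)
  have hint : ∀ {F : Space d → Ω → Space d}, IsL2Field P F →
      (∫ ω, (∫ x in cell d, F x ω) ∂P) j = ip P F fun _ _ => basisVec j := by
    intro F hF
    have hi : Integrable (Function.uncurry F) (cellMeasure d P) :=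
      hF.memLp.integrable (by norm_num)
    have h1 : ∫ ω, (∫ x in cell d, F x ω) ∂P = ∫ p, Function.uncurry F p ∂cellMeasure d P :=
      (integral_prod_symm _ hi).symm
    rw [h1, integral_euclidean_apply hi]
    refine integral_congr_ae (Eventually.of_forall fun p => ?_)
    simp [basisVec, EuclideanSpace.inner_single_right, Function.uncurry]
  have e1 : homogenized P (perturbed A C (cellField B)) i Dv j =
      ip P (fun x ω => app (perturbed A C (cellField B) x ω) (Dv x ω + basisVec i))
        fun x _ => Dwt x + basisVec j := by
    rw [homogenized, hint hAW, ip_add_right hAW hwt2 hej, ip_comm _ fun x _ => Dwt x,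
      ip_eq_zero hwt2 hAW hwtg.mem (hv.eqn.mono fun ω hω => negDivEqDiv_zero.1 hω), zero_add]
  have e2 : periodicHomogenized A i Dw j =
      ip P (fun x _ => app (A x) (Dw x + basisVec i)) fun x _ => Dwt x + basisVec j := by
    have h1 : periodicHomogenized A i Dw =
        ∫ _, (∫ x in cell d, app (A x) (Dw x + basisVec i)) ∂P := by
      rw [periodicHomogenized, integral_const]
      simp
    rw [h1, hint hAw, ip_add_right hAw hwt2 hej, ip_comm _ fun x _ => Dwt x,
      ip_eq_zero hwt2 hAw hwtg.mem (Eventually.of_forall fun _ => hw.divFree), zero_add]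
  have e3 : ip P (fun x ω => app (perturbed A C (cellField B) x ω) (Dv x ω + basisVec i))
        (fun x _ => Dwt x + basisVec j) =
      ip P (fun x ω => Dv x ω + basisVec i) (fun x _ => app (A x).transpose (Dwt x + basisVec j)) +
        ip P (fun x ω => Dv x ω + basisVec i)
          (fun x ω => cellField B x ω • app (C x).transpose (Dwt x + basisVec j)) := by
    rw [ip_app, ← ip_add_right hW hWt hZ]
    simp only [perturbed, Matrix.transpose_add, Matrix.transpose_smul, add_app, smul_app]
  have hperp := Eventually.of_forall (f := ae P) fun _ : Ω => hwt.divFree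
  rw [e1, e2, e3, ip_add_left hv2 hei hWt, ip_eq_zero hv2 hWt hv.isGrad.mem hperp, zero_add,
    ip_app (fun x _ => A x), ip_add_left hw2 hei hWt, ip_eq_zero hw2 hWt hwg.mem hperp, zero_add,
    add_sub_cancel_left, ip_cellField_smul]

end IsCoefficientPair

end Formula

/-! ### Strong convergence of the first-order coefficient -/

section Expansion

variable {Ω : Type*} [MeasurableSpace Ω] {P : Measure Ω}

lemma eLpNorm_two_toReal_eq {f : Ω → ℝ} (hf : MemLp f 2 P) :
    (eLpNorm f 2 P).toReal = ‖hf.toLp f‖ := (Lp.norm_toLp f hf).symm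

lemma eventually_forall_add {u : ℕ → ℝ} (hu : Tendsto u atTop (𝓝[>] 0)) :
    ∃ N, ∀ n, 0 < u (n + N) := by
  obtain ⟨N, hN⟩ := eventually_atTop.1 (hu.eventually self_mem_nhdsWithin)
  exact ⟨N, fun n => hN _ (Nat.le_add_left N n)⟩

/-- A weak expansion to second order yields strong convergence of the difference quotients. -/
theorem tendsto_eLpNorm_of_weak_expansion {B : ℝ → Ω → ℝ} {B₀ R₀ : Ω → ℝ}
    (hB : ∀ η > 0, MemLp (B η) 2 P) (hB₀ : MemLp B₀ 2 P) (hR₀ : MemLp R₀ 2 P)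
    (h : ∀ X : Ω → ℝ, MemLp X 2 P →
      (fun η : ℝ => ∫ ω, (B η ω - η * B₀ ω - η ^ 2 * R₀ ω) * X ω ∂P)
        =o[𝓝[>] 0] (fun η : ℝ => η ^ 2)) :
    Tendsto (fun η => (eLpNorm (fun ω => η⁻¹ * B η ω - B₀ ω) 2 P).toReal) (𝓝[>] 0) (𝓝 0) := by
  -- Along a sequence a convergent family is bounded for all indices. As η → 0⁺ boundedness would
  -- hold only eventually, at a rate depending on the test function, and uniform boundedness could
  -- not be applied.
  refine tendsto_of_seq_tendsto fun u hu => ?_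
  obtain ⟨N, hN⟩ := eventually_forall_add hu
  rw [← tendsto_add_atTop_iff_nat N]
  set s : ℕ → ℝ := fun n => u (n + N) with hs
  have hsl : Tendsto s atTop (𝓝[>] 0) := hu.comp (tendsto_add_atTop_nat N)
  have hs0 : Tendsto s atTop (𝓝 0) := tendsto_nhds_of_tendsto_nhdsWithin hsl
  have hr : ∀ n, MemLp (fun ω => (s n ^ 2)⁻¹ * (B (s n) ω - s n * B₀ ω - s n ^ 2 * R₀ ω)) 2 P :=
    fun n => (((hB _ (hN n)).sub (hB₀.const_mul _)).sub (hR₀.const_mul _)).const_mul _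
  have hd : ∀ n, MemLp (fun ω => (s n)⁻¹ * B (s n) ω - B₀ ω) 2 P :=
    fun n => ((hB _ (hN n)).const_mul _).sub hB₀
  -- The rescaled remainders r_n = s_n⁻²(B − s_n B₀ − s_n² R₀) tend weakly to 0, hence are bounded
  -- in norm by Banach–Steinhaus.
  have hbd : ∃ K, ∀ n, ‖innerSL ℝ ((hr n).toLp _)‖ ≤ K := by
    refine banach_steinhaus fun x => ?_
    have h1 := (h x (Lp.memLp x)).tendsto_div_nhds_zero.comp hsl
    have h2 : (fun n => innerSL ℝ ((hr n).toLp _) x) =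
        (fun η : ℝ => (∫ ω, (B η ω - η * B₀ ω - η ^ 2 * R₀ ω) * x ω ∂P) / η ^ 2) ∘ s := by
      funext n
      rw [innerSL_apply_apply, L2.inner_def, Function.comp_apply, div_eq_inv_mul,
        ← integral_const_mul]
      refine integral_congr_ae ?_
      filter_upwards [MemLp.coeFn_toLp (hr n)] with ω hω
      rw [hω, real_inner_eq_re_inner, RCLike.inner_apply]
      simp only [conj_trivial, RCLike.re_to_real]
      ring
    rw [← h2] at h1
    obtain ⟨K, hK⟩ := h1.norm.bddAbove_range
    exact ⟨K, fun n => hK ⟨n, rfl⟩⟩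
  obtain ⟨K, hK⟩ := hbd
  simp only [innerSL_apply_norm] at hK
  refine squeeze_zero (fun n => ENNReal.toReal_nonneg) (g := fun n => s n * (‖hR₀.toLp R₀‖ + K))
    (fun n => ?_) ?_
  · change (eLpNorm (fun ω => (s n)⁻¹ * B (s n) ω - B₀ ω) 2 P).toReal ≤ _
    rw [eLpNorm_two_toReal_eq (hd n)]
    -- The difference quotient minus B₀ is s_n (R₀ + r_n), hence of order s_n in norm.
    have h3 : (hd n).toLp _ = s n • (hR₀.toLp R₀ + (hr n).toLp _) := by
      refine Lp.ext ?_
      filter_upwards [MemLp.coeFn_toLp (hd n), MemLp.coeFn_toLp (hr n), MemLp.coeFn_toLp hR₀,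
        Lp.coeFn_smul (s n) (hR₀.toLp R₀ + (hr n).toLp _),
        Lp.coeFn_add (hR₀.toLp R₀) ((hr n).toLp _)] with ω h1 h2 h3 h4 h5
      rw [h1, h4, Pi.smul_apply, h5, Pi.add_apply, h2, h3, smul_eq_mul]
      have : s n ≠ 0 := (hN n).ne'
      field_simp
      ring
    rw [h3, norm_smul, Real.norm_of_nonneg (hN n).le]
    gcongr
    · exact (hN n).le
    · exact (norm_add_le _ _).trans (by gcongr; exact hK n)
  · simpa using hs0.mul_const (‖hR₀.toLp R₀‖ + K)

lemma tendsto_eLpNorm_of_difference_quotient {B : ℝ → Ω → ℝ} {B₀ : Ω → ℝ}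
    (hB : ∀ η > 0, MemLp (B η) 2 P) (hB₀ : MemLp B₀ 2 P)
    (h : Tendsto (fun η => (eLpNorm (fun ω => η⁻¹ * B η ω - B₀ ω) 2 P).toReal) (𝓝[>] 0) (𝓝 0)) :
    Tendsto (fun η => (eLpNorm (B η) 2 P).toReal) (𝓝[>] 0) (𝓝 0) := by
  have h0 : Tendsto (fun η : ℝ => η) (𝓝[>] 0) (𝓝 0) := tendsto_id.mono_left nhdsWithin_le_nhds
  have h1 := h0.mul (h.add_const ‖hB₀.toLp B₀‖)
  rw [zero_mul] at h1
  refine squeeze_zero' (Eventually.of_forall fun _ => ENNReal.toReal_nonneg) ?_ h1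
  filter_upwards [self_mem_nhdsWithin] with η hη
  have hη : 0 < η := hη
  have hd : MemLp (fun ω => η⁻¹ * B η ω - B₀ ω) 2 P := ((hB _ hη).const_mul _).sub hB₀
  rw [eLpNorm_two_toReal_eq (hB η hη), eLpNorm_two_toReal_eq hd]
  have h3 : (hB η hη).toLp _ = η • (hd.toLp _ + hB₀.toLp B₀) := by
    refine Lp.ext ?_
    filter_upwards [MemLp.coeFn_toLp hd, MemLp.coeFn_toLp (hB η hη), MemLp.coeFn_toLp hB₀,
      Lp.coeFn_smul η (hd.toLp _ + hB₀.toLp B₀),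
      Lp.coeFn_add (hd.toLp _) (hB₀.toLp B₀)] with ω h1 h2 h3 h4 h5
    rw [h2, h4, Pi.smul_apply, h5, Pi.add_apply, h1, h3, smul_eq_mul]
    field_simp
    ring
  rw [h3, norm_smul, Real.norm_of_nonneg hη.le]
  gcongr
  exact norm_add_le _ _

variable {d : ℕ} [IsProbabilityMeasure P]

lemma toReal_eLpNorm_smul_prod {X : Ω → ℝ} (hX : MemLp X 2 P) {G : Space d → Space d}
    (hG : MemLp G 2 (volume.restrict (cell d))) :
    (eLpNorm (fun p : Space d × Ω => X p.2 • G p.1) 2 (cellMeasure d P)).toReal =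
      (eLpNorm X 2 P).toReal * (eLpNorm G 2 (volume.restrict (cell d))).toReal := by
  have h : eLpNorm (fun p : Space d × Ω => X p.2 • G p.1) 2 (cellMeasure d P) ^ 2 =
      (eLpNorm X 2 P * eLpNorm G 2 (volume.restrict (cell d))) ^ 2 := by
    rw [mul_pow, eLpNorm_two_sq, eLpNorm_two_sq, eLpNorm_two_sq, mul_comm,
      ← lintegral_prod_mul (hG.1.enorm.pow_const 2) (hX.1.enorm.pow_const 2)]
    simp only [enorm_smul, mul_pow, mul_comm]
  have h2 := congrArg ENNReal.toReal h
  rw [ENNReal.toReal_pow, ENNReal.toReal_pow, ENNReal.toReal_mul] at h2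
  exact (pow_left_inj₀ ENNReal.toReal_nonneg
    (mul_nonneg ENNReal.toReal_nonneg ENNReal.toReal_nonneg) two_ne_zero).1 h2

/-- U is only square integrable and b n is not uniformly small, so Hölder does not suffice. A
subsequence of b n tends to 0 almost everywhere, and M‖U‖ dominates. -/
lemma exists_subseq_tendsto_eLpNorm_smul {b : ℕ → Ω → ℝ} {M : ℝ}
    (hb : ∀ n, AEStronglyMeasurable (b n) P) (hM : ∀ n, ∀ᵐ ω ∂P, |b n ω| ≤ M)
    (h0 : Tendsto (fun n => eLpNorm (b n) 2 P) atTop (𝓝 0)) {U : Space d × Ω → Space d}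
    (hU : MemLp U 2 (cellMeasure d P)) :
    ∃ ms : ℕ → ℕ, Tendsto (fun n =>
      (eLpNorm (fun p => b (ms n) p.2 • U p) 2 (cellMeasure d P)).toReal) atTop (𝓝 0) := by
  have hmeas : TendstoInMeasure P b atTop 0 := by
    refine tendstoInMeasure_of_tendsto_eLpNorm two_ne_zero hb aestronglyMeasurable_zero ?_
    simpa only [sub_zero] using h0
  obtain ⟨ms, -, hae⟩ := hmeas.exists_seq_tendsto_ae
  refine ⟨ms, ?_⟩
  have hae' := (Measure.quasiMeasurePreserving_snd (μ := volume.restrict (cell d)) (ν := P)).ae hae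
  have hM' := fun n =>
    (Measure.quasiMeasurePreserving_snd (μ := volume.restrict (cell d)) (ν := P)).ae (hM n)
  have hbm : ∀ n, AEStronglyMeasurable (fun p : Space d × Ω => b n p.2) (cellMeasure d P) :=
    fun n => (hb n).comp_quasiMeasurePreserving Measure.quasiMeasurePreserving_snd
  have hdct := tendsto_lintegral_of_dominated_convergence' (μ := cellMeasure d P)
    (F := fun n p => ‖b (ms n) p.2 • U p‖ₑ ^ 2) (f := fun _ => 0)
    (fun p => ENNReal.ofReal M ^ 2 * ‖U p‖ₑ ^ 2)
    (fun n => ((hbm (ms n)).smul hU.1).enorm.pow_const 2)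
    (fun n => by
      filter_upwards [hM' (ms n)] with p hp
      rw [enorm_smul, mul_pow]
      gcongr
      rw [← ofReal_norm, Real.norm_eq_abs]
      exact ENNReal.ofReal_le_ofReal hp)
    (by
      rw [lintegral_const_mul' _ _ (ENNReal.pow_ne_top ENNReal.ofReal_ne_top), ← eLpNorm_two_sq]
      exact ENNReal.mul_ne_top (ENNReal.pow_ne_top ENNReal.ofReal_ne_top)
        (ENNReal.pow_ne_top hU.2.ne))
    (by
      filter_upwards [hae'] with p hp
      have h1 : Tendsto (fun n => b (ms n) p.2 • U p) atTop (𝓝 ((0 : ℝ) • U p)) :=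
        hp.smul_const (U p)
      rw [zero_smul] at h1
      have h2 := (ENNReal.continuous_pow 2).tendsto _ |>.comp h1.enorm
      simpa [Function.comp_def] using h2)
  simp only [← eLpNorm_two_sq, lintegral_zero] at hdct
  have h3 := (ENNReal.tendsto_toReal ENNReal.zero_ne_top).comp hdct
  simp only [Function.comp_def, ENNReal.toReal_pow, ENNReal.toReal_zero] at h3
  have h4 := (Real.continuous_sqrt.tendsto 0).comp h3
  simpa only [Function.comp_def, Real.sqrt_sq ENNReal.toReal_nonneg, Real.sqrt_zero] using h4

lemma tendsto_eLpNorm_smul {B : ℝ → Ω → ℝ} {M : ℝ} (hB : ∀ η > 0, MemLp (B η) 2 P)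
    (hM : ∀ η > 0, ∀ᵐ ω ∂P, |B η ω| ≤ M)
    (h0 : Tendsto (fun η => (eLpNorm (B η) 2 P).toReal) (𝓝[>] 0) (𝓝 0))
    {U : Space d × Ω → Space d} (hU : MemLp U 2 (cellMeasure d P)) :
    Tendsto (fun η => (eLpNorm (fun p => B η p.2 • U p) 2 (cellMeasure d P)).toReal) (𝓝[>] 0)
      (𝓝 0) := by
  refine tendsto_of_subseq_tendsto fun u hu => ?_
  obtain ⟨N, hN⟩ := eventually_forall_add hu
  have hsl : Tendsto (fun n => u (n + N)) atTop (𝓝[>] 0) := hu.comp (tendsto_add_atTop_nat N)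
  obtain ⟨ms, hms⟩ := exists_subseq_tendsto_eLpNorm_smul (b := fun n => B (u (n + N)))
    (fun n => (hB _ (hN n)).1) (fun n => hM _ (hN n))
    ((ENNReal.tendsto_toReal_iff (fun n => (hB _ (hN n)).2.ne) ENNReal.zero_ne_top).1
      (by simpa using! h0.comp hsl)) hU
  exact ⟨fun n => ms n + N, hms⟩

end Expansion

/-! ### Expansion of the correctors -/

section Correctors

variable {d : ℕ} {Ω : Type*} [MeasurableSpace Ω] [AddAction (Fin d → ℤ) Ω] {P : Measure Ω}

/-- Square integrable stationary potential fields. -/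
def IsPotential (P : Measure Ω) (F : Space d → Ω → Space d) : Prop :=
  ∃ hF : IsL2Field P F, hF.memLp.toLp _ ∈ stationaryPotentials d P

lemma IsPotential.sub {F G : Space d → Ω → Space d} (hF : IsPotential P F)
    (hG : IsPotential P G) : IsPotential P fun x ω => F x ω - G x ω :=
  ⟨hF.1.sub hG.1, sub_mem hF.2 hG.2⟩

lemma IsL2Field.const_smul {F : Space d → Ω → Space d} (hF : IsL2Field P F) (c : ℝ) :
    IsL2Field P fun x ω => c • F x ω := ⟨hF.memLp.const_smul c, hF.stationary.comp _⟩

lemma IsPotential.const_smul {F : Space d → Ω → Space d} (hF : IsPotential P F) (c : ℝ) :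
    IsPotential P fun x ω => c • F x ω :=
  ⟨hF.1.const_smul c, Submodule.smul_mem _ c hF.2⟩

lemma abs_ip_le {F G : Space d → Ω → Space d} (hF : IsL2Field P F) (hG : IsL2Field P G) :
    |ip P F G| ≤ (eLpNorm (Function.uncurry F) 2 (cellMeasure d P)).toReal *
      (eLpNorm (Function.uncurry G) 2 (cellMeasure d P)).toReal := by
  rw [ip_eq_inner hF hG, ← Lp.norm_toLp _ hF.memLp, ← Lp.norm_toLp _ hG.memLp]
  exact abs_real_inner_le_norm _ _

/-- The energy estimate. -/
lemma norm_le_of_ip_eq_zero {a : Space d → Ω → Matrix (Fin d) (Fin d) ℝ} {α β : ℝ}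
    (ha : IsStationary P a)
    (hb : IsBoundedField (cellMeasure d P) (Function.uncurry a) β) (hα : 0 < α)
    (hco : ∀ᵐ p ∂cellMeasure d P, ∀ ξ : Space d,
      α * ‖ξ‖ ^ 2 ≤ inner ℝ (app (Function.uncurry a p) ξ) ξ)
    {δ F : Space d → Ω → Space d} (hδ : IsL2Field P δ) (hF : IsL2Field P F)
    (h : ip P (fun x ω => app (a x ω) (δ x ω) + F x ω) δ = 0) :
    (eLpNorm (Function.uncurry δ) 2 (cellMeasure d P)).toReal ≤
      (eLpNorm (Function.uncurry F) 2 (cellMeasure d P)).toReal / α := by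
  have haδ := IsL2Field.app ha hb hδ
  rw [ip_add_left haδ hF hδ] at h
  have h1 := hb.coercive_mulOp hco (hδ.memLp.toLp _)
  rw [hb.mulOp_toLp] at h1
  have h2 : ip P (fun x ω => app (a x ω) (δ x ω)) δ =
      inner ℝ ((hb.memLp hδ.memLp).toLp _) (hδ.memLp.toLp _) := ip_eq_inner haδ hδ
  rw [← h2, Lp.norm_toLp] at h1
  have h3 := abs_ip_le hF hδ
  set D := (eLpNorm (Function.uncurry δ) 2 (cellMeasure d P)).toReal with hD
  set N := (eLpNorm (Function.uncurry F) 2 (cellMeasure d P)).toReal with hN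
  have hD0 : 0 ≤ D := ENNReal.toReal_nonneg
  have h4 : α * D ^ 2 ≤ N * D := by
    have := neg_abs_le (ip P F δ)
    linarith
  rw [le_div_iff₀ hα]
  -- Coercivity gives α D² ≤ N D; division by D requires D ≠ 0.
  rcases hD0.eq_or_lt with h5 | h5
  · rw [← h5, zero_mul]
    exact ENNReal.toReal_nonneg
  · nlinarith

end Correctors

/-! ### Expansion of the corrector and of the homogenized tensor -/

section SecondOrder

variable {d : ℕ} {Ω : Type*} [MeasurableSpace Ω] [AddAction (Fin d → ℤ) Ω]
  [MeasurableConstVAdd (Fin d → ℤ) Ω] {P : Measure Ω} [IsProbabilityMeasure P]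
  [ErgodicVAdd (Fin d → ℤ) Ω P]
  {A C : Space d → Matrix (Fin d) (Fin d) ℝ} {M α β : ℝ} {i j : Fin d} {w wt : Space d → ℝ}
  {Dw Dwt : Space d → Space d} {v : Space d → Ω → ℝ} {Dv : Space d → Ω → Space d}

namespace IsCoefficientPair

/-- The remainder of the first-order expansion of the corrector. -/
lemma corrector_remainder_le (h : IsCoefficientPair A C M α β)
    (hw : IsPeriodicCorrector A i w Dw) {B B₀ : Ω → ℝ} (hBm : AEStronglyMeasurable B P)
    (hBM : ∀ᵐ ω ∂P, |B ω| ≤ M) (hB₀ : MemLp B₀ 2 P)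
    (hv : IsRandomResponse P A C i (cellField B₀) Dw v Dv)
    {u : Space d → Ω → ℝ} {Du : Space d → Ω → Space d}
    (hu : IsCorrector P (perturbed A C (cellField B)) i u Du) {η : ℝ} :
    IsL2Field P (fun x ω => η⁻¹ • (Du x ω - Dw x) - Dv x ω) ∧
    (eLpNorm (Function.uncurry fun x ω => η⁻¹ • (Du x ω - Dw x) - Dv x ω) 2
        (cellMeasure d P)).toReal ≤
      ((eLpNorm (fun ω => η⁻¹ * B ω - B₀ ω) 2 P).toReal *
          (eLpNorm (fun x => app (C x) (Dw x + basisVec i)) 2 (volume.restrict (cell d))).toReal +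
        (eLpNorm (fun p : Space d × Ω => B p.2 • app (C p.1) (Dv p.1 p.2)) 2
          (cellMeasure d P)).toReal) / α := by
  have hB2 : MemLp B 2 P := MemLp.of_bound hBm M hBM
  have hb := h.isBoundedField_perturbed hBm hBM
  have hst := h.isStationary_perturbed (P := P) B
  have hu2 := hu.isGrad.isL2Field
  have hv2 := hv.isGrad.isL2Field
  have hwg : IsStationaryGradient P (fun x (_ : Ω) => w x) fun x _ => Dw x :=
    hw.isGrad.isStationaryGradient hw.periodic
  have hw2 := hwg.isL2Field
  have hei : IsL2Field P fun (_ : Space d) (_ : Ω) => (basisVec i : Space d) := isL2Field_const _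
  have hYl : LocallyL2 fun x => app (C x) (Dw x + basisVec i) := h.locallyL2_right hw
  have hYp := h.isPeriodic_right hw
  have hδ : IsPotential P fun x ω => η⁻¹ • (Du x ω - Dw x) - Dv x ω :=
    ((IsPotential.sub ⟨hu2, hu.isGrad.mem⟩ ⟨hw2, hwg.mem⟩).const_smul η⁻¹).sub
      ⟨hv2, hv.isGrad.mem⟩
  have hδ2 := hδ.1
  have hbY := isL2Field_cellField_smul hB2 hYl hYp
  have hb₀Y := isL2Field_cellField_smul hB₀ hYl hYp
  have hbCv : IsL2Field P fun x ω => cellField B x ω • app (C x) (Dv x ω) := by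
    have h1 := (IsL2Field.app hst hb hv2).sub (h.isL2Field_left hv2)
    have h2 : ∀ x ω, app (perturbed A C (cellField B) x ω) (Dv x ω) - app (A x) (Dv x ω) =
        cellField B x ω • app (C x) (Dv x ω) := fun x ω => by
      rw [perturbed, add_app, smul_app, add_sub_cancel_left]
    simpa only [h2] using h1
  have hF := ((hbY.const_smul η⁻¹).sub hb₀Y).add hbCv
  have hAu := IsL2Field.app hst hb (hu2.add hei)
  have hAw := h.isL2Field_left (hw2.add hei)
  have hAv := (h.isL2Field_left hv2).add hb₀Y
  have horth : ip P (fun x ω => app (perturbed A C (cellField B) x ω)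
      (η⁻¹ • (Du x ω - Dw x) - Dv x ω) +
        (η⁻¹ • (cellField B x ω • app (C x) (Dw x + basisVec i)) -
          cellField B₀ x ω • app (C x) (Dw x + basisVec i) +
          cellField B x ω • app (C x) (Dv x ω)))
      (fun x ω => η⁻¹ • (Du x ω - Dw x) - Dv x ω) = 0 := by
    -- The residual flux is a combination of the three fluxes of the perturbed, periodic and
    -- response problems, all divergence-free. The identity is linear in η⁻¹, so no sign of η
    -- matters.
    have h1 : ∀ x ω, app (perturbed A C (cellField B) x ω)
        (η⁻¹ • (Du x ω - Dw x) - Dv x ω) +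
          (η⁻¹ • (cellField B x ω • app (C x) (Dw x + basisVec i)) -
            cellField B₀ x ω • app (C x) (Dw x + basisVec i) +
            cellField B x ω • app (C x) (Dv x ω)) =
        η⁻¹ • (app (perturbed A C (cellField B) x ω) (Du x ω + basisVec i) -
          app (A x) (Dw x + basisVec i)) -
          (app (A x) (Dv x ω) + cellField B₀ x ω • app (C x) (Dw x + basisVec i)) := fun x ω => by
      simp only [perturbed, add_app, smul_app, app_sub, app_smul, app_add]
      module
    simp only [h1]
    rw [ip_sub_left ((hAu.sub hAw).const_smul _) hAv hδ2, ip_smul_left, ip_sub_left hAu hAw hδ2,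
      ip_comm _ fun x ω => η⁻¹ • (Du x ω - Dw x) - Dv x ω,
      ip_comm (fun x _ => app (A x) (Dw x + basisVec i)),
      ip_comm (fun x ω => app (A x) (Dv x ω) + _),
      ip_eq_zero hδ2 hAu hδ.2 (hu.eqn.mono fun ω hω => negDivEqDiv_zero.1 hω),
      ip_eq_zero hδ2 hAw hδ.2 (Eventually.of_forall fun _ => hw.divFree),
      ip_eq_zero hδ2 hAv hδ.2 (h.ae_divFree_randomResponse hB₀ hw hv)]
    ring
  refine ⟨hδ2, (norm_le_of_ip_eq_zero hst hb h.coer_pos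
    ((h.ae_elliptic_perturbed hBM).mono fun p hp ξ => (hp ξ).1) hδ2 hF horth).trans ?_⟩
  have hX : MemLp (fun ω => η⁻¹ * B ω - B₀ ω) 2 P := (hB2.const_mul _).sub hB₀
  have hYc := hYl _ isCompact_cell
  have hX2 := memLp_smul_prod hX hYc
  have hae : Function.uncurry (fun x ω =>
        η⁻¹ • (cellField B x ω • app (C x) (Dw x + basisVec i)) -
          cellField B₀ x ω • app (C x) (Dw x + basisVec i) +
          cellField B x ω • app (C x) (Dv x ω)) =ᵐ[cellMeasure d P]
      (fun p : Space d × Ω => (η⁻¹ * B p.2 - B₀ p.2) • app (C p.1) (Dw p.1 + basisVec i)) +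
        fun p : Space d × Ω => B p.2 • app (C p.1) (Dv p.1 p.2) := by
    filter_upwards [uncurry_cellField_ae (P := P) B, uncurry_cellField_ae (P := P) B₀] with p h1 h2
    simp only [Function.uncurry] at h1 h2
    simp only [Function.uncurry, h1, h2, Pi.add_apply, sub_smul, mul_smul]
  have hBC : MemLp (fun p : Space d × Ω => B p.2 • app (C p.1) (Dv p.1 p.2)) 2
      (cellMeasure d P) := by
    refine (memLp_congr_ae ?_).1 hbCv.memLp
    filter_upwards [uncurry_cellField_ae (P := P) B] with p h1
    simp only [Function.uncurry] at h1
    simp only [Function.uncurry, h1]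
  rw [eLpNorm_congr_ae hae, ← toReal_eLpNorm_smul_prod hX hYc,
    ← ENNReal.toReal_add hX2.2.ne hBC.2.ne]
  refine div_le_div_of_nonneg_right ?_ h.coer_pos.le
  exact ENNReal.toReal_mono (ENNReal.add_ne_top.2 ⟨hX2.2.ne, hBC.2.ne⟩)
    (eLpNorm_add_le hX2.1 hBC.1 (by norm_num))

/-- The second-order expansion. -/
theorem isLittleO_expansion (h : IsCoefficientPair A C M α β)
    (hw : IsPeriodicCorrector A i w Dw)
    (hwt : IsPeriodicCorrector (fun x => (A x).transpose) j wt Dwt)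
    {B : ℝ → Ω → ℝ} {B₀ R₀ : Ω → ℝ}
    (hB_meas : ∀ η > 0, AEStronglyMeasurable (B η) P)
    (hB_bdd : ∀ η > 0, ∀ᵐ ω ∂P, |B η ω| ≤ M)
    (hB₀ : MemLp B₀ 2 P) (hR₀ : MemLp R₀ 2 P)
    (hB_expansion : ∀ X : Ω → ℝ, MemLp X 2 P →
      (fun η : ℝ => ∫ ω, (B η ω - η * B₀ ω - η ^ 2 * R₀ ω) * X ω ∂P)
        =o[𝓝[>] 0] (fun η : ℝ => η ^ 2))
    (hv : IsRandomResponse P A C i (cellField B₀) Dw v Dv)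
    {wη : ℝ → Space d → Ω → ℝ} {Dwη : ℝ → Space d → Ω → Space d}
    (hη : ∀ η > 0, IsCorrector P (perturbed A C (cellField (B η))) i (wη η) (Dwη η)) :
    (fun η : ℝ =>
      homogenized P (perturbed A C (cellField (B η))) i (Dwη η) j
        - periodicHomogenized A i Dw j
        - η * firstOrder P A C i (cellField B₀) Dw Dv j
        - η ^ 2 * secondOrder P C i j (cellField B₀) (cellField R₀) Dw Dwt Dv)
      =o[𝓝[>] 0] (fun η : ℝ => η ^ 2) := by
  have hB2 : ∀ η > 0, MemLp (B η) 2 P := fun η h0 => MemLp.of_bound (hB_meas η h0) M (hB_bdd η h0)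
  have hq := tendsto_eLpNorm_of_weak_expansion hB2 hB₀ hR₀ hB_expansion
  have hB0 := tendsto_eLpNorm_of_difference_quotient hB2 hB₀ hq
  have hv2 := hv.isGrad.isL2Field
  set Z : Space d → Space d := fun x => app (C x).transpose (Dwt x + basisVec j) with hZ
  have hZl : LocallyL2 Z := h.locallyL2_right_transpose hwt
  have hZc := hZl _ isCompact_cell
  set δ : ℝ → Space d → Ω → Space d := fun η x ω => η⁻¹ • (Dwη η x ω - Dw x) - Dv x ω with hδ
  have hδe := fun η (h0 : 0 < η) => h.corrector_remainder_le hw (hB_meas η h0) (hB_bdd η h0) hB₀ hv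
    (hη η h0) (η := η)
  have hCv : MemLp (fun p : Space d × Ω => app (C p.1) (Dv p.1 p.2)) 2 (cellMeasure d P) :=
    (h.right.comp_fst P).memLp hv2.memLp
  have hδ0 : Tendsto (fun η => (eLpNorm (Function.uncurry (δ η)) 2 (cellMeasure d P)).toReal)
      (𝓝[>] 0) (𝓝 0) := by
    have h1 := ((hq.mul_const (eLpNorm (fun x => app (C x) (Dw x + basisVec i)) 2
      (volume.restrict (cell d))).toReal).add (tendsto_eLpNorm_smul hB2 hB_bdd hB0 hCv)).div_const α
    rw [zero_mul, add_zero, zero_div] at h1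
    refine squeeze_zero' (Eventually.of_forall fun _ => ENNReal.toReal_nonneg) ?_ h1
    filter_upwards [self_mem_nhdsWithin] with η h0 using (hδe η h0).2
  have hwg : IsStationaryGradient P (fun x (_ : Ω) => w x) fun x _ => Dw x :=
    hw.isGrad.isStationaryGradient hw.periodic
  have hW : IsL2Field P fun x (_ : Ω) => Dw x + basisVec i :=
    hwg.isL2Field.add (isL2Field_const _)
  -- the three contributions
  have t1 : (fun η => wip P Z (fun ω => B η ω - η * B₀ ω - η ^ 2 * R₀ ω)
      fun x _ => Dw x + basisVec i) =o[𝓝[>] 0] (fun η : ℝ => η ^ 2) := by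
    simp only [wip_const]
    have := hB_expansion (fun _ => 1) (memLp_const 1)
    simp only [mul_one] at this
    simpa only [mul_comm] using this.const_mul_left
      (∫ x in cell d, inner ℝ (Dw x + basisVec i) (Z x))
  -- Strong convergence of B_η/η, tested against the first-order corrector.
  have t2 : Tendsto (fun η => wip P Z (fun ω => η⁻¹ * B η ω - B₀ ω) Dv) (𝓝[>] 0) (𝓝 0) := by
    have h1 := (hq.mul_const (eLpNorm Z 2 (volume.restrict (cell d))).toReal).mul_const
      (eLpNorm (Function.uncurry Dv) 2 (cellMeasure d P)).toReal
    rw [zero_mul, zero_mul] at h1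
    refine squeeze_zero_norm' ?_ h1
    filter_upwards [self_mem_nhdsWithin] with η h0
    have hX : MemLp (fun ω => η⁻¹ * B η ω - B₀ ω) 2 P := ((hB2 η h0).const_mul _).sub hB₀
    rw [Real.norm_eq_abs, ← toReal_eLpNorm_smul_prod hX hZc]
    exact abs_wip_le hX hZl hv2
  -- Here B_η/η stays bounded in L² while the corrector remainder tends to 0.
  have t3 : Tendsto (fun η => wip P Z (fun ω => η⁻¹ * B η ω) (δ η)) (𝓝[>] 0) (𝓝 0) := by
    have h1 := ((hq.add_const (eLpNorm B₀ 2 P).toReal).mul_const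
      (eLpNorm Z 2 (volume.restrict (cell d))).toReal).mul hδ0
    rw [mul_zero] at h1
    refine squeeze_zero_norm' ?_ h1
    filter_upwards [self_mem_nhdsWithin] with η h0
    have hX : MemLp (fun ω => η⁻¹ * B η ω) 2 P := (hB2 η h0).const_mul _
    have hX' : MemLp (fun ω => η⁻¹ * B η ω - B₀ ω) 2 P := hX.sub hB₀
    rw [Real.norm_eq_abs]
    refine (abs_wip_le hX hZl (hδe η h0).1).trans ?_
    rw [toReal_eLpNorm_smul_prod hX hZc]
    gcongr
    rw [← ENNReal.toReal_add hX'.2.ne hB₀.2.ne]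
    refine ENNReal.toReal_mono (ENNReal.add_ne_top.2 ⟨hX'.2.ne, hB₀.2.ne⟩) ?_
    refine le_trans (le_of_eq ?_) (eLpNorm_add_le hX'.1 hB₀.1 (by norm_num))
    congr 1
    funext ω
    simp
  have t4 := (Asymptotics.isBigO_refl (fun η : ℝ => η ^ 2) (𝓝[>] 0)).mul_isLittleO
    ((Asymptotics.isLittleO_one_iff ℝ).2 (t2.add t3 |>.trans (by rw [add_zero])))
  simp only [mul_one] at t4
  refine (t1.add t4).congr' ?_ EventuallyEq.rfl
  filter_upwards [self_mem_nhdsWithin] with η h0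
  have h0 : 0 < η := h0
  have hBη := hB2 η h0
  rw [h.homogenized_sub_eq_wip hw hwt (hB_meas η h0) (hB_bdd η h0) (hη η h0),
    h.firstOrder_eq_wip hw hwt hB₀ hv, h.secondOrder_eq_wip hwt hB₀ hv]
  -- By definition of δ, ∇w^η + e_i = (∇w⁰ + e_i) + η∇v⁰ + ηδ_η.
  have e1 : wip P Z (B η) (fun x ω => Dwη η x ω + basisVec i) =
      wip P Z (B η) (fun x _ => Dw x + basisVec i) + η * wip P Z (B η) Dv +
        η * wip P Z (B η) (δ η) := by
    rw [← wip_add_smul_right hBη hZl hW hv2, ← wip_add_smul_right hBη hZl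
      (hW.add (hv2.const_smul η)) (hδe η h0).1]
    congr 1
    funext x ω
    simp only [smul_sub, smul_smul, mul_inv_cancel₀ h0.ne', one_smul]
    abel
  have e2 : wip P Z (fun ω => B η ω - η * B₀ ω - η ^ 2 * R₀ ω) (fun x _ => Dw x + basisVec i) =
      wip P Z (B η) (fun x _ => Dw x + basisVec i) +
        (-η) * wip P Z B₀ (fun x _ => Dw x + basisVec i) +
        (-η ^ 2) * wip P Z R₀ (fun x _ => Dw x + basisVec i) := by
    have hs : MemLp (fun ω => B η ω + -η * B₀ ω) 2 P := hBη.add (hB₀.const_mul (-η))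
    rw [← wip_add_mul_left hBη hB₀ hZl hW, ← wip_add_mul_left hs hR₀ hZl hW]
    congr 1
    funext ω
    ring
  have e3 : wip P Z (fun ω => η⁻¹ * B η ω - B₀ ω) Dv =
      η⁻¹ * wip P Z (B η) Dv - wip P Z B₀ Dv := by
    have h1 := wip_add_mul_left (X := fun ω => -B₀ ω) hB₀.neg hBη hZl hv2 η⁻¹
    have h2 := wip_add_mul_left (X := fun _ : Ω => (0 : ℝ)) (memLp_const 0) hB₀ hZl hv2 (-1)
    have h3 : wip P Z (fun _ : Ω => (0 : ℝ)) Dv = 0 := by simp [wip]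
    simp only [h3, zero_add, neg_one_mul] at h2
    rw [h2] at h1
    rw [show (fun ω => η⁻¹ * B η ω - B₀ ω) = fun ω => -B₀ ω + η⁻¹ * B η ω from
      funext fun ω => by ring, h1]
    ring
  have e4 : wip P Z (fun ω => η⁻¹ * B η ω) (δ η) = η⁻¹ * wip P Z (B η) (δ η) := by
    simp only [wip, mul_assoc, integral_const_mul]
  rw [e1, e2, e3, e4]
  field_simp
  ring

end IsCoefficientPair

end SecondOrder

end WeakRandomHom

/-! ### The main theorem -/

theorem corollary4 {d : ℕ} {Ω : Type*} [MeasurableSpace Ω] (P : Measure Ω)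
    [IsProbabilityMeasure P] [AddAction (Fin d → ℤ) Ω] [MeasurableConstVAdd (Fin d → ℤ) Ω]
    [ErgodicVAdd (Fin d → ℤ) Ω P]
    (A C : Space d → Matrix (Fin d) (Fin d) ℝ)
    (hA_meas : ∀ i j, AEMeasurable (fun x => A x i j))
    (hC_meas : ∀ i j, AEMeasurable (fun x => C x i j))
    (hA_per : IsPeriodic A) (hC_per : IsPeriodic C)
    (M α β : ℝ) (hM : 0 < M) (hα : 0 < α) (hαβ : α ≤ β)
    (h_coercive : ∀ ξ : Space d, ∀ᵐ x, ∀ s ∈ Set.Icc (-M) M,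
      α * ‖ξ‖ ^ 2 ≤ inner ℝ (app (A x + s • C x) ξ) ξ)
    (h_bounded : ∀ ξ : Space d, ∀ᵐ x, ∀ s ∈ Set.Icc (-M) M,
      ‖app (A x + s • C x) ξ‖ ≤ β * ‖ξ‖)
    (B : ℝ → Ω → ℝ) (B₀ R₀ : Ω → ℝ)
    (hB_meas : ∀ η > 0, AEStronglyMeasurable (B η) P)
    (hB_bdd : ∀ η > 0, ∀ᵐ ω ∂P, |B η ω| ≤ M)
    (hB₀ : MemLp B₀ 2 P) (hR₀ : MemLp R₀ 2 P)
    (hB_expansion : ∀ X : Ω → ℝ, MemLp X 2 P →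
      (fun η : ℝ => ∫ ω, (B η ω - η * B₀ ω - η ^ 2 * R₀ ω) * X ω ∂P)
        =o[𝓝[>] 0] (fun η : ℝ => η ^ 2))
    (h_cov : Summable (fun k : Fin d → ℤ => |cov[B₀, fun ω => B₀ (k +ᵥ ω); P]|)) :
    -- all the problems that enter the expansion and the formula are solvable
    (∀ i : Fin d,
      (∃ w Dw, IsPeriodicCorrector A i w Dw) ∧
      (∃ wt Dwt, IsPeriodicCorrector (fun x => (A x).transpose) i wt Dwt) ∧
      (∀ η > 0, ∃ wη Dwη, IsCorrector P
        (perturbed A C (cellField (B η))) i wη Dwη) ∧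
      ∀ w Dw, IsPeriodicCorrector A i w Dw →
        (∃ v Dv, IsRandomResponse P A C i
          (cellField B₀) Dw v Dv) ∧
        (∃ s Ds, IsPeriodicResponse A C i Dw s Ds) ∧
        (∃ t Dt, IsDefectSolution A C i Dw t Dt)) ∧
    -- whichever solutions are chosen, the deterministic formula holds
    ∀ (i j : Fin d) (w : Space d → ℝ)
      (Dw : Space d → Space d),
      IsPeriodicCorrector A i w Dw →
    ∀ (wt : Space d → ℝ)
      (Dwt : Space d → Space d),
      IsPeriodicCorrector (fun x => (A x).transpose) j wt Dwt →
    ∀ (v : Space d → Ω → ℝ)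
      (Dv : Space d → Ω → Space d),
      IsRandomResponse P A C i (cellField B₀) Dw v Dv →
    ∀ (s : Space d → ℝ)
      (Ds : Space d → Space d),
      IsPeriodicResponse A C i Dw s Ds →
    ∀ (t : Space d → ℝ)
      (Dt : Space d → Space d),
      IsDefectSolution A C i Dw t Dt →
      Summable (fun k : {k : Fin d → ℤ // k ≠ 0} =>
        covTerm P C j B₀ Dwt Dt k) ∧
      secondOrder P C i j (cellField B₀)
          (cellField R₀) Dw Dwt Dv =
        deterministicSecondOrder P C i j B₀ R₀ Dw Dwt Ds Dt ∧
      -- and it is the second-order coefficient of the homogenized tensor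
      ∀ (wη : ℝ → Space d → Ω → ℝ)
        (Dwη : ℝ → Space d → Ω → Space d),
        (∀ η > 0, IsCorrector P
          (perturbed A C (cellField (B η))) i (wη η) (Dwη η)) →
        (fun η : ℝ =>
          homogenized P
              (perturbed A C (cellField (B η))) i (Dwη η) j
            - periodicHomogenized A i Dw j
            - η * firstOrder P A C i (cellField B₀) Dw Dv j
            - η ^ 2 * deterministicSecondOrder P C i j B₀ R₀ Dw Dwt Ds Dt)
          =o[𝓝[>] 0] (fun η : ℝ => η ^ 2) := by
  have h : IsCoefficientPair A C M α β :=
    ⟨hA_meas, hC_meas, hA_per, hC_per, hM, hα, ae_isElliptic h_coercive h_bounded⟩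
  refine ⟨fun i => ⟨exists_isPeriodicCorrector h.per_left h.left hα h.coercive i,
    exists_isPeriodicCorrector (h.per_left.comp Matrix.transpose) h.left.transpose hα
      h.coercive_transpose i,
    fun η hη => h.exists_isCorrector (hB_meas η hη) (hB_bdd η hη) i,
    fun w Dw hw => ⟨h.exists_isRandomResponse hB₀ hw, h.exists_isPeriodicResponse hw,
      h.exists_isDefectSolution hw⟩⟩,
    fun i j w Dw hw wt Dwt hwt v Dv hv s Ds hs t Dt ht => ?_⟩
  obtain ⟨hsum, heq⟩ := h.secondOrder_eq (R := R₀) hw hwt hB₀ h_cov hv hs ht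
  refine ⟨hsum, heq, fun wη Dwη hη => ?_⟩
  rw [← heq]
  exact h.isLittleO_expansion hw hwt hB_meas hB_bdd hB₀ hR₀ hB_expansion hv hη
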